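/- For a function $h:\mathbb{R}\to[0,\infty)$ let $\Omega_h=\{(x,y)\in\mathbb{R}^2: 0<y<h(x)\}$, and let $\int_{\mathbb{R}}|h'|:=\sup\{\sum_{i=1}^n|h(x_i)-h(x_{i-1})| : x_0<x_1<\dots<x_n\}$ be its pointwise variation. For $V>0$ let $\mathcal{A}^\ell_V$ be the set of all pairs $(u,h)$ such that $h\in L^1(\mathbb{R})$ is lower semicontinuous, nonnegative and of bounded pointwise variation, $\int_{\mathbb{R}}h\,dx=V$, $u\in H^1(\Omega_h)$, and $u(x,0)=x$ for almost every $x$ with $h(x)>0$, in the sense of traces. Put $$F_\ell(V):=\inf\Big\{\int_{\Omega_h}|\nabla u|^2\,dx\,dy+\int_{\mathbb{R}}|h'| \;:\; (u,h)\in\mathcal{A}^\ell_V\Big\}.$$ **Proposition.** Let $V>0$ be such that $F_\ell(V)<V$. Then there exists a minimizer, i.e. a pair $(u,h)\in\mathcal{A}^\ell_V$ with $$\int_{\Omega_h}|\nabla u|^2\,dx\,dy+\int_{\mathbb{R}}|h'|=F_\ell(V).$$ -/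

import Mathlib

open MeasureTheory Set
open scoped ENNReal ContDiff

namespace IslandFilm

/-- The region occupied by the film with height profile `h`: the open subgraph. -/
def subgraph (h : ℝ → ℝ) : Set (ℝ × ℝ) := {p | 0 < p.2 ∧ p.2 < h p.1}

/-- `v` is the weak partial derivative of `u` on the open set `Ω` in the direction `e`. -/
def IsWeakPartial (Ω : Set (ℝ × ℝ)) (e : ℝ × ℝ) (u v : ℝ × ℝ → ℝ) : Prop :=
  LocallyIntegrableOn u Ω ∧ LocallyIntegrableOn v Ω ∧
    ∀ φ : ℝ × ℝ → ℝ, ContDiff ℝ ∞ φ → HasCompactSupport φ → tsupport φ ⊆ Ω →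
      ∫ p in Ω, u p * fderiv ℝ φ p e = - ∫ p in Ω, v p * φ p

/-- Weak partial derivatives are unique almost everywhere. -/
theorem IsWeakPartial.ae_eq {Ω : Set (ℝ × ℝ)} (hΩ : IsOpen Ω) {e : ℝ × ℝ}
    {u v w : ℝ × ℝ → ℝ} (hv : IsWeakPartial Ω e u v) (hw : IsWeakPartial Ω e u w) :
    ∀ᵐ p ∂(volume.restrict Ω), v p = w p := by
  have key : ∀ᵐ p ∂(volume : Measure (ℝ × ℝ)), p ∈ Ω → (v - w) p = 0 := by
    refine hΩ.ae_eq_zero_of_integral_contDiff_smul_eq_zero (hv.2.1.sub hw.2.1) ?_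
    intro φ hφ hc hs
    have int_of : ∀ f : ℝ × ℝ → ℝ, LocallyIntegrableOn f Ω →
        IntegrableOn (fun p => f p * φ p) Ω := by
      intro f hf
      have h1 : IntegrableOn f (tsupport φ) := hf.integrableOn_compact_subset hs hc
      have h2 : IntegrableOn (fun p => f p * φ p) (tsupport φ) :=
        h1.mul_continuousOn hφ.continuous.continuousOn hc
      have h3 : Integrable (fun p => f p * φ p) := by
        refine (integrableOn_iff_integrable_of_support_subset ?_).1 h2
        intro p hp
        exact subset_tsupport φ (fun h0 => hp (by simp [h0]))
      exact h3.integrableOn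
    have e1 : ∫ p in Ω, v p * φ p = ∫ p in Ω, w p * φ p := by
      have := hv.2.2 φ hφ hc hs
      have := hw.2.2 φ hφ hc hs
      linarith
    have e2 : ∫ p, φ p • (v - w) p = ∫ p in Ω, φ p • (v - w) p := by
      symm
      refine setIntegral_eq_integral_of_forall_compl_eq_zero ?_
      intro p hp
      have : φ p = 0 := image_eq_zero_of_notMem_tsupport (fun h => hp (hs h))
      simp [this]
    rw [e2]
    have e3 : (fun p => φ p • (v - w) p) = fun p => v p * φ p - w p * φ p := by
      funext p
      simp only [Pi.sub_apply, smul_eq_mul]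
      ring
    rw [e3, integral_sub (int_of v hv.2.1) (int_of w hw.2.1), e1, sub_self]
  rw [ae_restrict_iff' hΩ.measurableSet]
  filter_upwards [key] with p hp hpΩ
  have := hp hpΩ
  simp only [Pi.sub_apply] at this
  linarith

open Classical in
/-- A representative of the weak partial derivative in the direction `e` (zero if there is none). -/
noncomputable def weakPartial (Ω : Set (ℝ × ℝ)) (e : ℝ × ℝ) (u : ℝ × ℝ → ℝ) : ℝ × ℝ → ℝ :=
  if H : ∃ v, IsWeakPartial Ω e u v then H.choose else 0

/-- The Sobolev space `H¹(Ω)`. -/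
def MemH1 (Ω : Set (ℝ × ℝ)) (u : ℝ × ℝ → ℝ) : Prop :=
  MemLp u 2 (volume.restrict Ω) ∧
    (∃ v, IsWeakPartial Ω (1, 0) u v ∧ MemLp v 2 (volume.restrict Ω)) ∧
    ∃ v, IsWeakPartial Ω (0, 1) u v ∧ MemLp v 2 (volume.restrict Ω)

/-- The elastic energy, the integral of `|∇u|²` over the film. -/
noncomputable def elasticEnergy (u : ℝ × ℝ → ℝ) (h : ℝ → ℝ) : ℝ≥0∞ :=
  ∫⁻ p in subgraph h, ENNReal.ofReal
    ((weakPartial (subgraph h) (1, 0) u p) ^ 2 + (weakPartial (subgraph h) (0, 1) u p) ^ 2)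

/-- The trace of `u ∈ H¹(subgraph h)` on the part `{(x, 0) | 0 < h x}` of the boundary is `g`,
expressed through the Green formula: the test functions need not vanish at this part of the
boundary, but they vanish near the rest of it. -/
def HasBottomTrace (h : ℝ → ℝ) (u : ℝ × ℝ → ℝ) (g : ℝ → ℝ) : Prop :=
  ∀ φ : ℝ × ℝ → ℝ, ContDiff ℝ ∞ φ → HasCompactSupport φ →
    tsupport φ ⊆ {p : ℝ × ℝ | 0 < h p.1 ∧ p.2 < h p.1} →
      ∫ p in subgraph h, u p * fderiv ℝ φ p (0, 1) =
        - (∫ p in subgraph h, weakPartial (subgraph h) (0, 1) u p * φ p) - ∫ x, g x * φ (x, 0)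

/-- The admissible pairs `(u, h)` of volume `V`. -/
def admissible (V : ℝ) : Set ((ℝ × ℝ → ℝ) × (ℝ → ℝ)) :=
  {q | Integrable q.2 ∧ BoundedVariationOn q.2 univ ∧ LowerSemicontinuous q.2 ∧
    (∀ x, 0 ≤ q.2 x) ∧ MemH1 (subgraph q.2) q.1 ∧ ∫ x, q.2 x = V ∧
    HasBottomTrace q.2 q.1 (fun x => x)}

/-- Elastic energy plus surface energy. The surface energy is the pointwise variation of the
lower semicontinuous function `h`, so a vertical cut counts with twice its length. -/
noncomputable def energy (q : (ℝ × ℝ → ℝ) × (ℝ → ℝ)) : ℝ≥0∞ :=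
  elasticEnergy q.1 q.2 + eVariationOn q.2 univ

/-- The minimal energy for the volume `V`. -/
noncomputable def minEnergy (V : ℝ) : ℝ≥0∞ := ⨅ q ∈ admissible V, energy q

end IslandFilm

namespace IslandFilm

open Filter Topology

/-! The displacement is eliminated by convex duality. For a stream function `ψ` whose support lies
in the film but may cross the bottom, the field `(ψ_y, -ψ_x)` is divergence-free and tangent to the
free surface. Its pairing with `∇u` therefore sees only the datum `u(x,0) = x` and equals `∫ ψ_y`.
By Young's inequality the elastic energy is at least `∫ (2 ψ_y - |∇ψ|²)`
(`ofReal_dualEnergy_le_elasticEnergy`). The supremum of this quantity, `elastic h`, is attained by a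
displacement when the film is bounded and confined: project the field `(1,0)` onto the closure of
the tangential fields, and integrate the projection vertically (`exists_optimal_field`,
`exists_displacement`). What remains is to minimize `elastic h + totalVar h` over profiles `h`
alone.

On a fixed interval the direct method works. The epi-limit of a minimizing sequence along an
ultrafilter is lower semicontinuous, the variation passes to the limit through recovery points, and
the volume converges by comparison of Riemann sums. The elastic part is lower semicontinuous because
a compactly supported stream function of the limit film is eventually one of the approximating films
(`exists_confined_minimizer`).

Mass could still be lost by spreading over ever longer intervals, and this is where energy below `V`
enters. A film of height at most `s` has elastic energy at least its volume minus `C s` times its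
variation (`exists_thin_film_bound`): spread-out film costs almost its full volume, which is more
than the average cost in a minimizer. Removing a thin piece and stretching the rest back to volume
`V` gives `cut_inequality`. On sufficiently long thin intervals it yields `∫ h ≤ c (h a + h b)²`
(`volume_le_sq_of_thin`). For `A(r) = ∫_{m-r}^{m+r} h` this is the differential inequality `A' ≥ κ
√A`. Since `√A` would grow linearly but is at most `√V`, the film must vanish near `m`.

Hence a minimizer on any sufficiently long interval has a gap of unit length (`exists_gap`). Closing
the gap shortens the interval by one without raising the energy (`exists_closed_gap`), so by
induction one fixed interval is optimal among all intervals (`exists_minimizer_compact`). Truncation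
followed by stretching approximates arbitrary profiles by confined ones (`exists_confined_approx`),
which finishes the proof. -/

/-! ### Partial derivatives of test functions and integration by parts on the half-plane -/

/-- Partial derivative in the first variable. -/
noncomputable def dx (ψ : ℝ × ℝ → ℝ) (p : ℝ × ℝ) : ℝ := fderiv ℝ ψ p (1, 0)

/-- Partial derivative in the second variable. -/
noncomputable def dy (ψ : ℝ × ℝ → ℝ) (p : ℝ × ℝ) : ℝ := fderiv ℝ ψ p (0, 1)

/-- The open upper half-plane. -/
def upperHalf : Set (ℝ × ℝ) := {p | 0 < p.2}

theorem upperHalf_eq : upperHalf = (univ : Set ℝ) ×ˢ Ioi (0 : ℝ) := by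
  ext p; simp [upperHalf]

theorem isOpen_upperHalf : IsOpen upperHalf := isOpen_lt continuous_const continuous_snd

theorem contDiff_dx {ψ : ℝ × ℝ → ℝ} (h : ContDiff ℝ ∞ ψ) : ContDiff ℝ ∞ (dx ψ) :=
  (h.fderiv_right (m := ∞) (by simp)).clm_apply contDiff_const

theorem contDiff_dy {ψ : ℝ × ℝ → ℝ} (h : ContDiff ℝ ∞ ψ) : ContDiff ℝ ∞ (dy ψ) :=
  (h.fderiv_right (m := ∞) (by simp)).clm_apply contDiff_const

theorem tsupport_dx (ψ : ℝ × ℝ → ℝ) : tsupport (dx ψ) ⊆ tsupport ψ :=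
  tsupport_fderiv_apply_subset ℝ (1, 0)

theorem tsupport_dy (ψ : ℝ × ℝ → ℝ) : tsupport (dy ψ) ⊆ tsupport ψ :=
  tsupport_fderiv_apply_subset ℝ (0, 1)

theorem compact_dx {ψ : ℝ × ℝ → ℝ} (h : HasCompactSupport ψ) : HasCompactSupport (dx ψ) :=
  h.mono' ((subset_tsupport _).trans (tsupport_dx ψ))

theorem compact_dy {ψ : ℝ × ℝ → ℝ} (h : HasCompactSupport ψ) : HasCompactSupport (dy ψ) :=
  h.mono' ((subset_tsupport _).trans (tsupport_dy ψ))

theorem dx_eq_zero {ψ : ℝ × ℝ → ℝ} {p : ℝ × ℝ} (h : p ∉ tsupport ψ) : dx ψ p = 0 :=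
  image_eq_zero_of_notMem_tsupport fun h' => h (tsupport_dx ψ h')

theorem dy_eq_zero {ψ : ℝ × ℝ → ℝ} {p : ℝ × ℝ} (h : p ∉ tsupport ψ) : dy ψ p = 0 :=
  image_eq_zero_of_notMem_tsupport fun h' => h (tsupport_dy ψ h')

theorem hasDerivAt_dx {ψ : ℝ × ℝ → ℝ} (h : ContDiff ℝ ∞ ψ) (x y : ℝ) :
    HasDerivAt (fun t => ψ (t, y)) (dx ψ (x, y)) x := by
  have h1 : HasFDerivAt ψ (fderiv ℝ ψ (x, y)) (x, y) :=
    (h.differentiable (by simp)).differentiableAt.hasFDerivAt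
  exact h1.comp_hasDerivAt x ((hasDerivAt_id x).prodMk (hasDerivAt_const x y))

theorem hasDerivAt_dy {ψ : ℝ × ℝ → ℝ} (h : ContDiff ℝ ∞ ψ) (x y : ℝ) :
    HasDerivAt (fun t => ψ (x, t)) (dy ψ (x, y)) y := by
  have h1 : HasFDerivAt ψ (fderiv ℝ ψ (x, y)) (x, y) :=
    (h.differentiable (by simp)).differentiableAt.hasFDerivAt
  exact h1.comp_hasDerivAt y ((hasDerivAt_const y x).prodMk (hasDerivAt_id y))

theorem dx_dy_comm {ψ : ℝ × ℝ → ℝ} (h : ContDiff ℝ ∞ ψ) (p : ℝ × ℝ) :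
    dx (dy ψ) p = dy (dx ψ) p := by
  have hs : IsSymmSndFDerivAt ℝ ψ p :=
    h.contDiffAt.isSymmSndFDerivAt (by simpa using WithTop.coe_le_coe.2 (le_top : (2 : ℕ∞) ≤ ⊤))
  have hd : DifferentiableAt ℝ (fderiv ℝ ψ) p :=
    ((h.fderiv_right (m := ∞) (by simp)).differentiable (by simp)).differentiableAt
  have e1 : dx (dy ψ) p = fderiv ℝ (fderiv ℝ ψ) p (1, 0) (0, 1) := by
    unfold dx dy
    rw [fderiv_clm_apply hd (by fun_prop)]
    simp
  have e2 : dy (dx ψ) p = fderiv ℝ (fderiv ℝ ψ) p (0, 1) (1, 0) := by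
    unfold dx dy
    rw [fderiv_clm_apply hd (by fun_prop)]
    simp
  rw [e1, e2, hs.eq]

theorem compact_slice_left {φ : ℝ × ℝ → ℝ} (hc : HasCompactSupport φ) (y : ℝ) :
    HasCompactSupport fun x => φ (x, y) := by
  refine HasCompactSupport.intro (hc.isCompact.image continuous_fst) fun x hx => ?_
  exact image_eq_zero_of_notMem_tsupport fun h => hx ⟨_, h, rfl⟩

theorem compact_slice_right {φ : ℝ × ℝ → ℝ} (hc : HasCompactSupport φ) (x : ℝ) :
    HasCompactSupport fun y => φ (x, y) := by
  refine HasCompactSupport.intro (hc.isCompact.image continuous_snd) fun y hx => ?_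
  exact image_eq_zero_of_notMem_tsupport fun h => hx ⟨_, h, rfl⟩

theorem setIntegral_upperHalf {f : ℝ × ℝ → ℝ} (hf : IntegrableOn f upperHalf) :
    ∫ p in upperHalf, f p = ∫ x, ∫ y in Ioi (0 : ℝ), f (x, y) := by
  rw [upperHalf_eq] at hf ⊢
  rw [Measure.volume_eq_prod] at hf ⊢
  rw [setIntegral_prod f hf]
  simp

theorem setIntegral_upperHalf_symm {f : ℝ × ℝ → ℝ} (hf : IntegrableOn f upperHalf) :
    ∫ p in upperHalf, f p = ∫ y in Ioi (0 : ℝ), ∫ x, f (x, y) := by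
  rw [upperHalf_eq] at hf ⊢
  rw [Measure.volume_eq_prod] at hf ⊢
  unfold IntegrableOn at hf
  rw [← Measure.prod_restrict] at hf ⊢
  rw [integral_prod_symm f hf]
  simp

theorem integrable_of_smooth {f : ℝ × ℝ → ℝ} (hf : ContDiff ℝ ∞ f) (hc : HasCompactSupport f) :
    Integrable f := hf.continuous.integrable_of_hasCompactSupport hc

theorem integral_upperHalf_dy {φ : ℝ × ℝ → ℝ} (h : ContDiff ℝ ∞ φ) (hc : HasCompactSupport φ) :
    ∫ p in upperHalf, dy φ p = - ∫ x, φ (x, 0) := by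
  rw [setIntegral_upperHalf (integrable_of_smooth (contDiff_dy h) (compact_dy hc)).integrableOn,
    ← integral_neg]
  congr 1 with x
  have := HasCompactSupport.integral_Ioi_deriv_eq (f := fun y => φ (x, y))
    ((h.comp (contDiff_prodMk_right x)).of_le (by simp)) (compact_slice_right hc x) 0
  rw [← this]
  congr 1 with y
  exact (hasDerivAt_dy h x y).deriv.symm

theorem integral_dx_slice {φ : ℝ × ℝ → ℝ} (h : ContDiff ℝ ∞ φ) (hc : HasCompactSupport φ) (y : ℝ) :
    ∫ x, dx φ (x, y) = 0 := by
  refine integral_eq_zero_of_hasDerivAt_of_integrable (f := fun x => φ (x, y))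
    (fun x => hasDerivAt_dx h x y) ?_ ?_
  · exact ((contDiff_dx h).continuous.comp (by fun_prop)).integrable_of_hasCompactSupport
      (compact_slice_left (compact_dx hc) y)
  · exact (h.continuous.comp (by fun_prop)).integrable_of_hasCompactSupport
      (compact_slice_left hc y)

theorem dx_mul {f g : ℝ × ℝ → ℝ} (hf : ContDiff ℝ ∞ f) (hg : ContDiff ℝ ∞ g) (p : ℝ × ℝ) :
    dx (fun p => f p * g p) p = dx f p * g p + f p * dx g p := by
  have h1 := (hasDerivAt_dx hf p.1 p.2).mul (hasDerivAt_dx hg p.1 p.2)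
  exact (hasDerivAt_dx (hf.mul hg) p.1 p.2).unique h1

theorem dy_mul {f g : ℝ × ℝ → ℝ} (hf : ContDiff ℝ ∞ f) (hg : ContDiff ℝ ∞ g) (p : ℝ × ℝ) :
    dy (fun p => f p * g p) p = dy f p * g p + f p * dy g p := by
  have h1 := (hasDerivAt_dy hf p.1 p.2).mul (hasDerivAt_dy hg p.1 p.2)
  exact (hasDerivAt_dy (hf.mul hg) p.1 p.2).unique h1

theorem dx_fst (p : ℝ × ℝ) : dx (fun p => p.1) p = 1 :=
  (hasDerivAt_dx contDiff_fst p.1 p.2).unique (hasDerivAt_id _)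

theorem dy_fst (p : ℝ × ℝ) : dy (fun p => p.1) p = 0 :=
  (hasDerivAt_dy contDiff_fst p.1 p.2).unique (hasDerivAt_const _ _)

theorem integral_fst_mul_dx {φ : ℝ × ℝ → ℝ} (h : ContDiff ℝ ∞ φ) (hc : HasCompactSupport φ)
    (y : ℝ) : ∫ x, x * dx φ (x, y) = - ∫ x, φ (x, y) := by
  have h1 := integral_dx_slice (contDiff_fst.mul h) (hc.mul_left (f := fun p : ℝ × ℝ => p.1)) y
  have e : ∀ x : ℝ, dx (fun p => p.1 * φ p) (x, y) = φ (x, y) + x * dx φ (x, y) := fun x => by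
    rw [dx_mul contDiff_fst h, dx_fst]; ring
  have h1' : ∫ x, (φ (x, y) + x * dx φ (x, y)) = 0 := by
    simp only [← e]; exact h1
  rw [integral_add] at h1'
  · linarith
  · exact (h.continuous.comp (by fun_prop)).integrable_of_hasCompactSupport
      (compact_slice_left hc y)
  · exact (continuous_id.mul ((contDiff_dx h).continuous.comp
      (by fun_prop))).integrable_of_hasCompactSupport
      ((compact_slice_left (compact_dx hc) y).mul_left)

theorem integral_upperHalf_fst_mul_dx {φ : ℝ × ℝ → ℝ} (h : ContDiff ℝ ∞ φ)
    (hc : HasCompactSupport φ) :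
    ∫ p in upperHalf, p.1 * dx φ p = - ∫ p in upperHalf, φ p := by
  rw [setIntegral_upperHalf_symm, setIntegral_upperHalf_symm (integrable_of_smooth h hc).integrableOn]
  · simp only [integral_fst_mul_dx h hc, integral_neg]
  · exact (integrable_of_smooth (contDiff_fst.mul (contDiff_dx h))
      (compact_dx hc).mul_left).integrableOn

/-! ### Stream functions, the dual energy and weak duality -/

/-- The film together with the half-line below each of its columns. -/
def filmRegion (h : ℝ → ℝ) : Set (ℝ × ℝ) := {p | 0 < h p.1 ∧ p.2 < h p.1}

/-- Stream functions of divergence-free fields that are tangent to the free surface. -/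
structure IsStream (h : ℝ → ℝ) (ψ : ℝ × ℝ → ℝ) : Prop where
  smooth : ContDiff ℝ ∞ ψ
  compact : HasCompactSupport ψ
  subset : tsupport ψ ⊆ filmRegion h

/-- The integrand of the dual energy. -/
noncomputable def dualDensity (ψ : ℝ × ℝ → ℝ) (p : ℝ × ℝ) : ℝ :=
  2 * dy ψ p - dy ψ p ^ 2 - dx ψ p ^ 2

/-- The dual energy of a stream function. -/
noncomputable def dualEnergy (ψ : ℝ × ℝ → ℝ) : ℝ := ∫ p in upperHalf, dualDensity ψ p

/-- The least elastic energy of a film, expressed by duality. -/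
noncomputable def elastic (h : ℝ → ℝ) : ℝ := sSup (dualEnergy '' {ψ | IsStream h ψ})

theorem isOpen_subgraph {h : ℝ → ℝ} (hl : LowerSemicontinuous h) : IsOpen (subgraph h) := by
  have h1 : IsOpen {p : ℝ × ℝ | p.2 < h p.1} := by
    have := (lowerSemicontinuous_iff_isClosed_epigraph.1 hl).isOpen_compl
    convert this using 1
    ext p; simp
  exact isOpen_upperHalf.inter h1

theorem subgraph_subset_upperHalf (h : ℝ → ℝ) : subgraph h ⊆ upperHalf := fun _ hp => hp.1

theorem filmRegion_inter_upperHalf (h : ℝ → ℝ) : filmRegion h ∩ upperHalf = subgraph h := by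
  ext p
  simp only [filmRegion, upperHalf, subgraph, mem_inter_iff, mem_ofPred_eq]
  constructor
  · rintro ⟨⟨_, h2⟩, h3⟩; exact ⟨h3, h2⟩
  · rintro ⟨h3, h2⟩; exact ⟨⟨h3.trans h2, h2⟩, h3⟩

theorem setIntegral_subgraph {h : ℝ → ℝ} {φ f : ℝ × ℝ → ℝ}
    (hs : tsupport φ ⊆ filmRegion h) (hf : ∀ p, p ∉ tsupport φ → f p = 0) :
    ∫ p in subgraph h, f p = ∫ p in upperHalf, f p := by
  refine (setIntegral_eq_of_subset_of_forall_sdiff_eq_zero isOpen_upperHalf.measurableSet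
    (subgraph_subset_upperHalf h) fun p hp => hf p fun hp' => hp.2 ?_).symm
  rw [← filmRegion_inter_upperHalf]
  exact ⟨hs hp', hp.1⟩

theorem isWeakPartial_weakPartial {Ω : Set (ℝ × ℝ)} {e : ℝ × ℝ} {u v : ℝ × ℝ → ℝ}
    (h : IsWeakPartial Ω e u v) : IsWeakPartial Ω e u (weakPartial Ω e u) := by
  have H : ∃ v, IsWeakPartial Ω e u v := ⟨v, h⟩
  rw [weakPartial, dif_pos H]
  exact H.choose_spec

theorem weakPartial_ae_eq {Ω : Set (ℝ × ℝ)} (hΩ : IsOpen Ω) {e : ℝ × ℝ} {u v : ℝ × ℝ → ℝ}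
    (h : IsWeakPartial Ω e u v) : weakPartial Ω e u =ᵐ[volume.restrict Ω] v :=
  (isWeakPartial_weakPartial h).ae_eq hΩ h

/-- A cutoff that vanishes near the lower half-plane. -/
noncomputable def lowerCutoff (n : ℕ) (p : ℝ × ℝ) : ℝ := Real.smoothTransition (n * p.2 - 1)

theorem contDiff_lowerCutoff (n : ℕ) : ContDiff ℝ ∞ (lowerCutoff n) := by
  unfold lowerCutoff
  exact Real.smoothTransition.contDiff.comp ((contDiff_const.mul contDiff_snd).sub contDiff_const)

theorem dx_lowerCutoff (n : ℕ) (p : ℝ × ℝ) : dx (lowerCutoff n) p = 0 :=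
  (hasDerivAt_dx (contDiff_lowerCutoff n) p.1 p.2).unique
    (hasDerivAt_const p.1 (lowerCutoff n (p.1, p.2)))

theorem tsupport_lowerCutoff_subset (n : ℕ) : tsupport (lowerCutoff n) ⊆ upperHalf := by
  have h1 : tsupport (lowerCutoff n) ⊆ {p | 1 ≤ (n : ℝ) * p.2} := by
    refine closure_minimal (fun p hp => ?_) (isClosed_le (by fun_prop) (by fun_prop))
    by_contra hc
    simp only [mem_ofPred_eq, not_le] at hc
    exact hp (Real.smoothTransition.zero_of_nonpos (by linarith))
  refine h1.trans fun p hp => ?_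
  simp only [mem_ofPred_eq] at hp
  by_contra hc
  have : p.2 ≤ 0 := not_lt.1 hc
  nlinarith [(Nat.cast_nonneg n : (0 : ℝ) ≤ n)]

theorem tendsto_lowerCutoff {p : ℝ × ℝ} (hp : p ∈ upperHalf) :
    Tendsto (fun n => lowerCutoff n p) atTop (𝓝 1) := by
  refine tendsto_const_nhds.congr' ?_
  obtain ⟨N, hN⟩ := exists_nat_ge (2 / p.2)
  filter_upwards [eventually_ge_atTop N] with n hn
  have hp' : (0 : ℝ) < p.2 := hp
  have h2 : 2 / p.2 ≤ n := hN.trans (by exact_mod_cast hn)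
  rw [div_le_iff₀ hp'] at h2
  exact (Real.smoothTransition.one_of_one_le (by linarith)).symm

/-- The horizontal weak derivative can be tested with functions that do not vanish at the bottom: a
cutoff near the bottom depends only on the height, so it produces no extra term under `dx`, and it
is removed by dominated convergence. -/
theorem integral_mul_dx_of_isWeakPartial {h : ℝ → ℝ} (hl : LowerSemicontinuous h)
    {u a φ : ℝ × ℝ → ℝ} (hw : IsWeakPartial (subgraph h) (1, 0) u a)
    (hu : MemLp u 2 (volume.restrict (subgraph h))) (ha : MemLp a 2 (volume.restrict (subgraph h)))
    (hφ : IsStream h φ) :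
    ∫ p in subgraph h, u p * dx φ p = - ∫ p in subgraph h, a p * φ p := by
  have key : ∀ n : ℕ, ∫ p in subgraph h, u p * (dx φ p * lowerCutoff n p)
      = - ∫ p in subgraph h, a p * (φ p * lowerCutoff n p) := by
    intro n
    have := hw.2.2 (fun p => φ p * lowerCutoff n p) (hφ.smooth.mul (contDiff_lowerCutoff n))
      hφ.compact.mul_right ?_
    · rw [← this]
      congr 1 with p
      have := dx_mul hφ.smooth (contDiff_lowerCutoff n) p
      rw [dx_lowerCutoff, mul_zero, add_zero] at this
      rw [← this, dx]
    · rw [← filmRegion_inter_upperHalf]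
      exact subset_inter ((tsupport_mul_subset_left).trans hφ.subset)
        ((tsupport_mul_subset_right).trans (tsupport_lowerCutoff_subset n))
  have lim : ∀ f g : ℝ × ℝ → ℝ, MemLp f 2 (volume.restrict (subgraph h)) → ContDiff ℝ ∞ g →
      HasCompactSupport g →
      Tendsto (fun n => ∫ p in subgraph h, f p * (g p * lowerCutoff n p)) atTop
        (𝓝 (∫ p in subgraph h, f p * g p)) := by
    intro f g hf hg hc
    have hg2 : MemLp g 2 (volume.restrict (subgraph h)) :=
      (hg.continuous.memLp_of_hasCompactSupport hc).restrict _
    refine tendsto_integral_of_dominated_convergence (fun p => ‖f p * g p‖) (fun n => ?_)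
      (hf.integrable_mul hg2).norm (fun n => ?_) ?_
    · exact hf.1.mul ((hg.continuous.mul (contDiff_lowerCutoff n).continuous).aestronglyMeasurable)
    · refine ae_of_all _ fun p => ?_
      rw [← mul_assoc, norm_mul]
      refine mul_le_of_le_one_right (norm_nonneg _) ?_
      rw [lowerCutoff, Real.norm_of_nonneg (Real.smoothTransition.nonneg _)]
      exact Real.smoothTransition.le_one _
    · filter_upwards [self_mem_ae_restrict (isOpen_subgraph hl).measurableSet] with p hp
      have := (tendsto_lowerCutoff (subgraph_subset_upperHalf h hp)).const_mul (f p * g p)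
      simpa [mul_assoc] using this
  have l1 := lim u (dx φ) hu (contDiff_dx hφ.smooth) (compact_dx hφ.compact)
  have l2 := (lim a φ ha hφ.smooth hφ.compact).neg
  simp only [key] at l1
  exact tendsto_nhds_unique l1 l2

theorem IsStream.dx {h : ℝ → ℝ} {ψ : ℝ × ℝ → ℝ} (hψ : IsStream h ψ) : IsStream h (dx ψ) :=
  ⟨contDiff_dx hψ.smooth, compact_dx hψ.compact, (tsupport_dx ψ).trans hψ.subset⟩

theorem IsStream.dy {h : ℝ → ℝ} {ψ : ℝ × ℝ → ℝ} (hψ : IsStream h ψ) : IsStream h (dy ψ) :=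
  ⟨contDiff_dy hψ.smooth, compact_dy hψ.compact, (tsupport_dy ψ).trans hψ.subset⟩

theorem IsStream.memLp {h : ℝ → ℝ} {ψ : ℝ × ℝ → ℝ} (hψ : IsStream h ψ) (μ : Measure (ℝ × ℝ))
    [IsFiniteMeasureOnCompacts μ] : MemLp ψ 2 μ :=
  hψ.smooth.continuous.memLp_of_hasCompactSupport hψ.compact

theorem contDiff_dualDensity {ψ : ℝ × ℝ → ℝ} (hψ : ContDiff ℝ ∞ ψ) :
    ContDiff ℝ ∞ (dualDensity ψ) :=
  ((contDiff_const.mul (contDiff_dy hψ)).sub ((contDiff_dy hψ).pow 2)).sub ((contDiff_dx hψ).pow 2)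

theorem dualDensity_eq_zero {ψ : ℝ × ℝ → ℝ} {p : ℝ × ℝ} (h : p ∉ tsupport ψ) :
    dualDensity ψ p = 0 := by
  simp [dualDensity, dx_eq_zero h, dy_eq_zero h]

theorem compact_dualDensity {ψ : ℝ × ℝ → ℝ} (hψ : HasCompactSupport ψ) :
    HasCompactSupport (dualDensity ψ) :=
  HasCompactSupport.intro hψ.isCompact fun _ hp => dualDensity_eq_zero hp

theorem integrable_dualDensity {ψ : ℝ × ℝ → ℝ} (hψ : ContDiff ℝ ∞ ψ) (hc : HasCompactSupport ψ) :
    Integrable (dualDensity ψ) :=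
  integrable_of_smooth (contDiff_dualDensity hψ) (compact_dualDensity hc)

/-- The gradient of an admissible displacement, tested against a tangential divergence-free
field, only sees the boundary condition. -/
theorem integral_gradient_stream {V : ℝ} {u : ℝ × ℝ → ℝ} {h : ℝ → ℝ}
    (ha : (u, h) ∈ admissible V) {ψ : ℝ × ℝ → ℝ} (hψ : IsStream h ψ) :
    (∫ p in subgraph h, weakPartial (subgraph h) (1, 0) u p * dy ψ p) -
      (∫ p in subgraph h, weakPartial (subgraph h) (0, 1) u p * dx ψ p)
        = ∫ p in upperHalf, dy ψ p := by
  obtain ⟨-, -, hl, -, ⟨hu, ⟨a, ha1, ha2⟩, ⟨b, hb1, hb2⟩⟩, -, htr⟩ := ha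
  simp only at hl hu ha1 ha2 hb1 hb2 htr
  have hΩ := isOpen_subgraph hl
  -- Test the horizontal derivative with `ψ_y` and the vertical one, including its trace term, with
  -- `ψ_x`. The two terms containing `u` cancel because mixed derivatives commute, and only the
  -- integral of `x ψ_x(x,0)` remains.
  have h1 := integral_mul_dx_of_isWeakPartial hl (isWeakPartial_weakPartial ha1) hu
    ((memLp_congr_ae (weakPartial_ae_eq hΩ ha1)).2 ha2) hψ.dy
  have h2 := htr (dx ψ) hψ.dx.smooth hψ.dx.compact hψ.dx.subset
  have h3 : ∫ p in subgraph h, u p * dx (dy ψ) p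
      = ∫ p in subgraph h, u p * fderiv ℝ (dx ψ) p (0, 1) := by
    congr 1 with p
    rw [dx_dy_comm hψ.smooth, dy]
  rw [integral_upperHalf_dy hψ.smooth hψ.compact]
  have h4 := integral_fst_mul_dx hψ.smooth hψ.compact 0
  linarith

/-- Weak duality: `|∇u|² ≥ 2 ∇u · σ - |σ|²` with `σ = (ψ_y, -ψ_x)`, and the cross term is known from
`integral_gradient_stream`. -/
theorem ofReal_dualEnergy_le_elasticEnergy {V : ℝ} {u : ℝ × ℝ → ℝ} {h : ℝ → ℝ}
    (ha : (u, h) ∈ admissible V) {ψ : ℝ × ℝ → ℝ} (hψ : IsStream h ψ) :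
    ENNReal.ofReal (dualEnergy ψ) ≤ elasticEnergy u h := by
  have hid := integral_gradient_stream ha hψ
  obtain ⟨-, -, hl, -, ⟨hu, ⟨a, ha1, ha2⟩, ⟨b, hb1, hb2⟩⟩, -, -⟩ := ha
  simp only at hl hu ha1 ha2 hb1 hb2
  have hΩ := isOpen_subgraph hl
  set A := weakPartial (subgraph h) (1, 0) u
  set B := weakPartial (subgraph h) (0, 1) u
  have hA : MemLp A 2 (volume.restrict (subgraph h)) :=
    (memLp_congr_ae (weakPartial_ae_eq hΩ ha1)).2 ha2
  have hB : MemLp B 2 (volume.restrict (subgraph h)) :=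
    (memLp_congr_ae (weakPartial_ae_eq hΩ hb1)).2 hb2
  have i1 : Integrable (fun p => A p ^ 2 + B p ^ 2) (volume.restrict (subgraph h)) :=
    hA.integrable_sq.add hB.integrable_sq
  have i2 : Integrable (fun p => A p * dy ψ p) (volume.restrict (subgraph h)) :=
    hA.integrable_mul (hψ.dy.memLp (volume.restrict (subgraph h)))
  have i3 : Integrable (fun p => B p * dx ψ p) (volume.restrict (subgraph h)) :=
    hB.integrable_mul (hψ.dx.memLp (volume.restrict (subgraph h)))
  have i4 : Integrable (dy ψ) (volume.restrict (subgraph h)) :=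
    (integrable_of_smooth hψ.dy.smooth hψ.dy.compact).restrict
  have i5 : Integrable (dualDensity ψ) (volume.restrict (subgraph h)) :=
    (integrable_dualDensity hψ.smooth hψ.compact).restrict
  rw [elasticEnergy, ← ofReal_integral_eq_lintegral_ofReal i1
    (ae_of_all _ fun p => by positivity)]
  refine ENNReal.ofReal_le_ofReal ?_
  have e1 : dualEnergy ψ = ∫ p in subgraph h, dualDensity ψ p :=
    (setIntegral_subgraph hψ.subset fun p hp => dualDensity_eq_zero hp).symm
  have e2 : ∫ p in upperHalf, dy ψ p = ∫ p in subgraph h, dy ψ p :=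
    (setIntegral_subgraph hψ.subset fun p hp => dy_eq_zero hp).symm
  -- Adding this null integral replaces `2 ψ_y` by the cross term `2 ∇u · σ`, so that the remaining
  -- comparison is pointwise.
  have e3 : ∫ p in subgraph h, (2 * (A p * dy ψ p - B p * dx ψ p) - 2 * dy ψ p) = 0 := by
    have i6 : Integrable (fun p => 2 * (A p * dy ψ p - B p * dx ψ p))
      (volume.restrict (subgraph h)) := (i2.sub i3).const_mul 2
    rw [integral_sub i6 (i4.const_mul 2), integral_const_mul,
      integral_const_mul, ← e2, ← hid, integral_sub i2 i3]
    ring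
  have i7 : Integrable (fun p => 2 * (A p * dy ψ p - B p * dx ψ p) - 2 * dy ψ p)
      (volume.restrict (subgraph h)) := ((i2.sub i3).const_mul 2).sub (i4.const_mul 2)
  have e4 : ∫ p in subgraph h, (dualDensity ψ p + (2 * (A p * dy ψ p - B p * dx ψ p) - 2 * dy ψ p))
      = dualEnergy ψ := by
    rw [integral_add i5 i7, e3, e1, add_zero]
  rw [← e4]
  refine integral_mono (i5.add i7) i1 fun p => ?_
  simp only [dualDensity]
  nlinarith [sq_nonneg (A p - dy ψ p), sq_nonneg (B p + dx ψ p)]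

/-! ### Linear structure of stream functions and finiteness of the dual supremum -/

theorem isStream_zero (h : ℝ → ℝ) : IsStream h (fun _ => 0) where
  smooth := contDiff_const
  compact := HasCompactSupport.zero
  subset := by
    have : tsupport (fun _ : ℝ × ℝ => (0 : ℝ)) = ∅ := tsupport_eq_empty_iff.2 rfl
    simp [this]

theorem IsStream.add {h : ℝ → ℝ} {ψ φ : ℝ × ℝ → ℝ} (hψ : IsStream h ψ) (hφ : IsStream h φ) :
    IsStream h (fun p => ψ p + φ p) where
  smooth := hψ.smooth.add hφ.smooth
  compact := hψ.compact.add hφ.compact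
  subset := (tsupport_add ψ φ).trans (union_subset hψ.subset hφ.subset)

theorem IsStream.const_mul {h : ℝ → ℝ} {ψ : ℝ × ℝ → ℝ} (hψ : IsStream h ψ) (c : ℝ) :
    IsStream h (fun p => c * ψ p) where
  smooth := contDiff_const.mul hψ.smooth
  compact := hψ.compact.mul_left
  subset := (tsupport_mul_subset_right (f := fun _ => c)).trans hψ.subset

theorem dx_add {f g : ℝ × ℝ → ℝ} (hf : ContDiff ℝ ∞ f) (hg : ContDiff ℝ ∞ g) (p : ℝ × ℝ) :
    dx (fun p => f p + g p) p = dx f p + dx g p :=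
  (hasDerivAt_dx (hf.add hg) p.1 p.2).unique
    ((hasDerivAt_dx hf p.1 p.2).add (hasDerivAt_dx hg p.1 p.2))

theorem dy_add {f g : ℝ × ℝ → ℝ} (hf : ContDiff ℝ ∞ f) (hg : ContDiff ℝ ∞ g) (p : ℝ × ℝ) :
    dy (fun p => f p + g p) p = dy f p + dy g p :=
  (hasDerivAt_dy (hf.add hg) p.1 p.2).unique
    ((hasDerivAt_dy hf p.1 p.2).add (hasDerivAt_dy hg p.1 p.2))

theorem dx_const_mul {f : ℝ × ℝ → ℝ} (hf : ContDiff ℝ ∞ f) (c : ℝ) (p : ℝ × ℝ) :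
    dx (fun p => c * f p) p = c * dx f p :=
  (hasDerivAt_dx (contDiff_const.mul hf) p.1 p.2).unique
    ((hasDerivAt_dx hf p.1 p.2).const_mul c)

theorem dy_const_mul {f : ℝ × ℝ → ℝ} (hf : ContDiff ℝ ∞ f) (c : ℝ) (p : ℝ × ℝ) :
    dy (fun p => c * f p) p = c * dy f p :=
  (hasDerivAt_dy (contDiff_const.mul hf) p.1 p.2).unique
    ((hasDerivAt_dy hf p.1 p.2).const_mul c)

theorem subgraph_eq_regionBetween (h : ℝ → ℝ) : subgraph h = regionBetween (fun _ => 0) h univ := by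
  ext p; simp [subgraph, regionBetween]

theorem volume_subgraph {h : ℝ → ℝ} (hi : Integrable h) (h0 : ∀ x, 0 ≤ h x) :
    volume (subgraph h) = ENNReal.ofReal (∫ x, h x) := by
  rw [subgraph_eq_regionBetween, Measure.volume_eq_prod, volume_regionBetween_eq_integral
    (integrableOn_zero) hi.integrableOn MeasurableSet.univ (fun x _ => h0 x)]
  simp

theorem dualEnergy_eq_subgraph {h : ℝ → ℝ} {ψ : ℝ × ℝ → ℝ} (hψ : IsStream h ψ) :
    dualEnergy ψ = ∫ p in subgraph h, dualDensity ψ p :=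
  (setIntegral_subgraph hψ.subset fun _ hp => dualDensity_eq_zero hp).symm

/-- Pointwise `2 t - t² ≤ 1`, so the density never exceeds one on the film. This makes the supremum
in `elastic` a genuine one. -/
theorem dualEnergy_le_integral {h : ℝ → ℝ} (hi : Integrable h) (h0 : ∀ x, 0 ≤ h x)
    {ψ : ℝ × ℝ → ℝ} (hψ : IsStream h ψ) : dualEnergy ψ ≤ ∫ x, h x := by
  have hv := volume_subgraph hi h0
  have hfin : volume (subgraph h) ≠ ⊤ := by rw [hv]; exact ENNReal.ofReal_ne_top
  have e : ∫ x, h x = ∫ p in subgraph h, (1 : ℝ) := by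
    simp [Measure.real, hv, ENNReal.toReal_ofReal (integral_nonneg h0)]
  rw [dualEnergy_eq_subgraph hψ, e]
  refine integral_mono (integrable_dualDensity hψ.smooth hψ.compact).restrict
    (integrableOn_const hfin) fun p => ?_
  simp only [dualDensity]
  nlinarith [sq_nonneg (dy ψ p - 1), sq_nonneg (dx ψ p)]

theorem bddAbove_dualEnergy {h : ℝ → ℝ} (hi : Integrable h) (h0 : ∀ x, 0 ≤ h x) :
    BddAbove (dualEnergy '' {ψ | IsStream h ψ}) :=
  ⟨∫ x, h x, by rintro _ ⟨ψ, hψ, rfl⟩; exact dualEnergy_le_integral hi h0 hψ⟩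

theorem dualEnergy_le_elastic {h : ℝ → ℝ} (hi : Integrable h) (h0 : ∀ x, 0 ≤ h x)
    {ψ : ℝ × ℝ → ℝ} (hψ : IsStream h ψ) : dualEnergy ψ ≤ elastic h :=
  le_csSup (bddAbove_dualEnergy hi h0) ⟨ψ, hψ, rfl⟩

theorem elastic_le {h : ℝ → ℝ} {c : ℝ} (hc : ∀ ψ, IsStream h ψ → dualEnergy ψ ≤ c) :
    elastic h ≤ c :=
  csSup_le ⟨_, _, isStream_zero h, rfl⟩ (by rintro _ ⟨ψ, hψ, rfl⟩; exact hc ψ hψ)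

theorem exists_lt_dualEnergy {h : ℝ → ℝ} {c : ℝ} (hc : c < elastic h) :
    ∃ ψ, IsStream h ψ ∧ c < dualEnergy ψ := by
  have hne : (dualEnergy '' {ψ | IsStream h ψ}).Nonempty := ⟨_, _, isStream_zero h, rfl⟩
  obtain ⟨_, ⟨ψ, hψ, rfl⟩, h2⟩ := exists_lt_of_lt_csSup hne hc
  exact ⟨ψ, hψ, h2⟩

theorem elastic_nonneg {h : ℝ → ℝ} (hi : Integrable h) (h0 : ∀ x, 0 ≤ h x) : 0 ≤ elastic h := by
  have h1 := dualEnergy_le_elastic hi h0 (isStream_zero h)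
  have h2 : dualEnergy (fun _ => 0) = 0 := by
    have : ∀ p, dualDensity (fun _ => 0) p = 0 := fun p => by simp [dualDensity, dx, dy]
    simp [dualEnergy, this]
  linarith

/-! ### The optimal field by Hilbert space projection -/

/-- The orthogonal projection of the constant field onto the closure of the tangential
divergence-free fields. -/
theorem exists_optimal_field {h : ℝ → ℝ} (hi : Integrable h) (h0 : ∀ x, 0 ≤ h x) :
    ∃ p q : ℝ × ℝ → ℝ, MemLp p 2 (volume.restrict (subgraph h)) ∧
      MemLp q 2 (volume.restrict (subgraph h)) ∧
      (∀ ψ, IsStream h ψ → ∫ z in subgraph h, (p z * dy ψ z - q z * dx ψ z)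
        = ∫ z in subgraph h, dy ψ z) ∧
      ∫ z in subgraph h, (p z ^ 2 + q z ^ 2) ≤ elastic h := by
  set μ := volume.restrict (subgraph h) with hμ
  have hfin : IsFiniteMeasure μ := ⟨by
    rw [hμ, Measure.restrict_apply_univ, volume_subgraph hi h0]; exact ENNReal.ofReal_lt_top⟩
  let E := WithLp 2 (Lp ℝ 2 μ × Lp ℝ 2 μ)
  let mk : ∀ f g : ℝ × ℝ → ℝ, MemLp f 2 μ → MemLp g 2 μ → E := fun f g hf hg =>
    WithLp.toLp 2 (hf.toLp f, hg.toLp g)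
  have inner_mk : ∀ (z : E) (f g : ℝ × ℝ → ℝ) (hf : MemLp f 2 μ) (hg : MemLp g 2 μ),
      inner ℝ z (mk f g hf hg) = ∫ a, (z.fst a * f a + z.snd a * g a) ∂μ := by
    intro z f g hf hg
    have e1 : inner ℝ z.fst (hf.toLp f) = ∫ a, z.fst a * f a ∂μ := by
      rw [L2.inner_def]
      refine integral_congr_ae ?_
      filter_upwards [hf.coeFn_toLp] with a ha
      rw [ha]; simp [mul_comm]
    have e2 : inner ℝ z.snd (hg.toLp g) = ∫ a, z.snd a * g a ∂μ := by
      rw [L2.inner_def]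
      refine integral_congr_ae ?_
      filter_upwards [hg.coeFn_toLp] with a ha
      rw [ha]; simp [mul_comm]
    have i1 : Integrable (fun a => z.fst a * f a) μ := (Lp.memLp z.fst).integrable_mul hf
    have i2 : Integrable (fun a => z.snd a * g a) μ := (Lp.memLp z.snd).integrable_mul hg
    rw [integral_add i1 i2, ← e1, ← e2]
    rfl
  have mk_congr : ∀ {f f' g g' : ℝ × ℝ → ℝ} (hf : MemLp f 2 μ) (hg : MemLp g 2 μ)
      (hf' : MemLp f' 2 μ) (hg' : MemLp g' 2 μ), (∀ a, f a = f' a) → (∀ a, g a = g' a) →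
      mk f g hf hg = mk f' g' hf' hg' := by
    intro f f' g g' hf hg hf' hg' e1 e2
    obtain rfl := funext e1
    obtain rfl := funext e2
    rfl
  let K : Submodule ℝ E :=
    { carrier := {z | ∃ ψ, ∃ hψ : IsStream h ψ,
        z = mk (dy ψ) (fun a => -1 * dx ψ a) (hψ.dy.memLp μ) ((hψ.dx.const_mul (-1)).memLp μ)}
      zero_mem' := by
        refine ⟨_, isStream_zero h, ?_⟩
        refine Eq.trans (b := mk 0 0 MemLp.zero MemLp.zero) ?_ (mk_congr _ _ _ _ ?_ ?_)
        · simp only [mk, MemLp.toLp_zero]; rfl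
        · intro a; simp [dy]
        · intro a; simp [dx]
      add_mem' := by
        rintro _ _ ⟨ψ, hψ, rfl⟩ ⟨φ, hφ, rfl⟩
        refine ⟨_, hψ.add hφ, ?_⟩
        refine Eq.trans (b := mk _ _ ((hψ.dy.memLp μ).add (hφ.dy.memLp μ))
          (((hψ.dx.const_mul (-1)).memLp μ).add ((hφ.dx.const_mul (-1)).memLp μ))) rfl
          (mk_congr _ _ _ _ ?_ ?_)
        · intro a; rw [dy_add hψ.smooth hφ.smooth]; rfl
        · intro a; rw [dx_add hψ.smooth hφ.smooth]; simp only [Pi.add_apply]; ring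
      smul_mem' := by
        rintro c _ ⟨ψ, hψ, rfl⟩
        refine ⟨_, hψ.const_mul c, ?_⟩
        refine Eq.trans (b := mk _ _ ((hψ.dy.memLp μ).const_smul c)
          (((hψ.dx.const_mul (-1)).memLp μ).const_smul c)) rfl (mk_congr _ _ _ _ ?_ ?_)
        · intro a; rw [dy_const_mul hψ.smooth]; rfl
        · intro a; rw [dx_const_mul hψ.smooth]; simp only [Pi.smul_apply, smul_eq_mul]; ring }
  let e : E := mk (fun _ => 1) (fun _ => 0) (memLp_const 1) (memLp_const 0)
  let P : E := K.topologicalClosure.starProjection e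
  have hP : P ∈ K.topologicalClosure := Submodule.starProjection_apply_mem _ _
  have horth : ∀ z ∈ K.topologicalClosure, inner ℝ (e - P) z = 0 := fun z hz =>
    Submodule.starProjection_inner_eq_zero _ _ hz
  have hmem : ∀ ψ (hψ : IsStream h ψ),
      mk (dy ψ) (fun a => -1 * dx ψ a) (hψ.dy.memLp μ) ((hψ.dx.const_mul (-1)).memLp μ) ∈ K :=
    fun ψ hψ => ⟨ψ, hψ, rfl⟩
  have inner_e : ∀ ψ (hψ : IsStream h ψ), inner ℝ e (mk (dy ψ) (fun a => -1 * dx ψ a)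
      (hψ.dy.memLp μ) ((hψ.dx.const_mul (-1)).memLp μ)) = ∫ a, dy ψ a ∂μ := by
    intro ψ hψ
    rw [inner_mk]
    refine integral_congr_ae ?_
    have h1 : e.fst =ᵐ[μ] fun _ => 1 := (memLp_const (1 : ℝ)).coeFn_toLp
    have h2 : e.snd =ᵐ[μ] fun _ => 0 := (memLp_const (0 : ℝ)).coeFn_toLp
    filter_upwards [h1, h2] with a ha1 ha2
    rw [ha1, ha2]; ring
  -- On `K` the left side is the dual energy of the stream function. The bound is a closed
  -- condition, so it extends to the closure, where the projection lives.
  have hKP : ∀ z ∈ K.topologicalClosure, 2 * inner ℝ e z - inner ℝ z z ≤ elastic h := by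
    have hcl : IsClosed {z : E | 2 * inner ℝ e z - inner ℝ z z ≤ elastic h} :=
      isClosed_le (by fun_prop) continuous_const
    refine fun z hz => closure_minimal (fun z hz => ?_) hcl hz
    obtain ⟨ψ, hψ, rfl⟩ := hz
    refine le_trans (le_of_eq ?_) (dualEnergy_le_elastic hi h0 hψ)
    rw [dualEnergy_eq_subgraph hψ, inner_e ψ hψ, inner_mk, ← integral_const_mul, ← integral_sub]
    · refine integral_congr_ae ?_
      have h1 : (mk (dy ψ) (fun a => -1 * dx ψ a) (hψ.dy.memLp μ)
        ((hψ.dx.const_mul (-1)).memLp μ)).fst =ᵐ[μ] dy ψ := (hψ.dy.memLp μ).coeFn_toLp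
      have h2 : (mk (dy ψ) (fun a => -1 * dx ψ a) (hψ.dy.memLp μ)
        ((hψ.dx.const_mul (-1)).memLp μ)).snd =ᵐ[μ] (fun a => -1 * dx ψ a) :=
          ((hψ.dx.const_mul (-1)).memLp μ).coeFn_toLp
      filter_upwards [h1, h2] with a ha1 ha2
      rw [ha1, ha2, dualDensity]; ring
    · exact (integrable_of_smooth hψ.dy.smooth hψ.dy.compact).restrict.const_mul 2
    · exact ((Lp.memLp _).integrable_mul (hψ.dy.memLp μ)).add
        ((Lp.memLp _).integrable_mul ((hψ.dx.const_mul (-1)).memLp μ))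
  refine ⟨P.fst, P.snd, Lp.memLp _, Lp.memLp _, fun ψ hψ => ?_, ?_⟩
  · have h1 := horth _ (K.le_topologicalClosure (hmem ψ hψ))
    rw [inner_sub_left, inner_e ψ hψ, inner_mk] at h1
    rw [eq_comm, ← sub_eq_zero, ← h1]
    congr 2 with a
    ring
  -- Orthogonality of `e - P` to `P` itself gives `⟪e, P⟫ = ‖P‖²`, so the dual value at `P` is
  -- exactly `‖P‖²`.
  · have h1 := horth P hP
    have h2 := hKP P hP
    rw [inner_sub_left] at h1
    have h3 : inner ℝ P P = ∫ z, ((P.fst : ℝ × ℝ → ℝ) z ^ 2 + (P.snd : ℝ × ℝ → ℝ) z ^ 2) ∂μ := by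
      have h4 := inner_mk P P.fst P.snd (Lp.memLp _) (Lp.memLp _)
      have h5 : mk P.fst P.snd (Lp.memLp _) (Lp.memLp _) = P := by
        simp only [mk, Lp.toLp_coeFn]; rfl
      rw [h5] at h4
      rw [h4]
      congr 1 with a
      ring
    rw [← h3]
    linarith

/-! ### Vertical primitives and reconstruction of the displacement -/

/-- The primitive of `φ` in the second variable that vanishes near `+∞`. -/
noncomputable def upperPrimitive (φ : ℝ × ℝ → ℝ) (p : ℝ × ℝ) : ℝ := ∫ s in Ioi p.2, φ (p.1, s)

/-- The primitive is the convolution, in the height variable, of `φ(x, ·)` with the indicator of the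
negative half-line. Smoothness is then that of a convolution depending on a parameter. -/
theorem contDiff_upperPrimitive {φ : ℝ × ℝ → ℝ} (h : ContDiff ℝ ∞ φ) (hc : HasCompactSupport φ) :
    ContDiff ℝ ∞ (upperPrimitive φ) := by
  have hf : LocallyIntegrable (indicator (Iio (0 : ℝ)) fun _ => (1 : ℝ)) :=
    (locallyIntegrable_const 1).indicator measurableSet_Iio
  have h1 := contDiffOn_convolution_right_with_param (n := ⊤) (μ := (volume : Measure ℝ))
    (ContinuousLinearMap.mul ℝ ℝ) (g := fun x t => φ (x, t)) (s := univ)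
    (k := Prod.snd '' tsupport φ) isOpen_univ (hc.isCompact.image continuous_snd)
    (fun x t _ ht => image_eq_zero_of_notMem_tsupport fun h' => ht ⟨_, h', rfl⟩) hf
    (by exact h.contDiffOn)
  rw [univ_prod_univ, contDiffOn_univ] at h1
  convert h1 using 1
  ext p
  simp only [upperPrimitive, convolution_def, ContinuousLinearMap.mul_apply']
  rw [← integral_indicator measurableSet_Ioi, ← integral_sub_left_eq_self _ volume p.2]
  congr 1 with t
  by_cases ht : t < 0
  · simp [ht]
  · have : ¬ p.2 < p.2 - t := by linarith
    simp [ht, this]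

theorem exists_upper_bound {φ : ℝ × ℝ → ℝ} (hc : HasCompactSupport φ) :
    ∃ B, ∀ x y, B < y → φ (x, y) = 0 := by
  obtain ⟨B, hB⟩ := (hc.isCompact.image continuous_snd).bddAbove
  refine ⟨B, fun x y hy => image_eq_zero_of_notMem_tsupport fun h => ?_⟩
  exact absurd (hB ⟨_, h, rfl⟩) (not_le.2 hy)

theorem upperPrimitive_eq_zero {φ : ℝ × ℝ → ℝ} {B : ℝ} (hB : ∀ x y, B < y → φ (x, y) = 0)
    (x y : ℝ) (hy : B < y) : upperPrimitive φ (x, y) = 0 := by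
  simp only [upperPrimitive]
  refine setIntegral_eq_zero_of_forall_eq_zero fun s hs => hB x s (hy.trans hs)

theorem dy_upperPrimitive {φ : ℝ × ℝ → ℝ} (h : ContDiff ℝ ∞ φ) (hc : HasCompactSupport φ)
    (p : ℝ × ℝ) : dy (upperPrimitive φ) p = - φ p := by
  have hcont : Continuous fun s => φ (p.1, s) := h.continuous.comp (by fun_prop)
  have hint : Integrable fun s => φ (p.1, s) :=
    hcont.integrable_of_hasCompactSupport (compact_slice_right hc p.1)
  have h1 : HasDerivAt (fun y => upperPrimitive φ (p.1, y)) (- φ p) p.2 := by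
    have e : (fun y => upperPrimitive φ (p.1, y))
        = fun y => (∫ s in Ioi p.2, φ (p.1, s)) - ∫ s in p.2..y, φ (p.1, s) := by
      ext y
      rw [← intervalIntegral.integral_Ioi_sub_Ioi' (hint.integrableOn (s := Ioi p.2))
        (hint.integrableOn (s := Ioi y))]
      simp [upperPrimitive]
    rw [e]
    have h2 := intervalIntegral.integral_hasDerivAt_right (hint.intervalIntegrable (a := p.2)
      (b := p.2)) hcont.aestronglyMeasurable.stronglyMeasurableAtFilter hcont.continuousAt
    simpa using h2.const_sub (∫ s in Ioi p.2, φ (p.1, s))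
  exact (hasDerivAt_dy (contDiff_upperPrimitive h hc) p.1 p.2).unique h1

/-- Both sides have vertical derivative `-dx φ` and vanish at large heights; this uses the symmetry
of second derivatives instead of differentiation under the integral. -/
theorem dx_upperPrimitive {φ : ℝ × ℝ → ℝ} (h : ContDiff ℝ ∞ φ) (hc : HasCompactSupport φ)
    (p : ℝ × ℝ) : dx (upperPrimitive φ) p = upperPrimitive (dx φ) p := by
  have hΨ := contDiff_upperPrimitive h hc
  obtain ⟨B, hB⟩ := exists_upper_bound hc
  have hder : ∀ y, HasDerivAt (fun y => dx (upperPrimitive φ) (p.1, y)) (- dx φ (p.1, y)) y := by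
    intro y
    have h1 := hasDerivAt_dy (contDiff_dx hΨ) p.1 y
    rw [← dx_dy_comm hΨ] at h1
    have h2 : dy (upperPrimitive φ) = fun p => (-1) * φ p := by
      ext p; rw [dy_upperPrimitive h hc]; ring
    rw [h2, dx_const_mul h] at h1
    simpa using h1
  have hz : ∀ y, B < y → dx (upperPrimitive φ) (p.1, y) = 0 := fun y hy =>
    (hasDerivAt_dx hΨ p.1 y).unique (by
      have e : (fun t => upperPrimitive φ (t, y)) = fun _ => 0 := by
        ext t; exact upperPrimitive_eq_zero hB t y hy
      rw [e]; exact hasDerivAt_const _ _)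
  have hint : Integrable fun s => dx φ (p.1, s) :=
    ((contDiff_dx h).continuous.comp (by fun_prop)).integrable_of_hasCompactSupport
      (compact_slice_right (compact_dx hc) p.1)
  have h3 := integral_Ioi_of_hasDerivAt_of_tendsto (a := p.2) (m := 0)
    (hder p.2).continuousAt.continuousWithinAt (fun y _ => hder y) hint.neg.integrableOn
    (tendsto_const_nhds.congr' (by
      filter_upwards [eventually_gt_atTop B] with y hy using (hz y hy).symm))
  rw [integral_neg] at h3
  simp only [upperPrimitive]
  have : ∫ s in Ioi p.2, dx φ (p.1, s) = dx (upperPrimitive φ) (p.1, p.2) := by linarith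
  rw [this]

/-- A cutoff that equals one on the upper half-plane. -/
noncomputable def bottomCutoff (p : ℝ × ℝ) : ℝ := Real.smoothTransition (p.2 + 1)

theorem contDiff_bottomCutoff : ContDiff ℝ ∞ bottomCutoff :=
  Real.smoothTransition.contDiff.comp (contDiff_snd.add contDiff_const)

theorem bottomCutoff_eq_one {p : ℝ × ℝ} (hp : 0 ≤ p.2) : bottomCutoff p = 1 :=
  Real.smoothTransition.one_of_one_le (by linarith)

theorem bottomCutoff_eq_zero {p : ℝ × ℝ} (hp : p.2 ≤ -1) : bottomCutoff p = 0 :=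
  Real.smoothTransition.zero_of_nonpos (by linarith)

theorem mul_bottomCutoff_eventuallyEq (f : ℝ × ℝ → ℝ) {p : ℝ × ℝ} (hp : p ∈ upperHalf) :
    (fun p => f p * bottomCutoff p) =ᶠ[𝓝 p] f := by
  filter_upwards [isOpen_upperHalf.mem_nhds hp] with z hz
  rw [bottomCutoff_eq_one (le_of_lt hz), mul_one]

theorem dx_mul_bottomCutoff (f : ℝ × ℝ → ℝ) {p : ℝ × ℝ} (hp : p ∈ upperHalf) :
    dx (fun p => f p * bottomCutoff p) p = dx f p := by
  rw [dx, (mul_bottomCutoff_eventuallyEq f hp).fderiv_eq, dx]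

theorem dy_mul_bottomCutoff (f : ℝ × ℝ → ℝ) {p : ℝ × ℝ} (hp : p ∈ upperHalf) :
    dy (fun p => f p * bottomCutoff p) p = dy f p := by
  rw [dy, (mul_bottomCutoff_eventuallyEq f hp).fderiv_eq, dy]

/-- The primitive spreads the support of `φ` only downwards, and `filmRegion` contains everything
below each of its points. The cutoff makes the support compact without changing the function on the
film. -/
theorem isStream_upperPrimitive {h : ℝ → ℝ} {φ : ℝ × ℝ → ℝ} (hs : ContDiff ℝ ∞ φ)
    (hc : HasCompactSupport φ) (hsub : tsupport φ ⊆ subgraph h) :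
    IsStream h (fun p => upperPrimitive φ p * bottomCutoff p) := by
  -- The union of the vertical segments from points of the support down to height `-1`.
  set K : Set (ℝ × ℝ) := (fun z : (ℝ × ℝ) × ℝ => (z.1.1, (1 - z.2) * z.1.2 + z.2 * (-1))) ''
    (tsupport φ ×ˢ Icc (0 : ℝ) 1)
  have hK : IsCompact K := (hc.isCompact.prod isCompact_Icc).image (by fun_prop)
  have hsupp : ∀ p, p ∉ K → upperPrimitive φ p * bottomCutoff p = 0 := by
    rintro ⟨x, y⟩ hp
    by_contra hne
    have h1 : -1 < y := by
      by_contra hy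
      exact hne (by rw [bottomCutoff_eq_zero (not_lt.1 hy), mul_zero])
    have h2 : ∃ s, y < s ∧ φ (x, s) ≠ 0 := by
      by_contra hcon
      push Not at hcon
      refine hne ?_
      have : upperPrimitive φ (x, y) = 0 :=
        setIntegral_eq_zero_of_forall_eq_zero fun s hs => hcon s hs
      rw [this, zero_mul]
    obtain ⟨s, hs1, hs2⟩ := h2
    refine hp ⟨((x, s), (s - y) / (s + 1)), ⟨subset_tsupport _ hs2, ?_, ?_⟩, ?_⟩
    · exact div_nonneg (by linarith) (by linarith)
    · rw [div_le_one (by linarith)]; linarith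
    · have : s + 1 ≠ 0 := by linarith
      simp only [Prod.mk.injEq, true_and]
      field_simp
      ring
  refine ⟨(contDiff_upperPrimitive hs hc).mul contDiff_bottomCutoff, HasCompactSupport.intro hK hsupp,
    ?_⟩
  refine (closure_minimal (fun p hp => ?_) hK.isClosed).trans (?_ : K ⊆ filmRegion h)
  · by_contra hpK
    exact hp (hsupp p hpK)
  · rintro _ ⟨⟨⟨x, s⟩, l⟩, ⟨h1, h2⟩, rfl⟩
    obtain ⟨h3, h4⟩ := hsub h1
    simp only at h3 h4 h2
    refine ⟨h3.trans h4, ?_⟩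
    simp only
    nlinarith [h2.1, h2.2]

/-- The primitive of `q` in the second variable that vanishes near `-∞`. -/
noncomputable def lowerPrimitive (q : ℝ × ℝ → ℝ) (p : ℝ × ℝ) : ℝ := ∫ s in Iio p.2, q (p.1, s)

theorem lowerPrimitive_eq (q : ℝ × ℝ → ℝ) (p : ℝ × ℝ) :
    lowerPrimitive q p = ∫ s, indicator {z : (ℝ × ℝ) × ℝ | z.2 < z.1.2}
      (fun z => q (z.1.1, z.2)) (p, s) := by
  rw [lowerPrimitive, ← integral_indicator measurableSet_Iio]
  rfl

theorem measurableSet_lt_snd : MeasurableSet {z : (ℝ × ℝ) × ℝ | z.2 < z.1.2} :=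
  (isOpen_lt (by fun_prop) (by fun_prop)).measurableSet

theorem stronglyMeasurable_lowerPrimitive {q : ℝ × ℝ → ℝ} (hq : StronglyMeasurable q) :
    StronglyMeasurable (lowerPrimitive q) := by
  have h1 : StronglyMeasurable (indicator {z : (ℝ × ℝ) × ℝ | z.2 < z.1.2}
      (fun z : (ℝ × ℝ) × ℝ => q (z.1.1, z.2))) :=
    (hq.comp_measurable (by fun_prop)).indicator measurableSet_lt_snd
  have := h1.integral_prod_right' (ν := (volume : Measure ℝ))
  convert this using 1
  ext p
  exact lowerPrimitive_eq q p

/-- Fubini's theorem for the pairing of a primitive with a test function. -/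
theorem integral_lowerPrimitive_mul {q G : ℝ × ℝ → ℝ} (hq : StronglyMeasurable q)
    (hi : Integrable q) (hG : Continuous G) (hc : HasCompactSupport G)
    (hG' : Continuous (upperPrimitive G)) {C : ℝ} (hC : ∀ p, |upperPrimitive G p| ≤ C) :
    ∫ p, lowerPrimitive q p * G p = ∫ p, q p * upperPrimitive G p := by
  have i1 : Integrable fun p => q p * upperPrimitive G p := by
    refine hi.mul_bdd (c := C) hG'.aestronglyMeasurable (ae_of_all _ fun p => hC p)
  -- The majorant is the `L¹` norm of the column of `q` times a constant on the bounded set of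
  -- heights met by the support of `G`.
  have i2 : Integrable fun p => lowerPrimitive q p * G p := by
    obtain ⟨D, hD⟩ := hc.exists_bound_of_continuous hG
    set K : Set ℝ := Prod.snd '' tsupport G
    have hK : IsCompact K := hc.isCompact.image continuous_snd
    have hb : Integrable fun p : ℝ × ℝ => (∫ s, ‖q (p.1, s)‖) * indicator K (fun _ => D) p.2 := by
      refine Integrable.mul_prod (f := fun x => ∫ s, ‖q (x, s)‖) ?_ ?_
      · exact hi.integral_norm_prod_left
      · exact (integrable_indicator_iff hK.measurableSet).2
          (integrableOn_const hK.measure_lt_top.ne)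
    refine hb.mono' ((stronglyMeasurable_lowerPrimitive hq).aestronglyMeasurable.mul
      hG.aestronglyMeasurable) ?_
    have hae : ∀ᵐ x : ℝ, Integrable fun s => q (x, s) := by
      rw [Measure.volume_eq_prod] at hi
      exact hi.prod_right_ae
    have hae' : ∀ᵐ p : ℝ × ℝ, Integrable fun s => q (p.1, s) :=
      Measure.quasiMeasurePreserving_fst.ae hae
    filter_upwards [hae'] with p hp
    by_cases hpK : p.2 ∈ K
    · rw [norm_mul, indicator_of_mem hpK]
      refine mul_le_mul ?_ (hD p) (norm_nonneg _) (integral_nonneg fun _ => norm_nonneg _)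
      refine (norm_integral_le_integral_norm _).trans ?_
      exact setIntegral_le_integral hp.norm (ae_of_all _ fun _ => norm_nonneg _)
    · have : G p = 0 := image_eq_zero_of_notMem_tsupport fun h => hpK ⟨p, h, rfl⟩
      simp [this, hpK]
  rw [Measure.volume_eq_prod] at i1 i2 ⊢
  rw [integral_prod _ i1, integral_prod _ i2]
  have hae : ∀ᵐ x : ℝ, Integrable fun s => q (x, s) := by
    rw [Measure.volume_eq_prod] at hi
    exact hi.prod_right_ae
  refine integral_congr_ae ?_
  filter_upwards [hae] with x hx
  have hGx : Integrable fun y => G (x, y) :=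
    (hG.comp (by fun_prop)).integrable_of_hasCompactSupport (compact_slice_right hc x)
  have e1 : ∀ y, lowerPrimitive q (x, y) * G (x, y)
      = ∫ s, indicator {z : ℝ × ℝ | z.2 < z.1} (fun z => q (x, z.2) * G (x, z.1)) (y, s) := by
    intro y
    rw [lowerPrimitive, ← integral_mul_const, ← integral_indicator measurableSet_Iio]
    rfl
  have e2 : ∀ s, q (x, s) * upperPrimitive G (x, s)
      = ∫ y, indicator {z : ℝ × ℝ | z.2 < z.1} (fun z => q (x, z.2) * G (x, z.1)) (y, s) := by
    intro s
    rw [upperPrimitive, ← integral_const_mul, ← integral_indicator measurableSet_Ioi]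
    rfl
  simp only [e1, e2]
  refine integral_integral_swap ?_
  have h1 : Integrable (fun z : ℝ × ℝ => q (x, z.2) * G (x, z.1)) (volume.prod volume) := by
    have := hGx.mul_prod hx
    simpa only [mul_comm] using this
  exact h1.indicator (isOpen_lt (by fun_prop) (by fun_prop)).measurableSet

/-- Cauchy-Schwarz on a column, which has length at most `H` because `q` vanishes outside these
heights. -/
theorem enorm_lowerPrimitive_sq_le {q : ℝ × ℝ → ℝ} (hq : StronglyMeasurable q) {H : ℝ}
    (hz : ∀ x s, s ∉ Ioo 0 H → q (x, s) = 0) (p : ℝ × ℝ) :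
    ‖lowerPrimitive q p‖ₑ ^ 2 ≤ ENNReal.ofReal H * ∫⁻ s, ‖q (p.1, s)‖ₑ ^ 2 := by
  have hm : AEMeasurable (fun s => ‖q (p.1, s)‖ₑ) (volume.restrict (Ioo 0 H)) :=
    (hq.comp_measurable (by fun_prop : Measurable fun s => (p.1, s))).enorm.aemeasurable
  have h1 : ‖lowerPrimitive q p‖ₑ ≤ ∫⁻ s in Ioo 0 H, ‖q (p.1, s)‖ₑ := by
    refine (enorm_integral_le_lintegral_enorm _).trans ((setLIntegral_le_lintegral _ _).trans ?_)
    rw [← lintegral_indicator measurableSet_Ioo]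
    refine lintegral_mono fun s => ?_
    by_cases hs : s ∈ Ioo 0 H
    · simp [hs]
    · simp [hz p.1 s hs]
  have h2 := ENNReal.lintegral_mul_le_Lp_mul_Lq (volume.restrict (Ioo 0 H))
    Real.HolderConjugate.two_two hm (aemeasurable_const (b := (1 : ℝ≥0∞)))
  have h3 : ∫⁻ s in Ioo 0 H, ‖q (p.1, s)‖ₑ ^ 2 ≤ ∫⁻ s, ‖q (p.1, s)‖ₑ ^ 2 :=
    setLIntegral_le_lintegral _ _
  simp only [Pi.mul_apply, mul_one, lintegral_const, one_pow, one_mul,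
    Measure.restrict_apply_univ, Real.volume_Ioo, sub_zero, ENNReal.rpow_ofNat] at h2
  calc ‖lowerPrimitive q p‖ₑ ^ 2
      ≤ ((∫⁻ s in Ioo 0 H, ‖q (p.1, s)‖ₑ ^ 2) ^ (1 / 2 : ℝ) *
        ENNReal.ofReal H ^ (1 / 2 : ℝ)) ^ 2 := by gcongr; exact h1.trans h2
    _ = (∫⁻ s in Ioo 0 H, ‖q (p.1, s)‖ₑ ^ 2) * ENNReal.ofReal H := by
        rw [mul_pow, ← ENNReal.rpow_natCast, ← ENNReal.rpow_natCast, ← ENNReal.rpow_mul,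
          ← ENNReal.rpow_mul]
        norm_num
    _ ≤ _ := by rw [mul_comm]; gcongr

theorem memLp_lowerPrimitive {q : ℝ × ℝ → ℝ} (hq : StronglyMeasurable q) (hq2 : MemLp q 2)
    {H : ℝ} (hz : ∀ x s, s ∉ Ioo 0 H → q (x, s) = 0) {Ω : Set (ℝ × ℝ)}
    (hΩ : Ω ⊆ univ ×ˢ Ioo 0 H) : MemLp (lowerPrimitive q) 2 (volume.restrict Ω) := by
  have hm := stronglyMeasurable_lowerPrimitive hq
  refine MemLp.mono_measure (Measure.restrict_mono hΩ le_rfl) ?_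
  rw [memLp_two_iff_integrable_sq hm.aestronglyMeasurable]
  refine ⟨(hm.pow 2).aestronglyMeasurable, ?_⟩
  have hfin : ∫⁻ p, ‖q p‖ₑ ^ 2 < ⊤ := by
    have := ((memLp_two_iff_integrable_sq hq.aestronglyMeasurable).1 hq2).2
    simpa [HasFiniteIntegral, enorm_pow] using this
  rw [HasFiniteIntegral]
  calc ∫⁻ p in univ ×ˢ Ioo 0 H, ‖lowerPrimitive q p ^ 2‖ₑ
      ≤ ∫⁻ p in univ ×ˢ Ioo 0 H, ENNReal.ofReal H * ∫⁻ s, ‖q (p.1, s)‖ₑ ^ 2 := by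
        refine lintegral_mono fun p => ?_
        rw [enorm_pow]
        exact enorm_lowerPrimitive_sq_le hq hz p
    _ = ENNReal.ofReal H * (ENNReal.ofReal H * ∫⁻ p, ‖q p‖ₑ ^ 2) := by
        have hmq : Measurable fun p : ℝ × ℝ => ‖q p‖ₑ ^ 2 := hq.enorm.pow_const 2
        have hmx : Measurable fun x => ∫⁻ s, ‖q (x, s)‖ₑ ^ 2 := hmq.lintegral_prod_right'
        rw [lintegral_const_mul _ (by exact hmx.comp measurable_fst), Measure.volume_eq_prod,
          ← Measure.prod_restrict, lintegral_prod _ (by exact (hmx.comp measurable_fst).aemeasurable),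
          lintegral_prod _ hmq.aemeasurable]
        simp only [lintegral_const, Measure.restrict_apply_univ, Real.volume_Ioo, sub_zero,
          Measure.restrict_univ]
        rw [lintegral_mul_const _ hmx, mul_comm (ENNReal.ofReal H) (∫⁻ x, _)]
    _ < ⊤ := ENNReal.mul_lt_top ENNReal.ofReal_lt_top
        (ENNReal.mul_lt_top ENNReal.ofReal_lt_top hfin)

theorem upperPrimitive_dy {φ : ℝ × ℝ → ℝ} (h : ContDiff ℝ ∞ φ) (hc : HasCompactSupport φ)
    (p : ℝ × ℝ) : upperPrimitive (dy φ) p = - φ p := by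
  have := HasCompactSupport.integral_Ioi_deriv_eq (f := fun y => φ (p.1, y))
    ((h.comp (contDiff_prodMk_right p.1)).of_le (by simp)) (compact_slice_right hc p.1) p.2
  rw [← this, upperPrimitive]
  congr 1 with y
  exact (hasDerivAt_dy h p.1 y).deriv.symm

theorem exists_abs_upperPrimitive_le {G : ℝ × ℝ → ℝ} (hG : Continuous G)
    (hc : HasCompactSupport G) : ∃ C, ∀ p, |upperPrimitive G p| ≤ C := by
  obtain ⟨D, hD⟩ := hc.exists_bound_of_continuous hG
  set K : Set ℝ := Prod.snd '' tsupport G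
  have hK : IsCompact K := hc.isCompact.image continuous_snd
  refine ⟨∫ s, indicator K (fun _ => D) s, fun p => ?_⟩
  have hD0 : 0 ≤ D := (norm_nonneg _).trans (hD 0)
  have hb : Integrable (indicator K fun _ => D) :=
    (integrable_indicator_iff hK.measurableSet).2 (integrableOn_const hK.measure_lt_top.ne)
  rw [← Real.norm_eq_abs, upperPrimitive]
  refine (norm_integral_le_of_norm_le hb.integrableOn (ae_of_all _ fun s => ?_)).trans
    (setIntegral_le_integral hb (ae_of_all _ fun s => indicator_nonneg (fun _ _ => hD0) s))
  by_cases hs : s ∈ K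
  · rw [indicator_of_mem hs]; exact hD _
  · have : G (p.1, s) = 0 := image_eq_zero_of_notMem_tsupport fun h => hs ⟨_, h, rfl⟩
    simp [this, hs]

theorem integral_upperHalf_fst_mul_dy {φ : ℝ × ℝ → ℝ} (h : ContDiff ℝ ∞ φ)
    (hc : HasCompactSupport φ) :
    ∫ p in upperHalf, p.1 * dy φ p = - ∫ x, x * φ (x, 0) := by
  have := integral_upperHalf_dy (contDiff_fst.mul h) (hc.mul_left (f := fun p : ℝ × ℝ => p.1))
  rw [← this]
  congr 1 with p
  rw [dy_mul contDiff_fst h, dy_fst, zero_mul, zero_add]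

/-- The dual energy is attained by an actual displacement. -/
theorem exists_displacement {h : ℝ → ℝ} (hl : LowerSemicontinuous h) (h0 : ∀ x, 0 ≤ h x)
    (hi : Integrable h) {H R : ℝ} (hH : ∀ x, h x ≤ H) (hR : ∀ x, x ∉ Icc 0 R → h x = 0) :
    ∃ u, MemH1 (subgraph h) u ∧ HasBottomTrace h u (fun x => x) ∧
      elasticEnergy u h ≤ ENNReal.ofReal (elastic h) := by
  have hΩ := isOpen_subgraph hl
  have hΩm := hΩ.measurableSet
  set Ω := subgraph h with hΩdef
  have hfin : IsFiniteMeasure (volume.restrict Ω) := ⟨by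
    rw [Measure.restrict_apply_univ, volume_subgraph hi h0]; exact ENNReal.ofReal_lt_top⟩
  obtain ⟨p, q, hp, hq, hpq, hle⟩ := exists_optimal_field hi h0
  -- A strongly measurable version of `q` extended by zero. Its primitive from `-∞` starts
  -- effectively at the bottom of the film and is defined on the whole plane, so that Fubini applies
  -- there.
  set q' : ℝ × ℝ → ℝ := indicator Ω (hq.1.mk q)
  have hq'm : StronglyMeasurable q' := hq.1.stronglyMeasurable_mk.indicator hΩm
  have hq'q : q' =ᵐ[volume.restrict Ω] q := by
    filter_upwards [hq.1.ae_eq_mk, self_mem_ae_restrict hΩm] with z hz hz'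
    exact (indicator_of_mem hz' _).trans hz.symm
  have hq'2 : MemLp q' 2 := (memLp_indicator_iff_restrict hΩm).2 (hq.ae_eq hq.1.ae_eq_mk)
  have hq'i : Integrable q' := (integrable_indicator_iff hΩm).2
    ((hq.ae_eq hq.1.ae_eq_mk).integrable (by norm_num))
  have hsub : Ω ⊆ univ ×ˢ Ioo 0 H := fun z hz => ⟨mem_univ _, hz.1, hz.2.trans_le (hH _)⟩
  have hz : ∀ x s, s ∉ Ioo 0 H → q' (x, s) = 0 := fun x s hs =>
    indicator_of_notMem (fun h' => hs (hsub h').2) _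
  set w := lowerPrimitive q'
  have hw2 : MemLp w 2 (volume.restrict Ω) := memLp_lowerPrimitive hq'm hq'2 hz hsub
  have hx2 : MemLp (fun z : ℝ × ℝ => z.1) 2 (volume.restrict Ω) := by
    refine MemLp.of_bound (by fun_prop) R ?_
    filter_upwards [self_mem_ae_restrict hΩm] with z hz'
    have : z.1 ∈ Icc 0 R := by
      by_contra hc
      have h1 := hz'.1.trans hz'.2
      rw [hR _ hc] at h1
      exact lt_irrefl _ h1
    rw [Real.norm_of_nonneg this.1]; exact this.2
  -- Integrate the vertical component of the optimal field upwards from the boundary datum `x`. The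
  -- identity for the horizontal derivative must then come from optimality.
  set u : ℝ × ℝ → ℝ := fun z => z.1 + w z
  have hu2 : MemLp u 2 (volume.restrict Ω) := hx2.add hw2
  have w_zero : ∀ z : ℝ × ℝ, z.2 ≤ 0 → w z = 0 := fun z hz2 =>
    setIntegral_eq_zero_of_forall_eq_zero fun s hs =>
      hz _ _ fun hs' => absurd hs'.1 (not_lt.2 ((le_of_lt hs).trans hz2))
  have wG : ∀ G : ℝ × ℝ → ℝ, ContDiff ℝ ∞ G → HasCompactSupport G → tsupport G ⊆ filmRegion h →
      Continuous (upperPrimitive G) →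
      ∫ z in Ω, w z * G z = ∫ z in Ω, q z * upperPrimitive G z := by
    intro G hG hc hs hcont
    obtain ⟨C, hC⟩ := exists_abs_upperPrimitive_le hG.continuous hc
    have h1 := integral_lowerPrimitive_mul hq'm hq'i hG.continuous hc hcont hC
    have h2 : ∫ z in Ω, w z * G z = ∫ z, w z * G z := by
      rw [setIntegral_subgraph (φ := G) hs fun z hz' => by
        rw [image_eq_zero_of_notMem_tsupport hz', mul_zero]]
      refine setIntegral_eq_integral_of_forall_compl_eq_zero fun z hz' => ?_
      rw [w_zero z (not_lt.1 hz'), zero_mul]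
    have h3 : ∫ z in Ω, q z * upperPrimitive G z = ∫ z in Ω, q' z * upperPrimitive G z := by
      refine integral_congr_ae ?_
      filter_upwards [hq'q] with z hz'
      rw [hz']
    rw [h2, h3, h1]
    refine (setIntegral_eq_integral_of_forall_compl_eq_zero fun z hz' => ?_).symm
    simp only [q', indicator_of_notMem hz', zero_mul]
  have split : ∀ G : ℝ × ℝ → ℝ, ContDiff ℝ ∞ G → HasCompactSupport G →
      ∫ z in Ω, u z * G z = (∫ z in Ω, z.1 * G z) + ∫ z in Ω, w z * G z := by
    intro G hG hc
    have hG2 : MemLp G 2 (volume.restrict Ω) :=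
      hG.continuous.memLp_of_hasCompactSupport hc
    have i1 : Integrable (fun z : ℝ × ℝ => z.1 * G z) (volume.restrict Ω) := hx2.integrable_mul hG2
    have i2 : Integrable (fun z : ℝ × ℝ => w z * G z) (volume.restrict Ω) := hw2.integrable_mul hG2
    rw [← integral_add i1 i2]
    congr 1 with z
    simp only [u]; ring
  -- Since `φ` need not vanish at the bottom, this single identity gives both the weak vertical
  -- derivative and the trace.
  have green : ∀ φ, IsStream h φ →
      ∫ z in Ω, u z * dy φ z = - (∫ z in Ω, q z * φ z) - ∫ x, x * φ (x, 0) := by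
    intro φ hφ
    have e : upperPrimitive (dy φ) = fun z => - φ z :=
      funext fun z => upperPrimitive_dy hφ.smooth hφ.compact z
    rw [split _ hφ.dy.smooth hφ.dy.compact, wG _ hφ.dy.smooth hφ.dy.compact hφ.dy.subset
      (by rw [e]; exact hφ.smooth.continuous.neg), e,
      setIntegral_subgraph (φ := φ) (f := fun z => z.1 * dy φ z) hφ.subset
        fun z hz' => by rw [dy_eq_zero hz', mul_zero],
      integral_upperHalf_fst_mul_dy hφ.smooth hφ.compact]
    simp only [mul_neg, integral_neg]
    ring
  have hsubΩ : Ω ⊆ filmRegion h := fun z hz' => ⟨hz'.1.trans hz'.2, hz'.2⟩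
  have loc : ∀ f : ℝ × ℝ → ℝ, MemLp f 2 (volume.restrict Ω) → LocallyIntegrableOn f Ω := by
    intro f hf
    exact IntegrableOn.locallyIntegrableOn (hf.integrable (by norm_num))
  have hwy : IsWeakPartial Ω (0, 1) u q := by
    refine ⟨loc u hu2, loc q hq, fun φ hs hc hsupp => ?_⟩
    have h1 := green φ ⟨hs, hc, hsupp.trans hsubΩ⟩
    have h2 : ∀ x : ℝ, φ (x, 0) = 0 := fun x =>
      image_eq_zero_of_notMem_tsupport fun h' => lt_irrefl _ (hsupp h').1
    simp only [h2, mul_zero, integral_zero, sub_zero] at h1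
    exact h1
  have hwx : IsWeakPartial Ω (1, 0) u p := by
    refine ⟨loc u hu2, loc p hp, fun φ hs hc hsupp => ?_⟩
    have hst : IsStream h φ := ⟨hs, hc, hsupp.trans hsubΩ⟩
    have e : upperPrimitive (dx φ) = dx (upperPrimitive φ) :=
      funext fun z => (dx_upperPrimitive hs hc z).symm
    have hcont : Continuous (upperPrimitive (dx φ)) := by
      rw [e]; exact (contDiff_dx (contDiff_upperPrimitive hs hc)).continuous
    have h1 := split (dx φ) hst.dx.smooth hst.dx.compact
    rw [wG _ hst.dx.smooth hst.dx.compact hst.dx.subset hcont,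
      setIntegral_subgraph (φ := φ) (f := fun z => z.1 * dx φ z) hst.subset
        fun z hz' => by rw [dx_eq_zero hz', mul_zero],
      integral_upperHalf_fst_mul_dx hs hc,
      ← setIntegral_subgraph (h := h) (φ := φ) (f := φ) hst.subset
        fun z hz' => image_eq_zero_of_notMem_tsupport hz'] at h1
    -- On the film the stream function `Ψ`, the upper primitive of `φ`, satisfies `Ψ_y = -φ` and has
    -- `Ψ_x` equal to the primitive of `dx φ`. The optimality relation for `Ψ` therefore expresses
    -- the pairing of `q` with that primitive through `∫ p φ` and `∫ φ`, which is what the formula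
    -- for `∫ u dx φ` needs.
    have h2 := hpq _ (isStream_upperPrimitive (h := h) hs hc hsupp)
    have h3 : ∫ z in Ω, dy (fun z => upperPrimitive φ z * bottomCutoff z) z
        = - ∫ z in Ω, φ z := by
      rw [← integral_neg]
      refine setIntegral_congr_fun hΩm fun z hz' => ?_
      rw [dy_mul_bottomCutoff _ (subgraph_subset_upperHalf h hz'), dy_upperPrimitive hs hc]
    have h4 : ∫ z in Ω, (p z * dy (fun z => upperPrimitive φ z * bottomCutoff z) z
        - q z * dx (fun z => upperPrimitive φ z * bottomCutoff z) z)
        = - (∫ z in Ω, p z * φ z) - ∫ z in Ω, q z * upperPrimitive (dx φ) z := by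
      have hφ2 : MemLp φ 2 (volume.restrict Ω) := hst.memLp _
      have i1 : Integrable (fun z => p z * φ z) (volume.restrict Ω) := hp.integrable_mul hφ2
      have i2 : Integrable (fun z => q z * upperPrimitive (dx φ) z) (volume.restrict Ω) := by
        obtain ⟨C, hC⟩ := exists_abs_upperPrimitive_le hst.dx.smooth.continuous hst.dx.compact
        exact (hq.integrable (by norm_num)).mul_bdd (c := C) hcont.aestronglyMeasurable
          (ae_of_all _ hC)
      rw [← integral_neg, ← integral_sub (f := fun z => -(p z * φ z)) i1.neg i2]
      refine setIntegral_congr_fun hΩm fun z hz' => ?_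
      have hz'' := subgraph_subset_upperHalf h hz'
      rw [dy_mul_bottomCutoff _ hz'', dx_mul_bottomCutoff _ hz'', dy_upperPrimitive hs hc, e]
      ring
    have h5 : ∫ z in Ω, u z * dx φ z = - ∫ z in Ω, p z * φ z := by linarith
    exact h5
  refine ⟨u, ⟨hu2, ⟨p, hwx, hp⟩, ⟨q, hwy, hq⟩⟩, fun φ hs hc hsupp => ?_, ?_⟩
  · have h1 := green φ ⟨hs, hc, hsupp⟩
    have h2 : ∫ z in Ω, weakPartial Ω (0, 1) u z * φ z = ∫ z in Ω, q z * φ z := by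
      refine integral_congr_ae ?_
      filter_upwards [weakPartial_ae_eq hΩ hwy] with z hz'
      rw [hz']
    rw [h2]
    exact h1
  · have i1 : Integrable (fun z => p z ^ 2 + q z ^ 2) (volume.restrict Ω) :=
      hp.integrable_sq.add hq.integrable_sq
    have h1 : elasticEnergy u h = ∫⁻ z in Ω, ENNReal.ofReal (p z ^ 2 + q z ^ 2) := by
      refine lintegral_congr_ae ?_
      filter_upwards [weakPartial_ae_eq hΩ hwx, weakPartial_ae_eq hΩ hwy] with z hz1 hz2
      rw [hz1, hz2]
    rw [h1, ← ofReal_integral_eq_lintegral_ofReal i1 (ae_of_all _ fun z => by positivity)]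
    exact ENNReal.ofReal_le_ofReal hle

/-! ### The elastic energy under inclusion, splitting, translation and stretching -/

theorem IsStream.mono {h k : ℝ → ℝ} (hk : ∀ x, h x ≤ k x) {ψ : ℝ × ℝ → ℝ} (hψ : IsStream h ψ) :
    IsStream k ψ :=
  ⟨hψ.smooth, hψ.compact, hψ.subset.trans fun _ hp =>
    ⟨hp.1.trans_le (hk _), hp.2.trans_le (hk _)⟩⟩

theorem elastic_mono {h k : ℝ → ℝ} (hi : Integrable k) (h0 : ∀ x, 0 ≤ k x) (hk : ∀ x, h x ≤ k x) :
    elastic h ≤ elastic k :=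
  elastic_le fun _ hψ => dualEnergy_le_elastic hi h0 (hψ.mono hk)

theorem dualEnergy_add {ψ φ : ℝ × ℝ → ℝ} (hψ : ContDiff ℝ ∞ ψ) (hφ : ContDiff ℝ ∞ φ)
    (cψ : HasCompactSupport ψ) (cφ : HasCompactSupport φ)
    (hd : ∀ p ∈ tsupport ψ, p ∉ tsupport φ) :
    dualEnergy (fun p => ψ p + φ p) = dualEnergy ψ + dualEnergy φ := by
  rw [dualEnergy, dualEnergy, dualEnergy, ← integral_add
    (integrable_dualDensity hψ cψ).restrict (integrable_dualDensity hφ cφ).restrict]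
  congr 1 with p
  simp only [dualDensity, dx_add hψ hφ, dy_add hψ hφ]
  by_cases hp : p ∈ tsupport ψ
  · simp [dx_eq_zero (hd p hp), dy_eq_zero (hd p hp)]
  · simp [dx_eq_zero hp, dy_eq_zero hp]

/-- Stream functions of the two films live over disjoint sets of columns, so they can be added
without interaction in the quadratic term. Removing a piece thus releases at least the elastic
energy of that piece. -/
theorem elastic_add_le {h h₁ h₂ : ℝ → ℝ} (hi : Integrable h) (h0 : ∀ x, 0 ≤ h x)
    (h1 : ∀ x, h₁ x ≤ h x) (h2 : ∀ x, h₂ x ≤ h x) (hd : ∀ x, h₁ x = 0 ∨ h₂ x = 0) :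
    elastic h₁ + elastic h₂ ≤ elastic h := by
  rw [← le_sub_iff_add_le]
  refine elastic_le fun ψ hψ => ?_
  rw [le_sub_comm]
  refine elastic_le fun φ hφ => ?_
  rw [le_sub_iff_add_le, add_comm, ← dualEnergy_add hψ.smooth hφ.smooth hψ.compact hφ.compact]
  · exact dualEnergy_le_elastic hi h0 ((hψ.mono h1).add (hφ.mono h2))
  · intro p hp hp'
    rcases hd p.1 with h | h
    · exact absurd (hψ.subset hp).1 (by rw [h]; exact lt_irrefl _)
    · exact absurd (hφ.subset hp').1 (by rw [h]; exact lt_irrefl _)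

/-- A stream function restricted to one side of a vertical line that avoids its support. -/
theorem IsStream.indicator {h : ℝ → ℝ} {ψ : ℝ × ℝ → ℝ} (hψ : IsStream h ψ) {s : Set ℝ}
    (hs : IsOpen s) (hf : ∀ x ∈ frontier s, h x = 0) :
    IsStream (s.indicator h) (fun p => s.indicator (fun _ => ψ p) p.1) := by
  set φ : ℝ × ℝ → ℝ := fun p => s.indicator (fun _ => ψ p) p.1
  have hsub : Function.support φ ⊆ tsupport ψ ∩ Prod.fst ⁻¹' s := by
    intro p hp
    by_cases hps : p.1 ∈ s
    · refine ⟨subset_tsupport _ ?_, hps⟩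
      simpa [φ, hps] using hp
    · exact absurd (by simp [φ, hps]) hp
  have hfr : ∀ p ∈ tsupport ψ, p.1 ∉ frontier s := fun p hp hps => by
    have := (hψ.subset hp).1
    rw [hf _ hps] at this
    exact lt_irrefl _ this
  have hts : tsupport φ ⊆ tsupport ψ ∩ Prod.fst ⁻¹' s := by
    intro p hp
    have h1 : p ∈ tsupport ψ :=
      closure_minimal (hsub.trans inter_subset_left) (isClosed_tsupport _) hp
    have h2 : p.1 ∈ closure s := by
      have : tsupport φ ⊆ Prod.fst ⁻¹' closure s :=
        closure_minimal (hsub.trans (inter_subset_right.trans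
          (preimage_mono subset_closure))) (isClosed_closure.preimage continuous_fst)
      exact this hp
    refine ⟨h1, ?_⟩
    by_contra hc
    exact hfr p h1 ⟨h2, by rwa [hs.interior_eq]⟩
  refine ⟨contDiff_iff_contDiffAt.2 fun p => ?_, hψ.compact.mono' (hsub.trans inter_subset_left),
    hts.trans fun p hp => ?_⟩
  · by_cases hp : p ∈ tsupport ψ
    · by_cases hps : p.1 ∈ s
      · refine hψ.smooth.contDiffAt.congr_of_eventuallyEq ?_
        filter_upwards [(hs.preimage continuous_fst).mem_nhds hps] with z hz
        simp only [φ]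
        rw [indicator_of_mem (show z.1 ∈ s from hz)]
      · have hcl : p.1 ∉ closure s := fun h' => hfr p hp ⟨h', by rwa [hs.interior_eq]⟩
        refine (contDiffAt_const (c := (0 : ℝ))).congr_of_eventuallyEq ?_
        filter_upwards [(isClosed_closure.isOpen_compl.preimage continuous_fst).mem_nhds hcl]
          with z hz
        simp only [φ]
        rw [indicator_of_notMem fun h' => hz (subset_closure h')]
    · refine (contDiffAt_const (c := (0 : ℝ))).congr_of_eventuallyEq ?_
      filter_upwards [(isClosed_tsupport ψ).isOpen_compl.mem_nhds hp] with z hz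
      simp only [φ, image_eq_zero_of_notMem_tsupport hz]
      simp
  · have := hψ.subset hp.1
    simp only [filmRegion, mem_ofPred_eq]
    rw [indicator_of_mem (show p.1 ∈ s from hp.2)]
    exact this

/-- No stream function has a support point above or below a column of height zero, so each one
splits smoothly into a left and a right part. -/
theorem elastic_le_add_of_zero {h : ℝ → ℝ} (hi : Integrable h) (h0 : ∀ x, 0 ≤ h x) {a : ℝ}
    (ha : h a = 0) :
    elastic h ≤ elastic ((Iio a).indicator h) + elastic ((Ioi a).indicator h) := by
  refine elastic_le fun ψ hψ => ?_
  have h1 := hψ.indicator isOpen_Iio (by simpa [frontier_Iio] using ha)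
  have h2 := hψ.indicator isOpen_Ioi (by simpa [frontier_Ioi] using ha)
  have e : ψ = fun p => (Iio a).indicator (fun _ => ψ p) p.1 + (Ioi a).indicator (fun _ => ψ p) p.1 := by
    ext p
    rcases lt_trichotomy p.1 a with hp | hp | hp
    · simp [hp, hp.le]
    · have : ψ p = 0 := image_eq_zero_of_notMem_tsupport fun h' => by
        have := (hψ.subset h').1
        rw [hp, ha] at this
        exact lt_irrefl _ this
      simp [this]
    · simp [hp, hp.le]
  have hd : ∀ p ∈ tsupport (fun p : ℝ × ℝ => (Iio a).indicator (fun _ => ψ p) p.1),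
      p ∉ tsupport (fun p : ℝ × ℝ => (Ioi a).indicator (fun _ => ψ p) p.1) := by
    intro p hp hp'
    have q1 := (h1.subset hp).1
    have q2 := (h2.subset hp').1
    by_cases hpa : p.1 < a
    · rw [indicator_of_notMem (by simp [hpa.le])] at q2; exact lt_irrefl _ q2
    · rw [indicator_of_notMem (by simpa using hpa)] at q1; exact lt_irrefl _ q1
  rw [e, dualEnergy_add h1.smooth h2.smooth h1.compact h2.compact hd]
  exact add_le_add
    (dualEnergy_le_elastic (hi.indicator measurableSet_Iio) (indicator_nonneg fun x _ => h0 x) h1)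
    (dualEnergy_le_elastic (hi.indicator measurableSet_Ioi) (indicator_nonneg fun x _ => h0 x) h2)

theorem elastic_translate_le {h : ℝ → ℝ} (hi : Integrable h) (h0 : ∀ x, 0 ≤ h x) (a : ℝ) :
    elastic (fun x => h (x + a)) ≤ elastic h := by
  refine elastic_le fun ψ hψ => ?_
  set c : ℝ × ℝ := (-a, 0)
  set φ : ℝ × ℝ → ℝ := fun p => ψ (p + c)
  have hx : ∀ p, dx φ p = dx ψ (p + c) := fun p => by simp only [dx, φ, fderiv_comp_add_right]
  have hy : ∀ p, dy φ p = dy ψ (p + c) := fun p => by simp only [dy, φ, fderiv_comp_add_right]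
  have hts : tsupport φ ⊆ (fun p => p + c) ⁻¹' tsupport ψ :=
    closure_minimal (fun p hp => subset_tsupport ψ hp)
      ((isClosed_tsupport ψ).preimage (by fun_prop))
  have hφ : IsStream h φ := by
    refine ⟨hψ.smooth.comp (contDiff_id.add contDiff_const), ?_, hts.trans fun p hp => ?_⟩
    · exact hψ.compact.comp_homeomorph (Homeomorph.addRight c)
    · have := hψ.subset hp
      simpa [filmRegion, c] using this
  have e : dualEnergy φ = dualEnergy ψ := by
    rw [dualEnergy, dualEnergy, ← integral_indicator isOpen_upperHalf.measurableSet,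
      ← integral_indicator isOpen_upperHalf.measurableSet,
      ← integral_add_right_eq_self (upperHalf.indicator (dualDensity ψ)) c]
    congr 1 with p
    have h1 : p + c ∈ upperHalf ↔ p ∈ upperHalf := by simp [upperHalf, c]
    by_cases hp : p ∈ upperHalf
    · rw [indicator_of_mem hp, indicator_of_mem (h1.2 hp)]
      simp only [dualDensity, hx, hy]
    · rw [indicator_of_notMem hp, indicator_of_notMem (fun h' => hp (h1.1 h'))]
  rw [← e]
  exact dualEnergy_le_elastic hi h0 hφ

theorem integral_upperHalf_stretch {F : ℝ × ℝ → ℝ} (hF : Continuous F) (hc : HasCompactSupport F)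
    {t : ℝ} (ht : 0 < t) :
    ∫ p in upperHalf, F (p.1, t * p.2) = t⁻¹ * ∫ p in upperHalf, F p := by
  have hm : Continuous fun p : ℝ × ℝ => F (p.1, t * p.2) := hF.comp (by fun_prop)
  have hcm : HasCompactSupport fun p : ℝ × ℝ => F (p.1, t * p.2) :=
    hc.comp_homeomorph ((Homeomorph.refl ℝ).prodCongr (Homeomorph.mulLeft₀ t ht.ne'))
  rw [setIntegral_upperHalf (hF.integrable_of_hasCompactSupport hc).integrableOn,
    setIntegral_upperHalf (hm.integrable_of_hasCompactSupport hcm).integrableOn,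
    ← integral_const_mul]
  congr 1 with x
  have := integral_comp_mul_left_Ioi (fun y => F (x, y)) 0 ht
  simpa using this

/-- Transport `ψ` to `t⁻¹ ψ(x, t y)`: the vertical derivative is preserved and the horizontal one
shrinks, so the density does not drop, while the change of variables contributes the factor `t⁻¹`.
-/
theorem elastic_stretch_le {h : ℝ → ℝ} (hi : Integrable h) (h0 : ∀ x, 0 ≤ h x) {t : ℝ}
    (ht : 1 ≤ t) : elastic (fun x => t * h x) ≤ t * elastic h := by
  have t0 : 0 < t := by linarith
  refine elastic_le fun ψ hψ => ?_
  set S := (Homeomorph.refl ℝ).prodCongr (Homeomorph.mulLeft₀ t t0.ne')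
  have hS : ∀ p, S p = (p.1, t * p.2) := fun p => rfl
  set φ : ℝ × ℝ → ℝ := fun p => t⁻¹ * ψ (p.1, t * p.2)
  have hφs : ContDiff ℝ ∞ φ := contDiff_const.mul
    (hψ.smooth.comp (contDiff_fst.prodMk (contDiff_const.mul contDiff_snd)))
  have hx : ∀ p, dx φ p = t⁻¹ * dx ψ (p.1, t * p.2) := fun p =>
    (hasDerivAt_dx hφs p.1 p.2).unique
      ((hasDerivAt_dx hψ.smooth p.1 (t * p.2)).const_mul t⁻¹)
  have hy : ∀ p, dy φ p = dy ψ (p.1, t * p.2) := fun p => by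
    have h1 := ((hasDerivAt_dy hψ.smooth p.1 (t * p.2)).comp p.2
      ((hasDerivAt_id p.2).const_mul t)).const_mul t⁻¹
    have h2 := (hasDerivAt_dy hφs p.1 p.2).unique h1
    rw [show p = (p.1, p.2) from rfl, h2]
    field_simp
  have hts : tsupport φ ⊆ S ⁻¹' tsupport ψ := by
    refine closure_minimal (fun p hp => subset_tsupport ψ ?_)
      ((isClosed_tsupport ψ).preimage S.continuous)
    exact right_ne_zero_of_mul hp
  have hφ : IsStream h φ := by
    refine ⟨hφs, (hψ.compact.comp_homeomorph S).mul_left, hts.trans fun p hp => ?_⟩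
    have := hψ.subset hp
    simp only [filmRegion, mem_ofPred_eq, hS] at this ⊢
    exact ⟨pos_of_mul_pos_right this.1 t0.le, lt_of_mul_lt_mul_left this.2 t0.le⟩
  have h1 := integral_upperHalf_stretch (contDiff_dualDensity hψ.smooth).continuous
    (compact_dualDensity hψ.compact) t0
  have h2 : ∫ p in upperHalf, dualDensity ψ (p.1, t * p.2) ≤ dualEnergy φ := by
    have hcm : HasCompactSupport fun p : ℝ × ℝ => dualDensity ψ (p.1, t * p.2) :=
      (compact_dualDensity hψ.compact).comp_homeomorph S
    have hm : Continuous fun p : ℝ × ℝ => dualDensity ψ (p.1, t * p.2) :=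
      (contDiff_dualDensity hψ.smooth).continuous.comp (by fun_prop)
    refine integral_mono (hm.integrable_of_hasCompactSupport hcm).restrict
      (integrable_dualDensity hφs hφ.compact).restrict fun p => ?_
    simp only [dualDensity, hx, hy, mul_pow]
    have : t⁻¹ ^ 2 ≤ 1 := pow_le_one₀ (by positivity) (inv_le_one_of_one_le₀ ht)
    nlinarith [sq_nonneg (dx ψ (p.1, t * p.2))]
  have h3 := dualEnergy_le_elastic hi h0 hφ
  have h4 : t⁻¹ * dualEnergy ψ ≤ elastic h := (h1.symm.le.trans h2).trans h3
  calc dualEnergy ψ = t * (t⁻¹ * dualEnergy ψ) := by field_simp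
    _ ≤ t * elastic h := by gcongr

/-! ### The variation of truncated profiles -/

theorem eVariationOn_le_add {f g k : ℝ → ℝ} {s : Set ℝ}
    (h : ∀ x ∈ s, ∀ y ∈ s, |f x - f y| ≤ |g x - g y| + |k x - k y|) :
    eVariationOn f s ≤ eVariationOn g s + eVariationOn k s := by
  refine iSup_le fun ⟨n, u, hu, us⟩ => ?_
  calc ∑ i ∈ Finset.range n, edist (f (u (i + 1))) (f (u i))
      ≤ ∑ i ∈ Finset.range n, (edist (g (u (i + 1))) (g (u i)) +
          edist (k (u (i + 1))) (k (u i))) := by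
        refine Finset.sum_le_sum fun i _ => ?_
        rw [edist_dist, edist_dist, edist_dist, ← ENNReal.ofReal_add dist_nonneg dist_nonneg]
        exact ENNReal.ofReal_le_ofReal (h _ (us _) _ (us _))
    _ ≤ _ := by
        rw [Finset.sum_add_distrib]
        exact add_le_add (eVariationOn.sum_le hu us) (eVariationOn.sum_le hu us)

theorem eVariationOn_le_of_monotone {k : ℝ → ℝ} (hk : Monotone k) {c : ℝ}
    (h : ∀ x, k x ∈ Icc 0 c) (s : Set ℝ) : eVariationOn k s ≤ ENNReal.ofReal c := by
  have hc : 0 ≤ c := (h 0).1.trans (h 0).2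
  have h1 := eVariationOn.comp_le_of_monotoneOn (fun t : ℝ => t) (t := s) (s := Icc 0 c) k
    (hk.monotoneOn s) (fun x _ => h x)
  have h2 := (monotone_id.monotoneOn (univ : Set ℝ)).eVariationOn_eq (mem_univ 0) (mem_univ c)
  rw [univ_inter] at h2
  simp only [id, sub_zero] at h2
  exact h1.trans h2.le

/-- To the left of `a` the truncated profile is `h` minus a single step of height `h a` at `a`:
cutting costs at most the height at the cut. -/
theorem eVariationOn_indicator_Iio_le {h : ℝ → ℝ} {a : ℝ} (ha : 0 ≤ h a) {s : Set ℝ}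
    (hs : s ⊆ Iic a) :
    eVariationOn ((Iio a).indicator h) s ≤ eVariationOn h s + ENNReal.ofReal (h a) := by
  set k : ℝ → ℝ := fun x => if x < a then 0 else h a
  have hk : Monotone k := by
    intro x y hxy
    simp only [k]
    split_ifs <;> linarith
  have hk2 : ∀ x, k x ∈ Icc 0 (h a) := by
    intro x
    simp only [k]
    split_ifs <;> simp [ha]
  refine (eVariationOn_le_add (g := h) (k := k) fun x hx y hy => ?_).trans
    (add_le_add le_rfl (eVariationOn_le_of_monotone hk hk2 s))
  have e : ∀ x ∈ s, (Iio a).indicator h x = h x - k x := by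
    intro x hx
    rcases (show x ≤ a from hs hx).lt_or_eq with h1 | h1
    · simp [k, h1]
    · simp [k, h1]
  rw [e x hx, e y hy, show h x - k x - (h y - k y) = (h x - h y) - (k x - k y) by ring]
  exact abs_sub _ _

theorem eVariationOn_indicator_Ioi_le {h : ℝ → ℝ} {a : ℝ} (ha : 0 ≤ h a) {s : Set ℝ}
    (hs : s ⊆ Ici a) :
    eVariationOn ((Ioi a).indicator h) s ≤ eVariationOn h s + ENNReal.ofReal (h a) := by
  set k : ℝ → ℝ := fun x => if x ≤ a then 0 else h a
  have hk : Monotone k := by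
    intro x y hxy
    simp only [k]
    split_ifs <;> linarith
  have hk2 : ∀ x, k x ∈ Icc 0 (h a) := by
    intro x
    simp only [k]
    split_ifs <;> simp [ha]
  refine (eVariationOn_le_add (g := h) (k := k) fun x hx y hy => ?_).trans
    (add_le_add le_rfl (eVariationOn_le_of_monotone hk hk2 s))
  have e : ∀ x ∈ s, (Ioi a).indicator h x = h x + k x - h a := by
    intro x hx
    rcases (show a ≤ x from hs hx).lt_or_eq with h1 | h1
    · have : ¬ x ≤ a := not_le.2 h1
      simp [k, h1, this]
    · simp [k, ← h1]
  rw [e x hx, e y hy, show h x + k x - h a - (h y + k y - h a) = (h x - h y) + (k x - k y) by ring]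
  exact abs_add_le _ _

/-- The total variation. -/
noncomputable def totalVar (h : ℝ → ℝ) : ℝ := (eVariationOn h univ).toReal

/-- The variation on `(-∞, x]`. -/
noncomputable def cumVar (h : ℝ → ℝ) (x : ℝ) : ℝ := (eVariationOn h (Iic x)).toReal

theorem totalVar_nonneg (h : ℝ → ℝ) : 0 ≤ totalVar h := ENNReal.toReal_nonneg

theorem cumVar_nonneg (h : ℝ → ℝ) (x : ℝ) : 0 ≤ cumVar h x := ENNReal.toReal_nonneg

section
variable {h : ℝ → ℝ}

theorem eVariationOn_ne_top (hb : BoundedVariationOn h univ) (s : Set ℝ) : eVariationOn h s ≠ ⊤ :=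
  hb.mono (subset_univ s)

theorem cumVar_le_totalVar (hb : BoundedVariationOn h univ) (x : ℝ) : cumVar h x ≤ totalVar h :=
  ENNReal.toReal_mono hb (eVariationOn.mono h (subset_univ _))

theorem cumVar_add_Icc (hb : BoundedVariationOn h univ) {x y : ℝ} (hxy : x ≤ y) :
    cumVar h x + (eVariationOn h (Icc x y)).toReal = cumVar h y := by
  have := eVariationOn.union h (s := Iic x) (t := Icc x y) isGreatest_Iic (isLeast_Icc hxy)
  rw [Iic_union_Icc_eq_Iic hxy] at this
  rw [cumVar, cumVar, this, ENNReal.toReal_add (eVariationOn_ne_top hb _)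
    (eVariationOn_ne_top hb _)]

theorem cumVar_add_Ici (hb : BoundedVariationOn h univ) (x : ℝ) :
    cumVar h x + (eVariationOn h (Ici x)).toReal = totalVar h := by
  have := eVariationOn.union h (s := Iic x) (t := Ici x) isGreatest_Iic isLeast_Ici
  rw [Iic_union_Ici] at this
  rw [cumVar, totalVar, this, ENNReal.toReal_add (eVariationOn_ne_top hb _)
    (eVariationOn_ne_top hb _)]

theorem monotone_cumVar (hb : BoundedVariationOn h univ) : Monotone (cumVar h) := fun x y hxy => by
  rw [← cumVar_add_Icc hb hxy]
  exact le_add_of_nonneg_right ENNReal.toReal_nonneg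

theorem abs_sub_le_cumVar (hb : BoundedVariationOn h univ) {a b x y : ℝ} (hx : x ∈ Icc a b)
    (hy : y ∈ Icc a b) : |h x - h y| ≤ cumVar h b - cumVar h a := by
  rw [← cumVar_add_Icc hb (hx.1.trans hx.2), add_sub_cancel_left]
  have := (BoundedVariationOn.mono hb (subset_univ (Icc a b))).dist_le hx hy
  exact this

end

theorem eVariationOn_indicator_Ioo_le {h : ℝ → ℝ} {a b : ℝ} (hab : a < b) (ha : 0 ≤ h a)
    (hb : 0 ≤ h b) : eVariationOn ((Ioo a b).indicator h) univ ≤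
      eVariationOn h (Icc a b) + ENNReal.ofReal (h a) + ENNReal.ofReal (h b) := by
  set f := (Ioo a b).indicator h
  have h1 : eVariationOn f (Iic a) = 0 :=
    eVariationOn.constant_on (by
      rintro _ ⟨x, hx, rfl⟩ _ ⟨y, hy, rfl⟩
      simp only [f]
      rw [indicator_of_notMem fun h' => absurd h'.1 (not_lt.2 hx),
        indicator_of_notMem fun h' => absurd h'.1 (not_lt.2 hy)])
  have h2 : eVariationOn f (Ici b) = 0 :=
    eVariationOn.constant_on (by
      rintro _ ⟨x, hx, rfl⟩ _ ⟨y, hy, rfl⟩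
      simp only [f]
      rw [indicator_of_notMem fun h' => absurd h'.2 (not_lt.2 hx),
        indicator_of_notMem fun h' => absurd h'.2 (not_lt.2 hy)])
  have h3 : eVariationOn f univ = eVariationOn f (Icc a b) := by
    have e1 := eVariationOn.union f (s := Iic a) (t := Ici a) isGreatest_Iic isLeast_Ici
    have e2 := eVariationOn.union f (s := Icc a b) (t := Ici b) (isGreatest_Icc hab.le) isLeast_Ici
    rw [Iic_union_Ici] at e1
    rw [Icc_union_Ici_eq_Ici hab.le] at e2
    rw [e1, e2, h1, h2, zero_add, add_zero]
  have h4 : EqOn f ((Iio b).indicator ((Ioi a).indicator h)) (Icc a b) := by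
    intro x _
    rw [indicator_indicator, inter_comm, Ioi_inter_Iio]
  have h5 : (Ioi a).indicator h b = h b := by simp [hab]
  rw [h3, eVariationOn.congr h4]
  refine (eVariationOn_indicator_Iio_le (by rw [h5]; exact hb) Icc_subset_Iic_self).trans ?_
  rw [h5]
  gcongr
  exact eVariationOn_indicator_Ioi_le ha Icc_subset_Ici_self

theorem eVariationOn_indicator_compl_Icc_le {h : ℝ → ℝ} {a b : ℝ} (hab : a ≤ b) (ha : 0 ≤ h a)
    (hb : 0 ≤ h b) : eVariationOn ((Icc a b)ᶜ.indicator h) univ ≤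
      (eVariationOn h (Iic a) + ENNReal.ofReal (h a)) +
        (eVariationOn h (Ici b) + ENNReal.ofReal (h b)) := by
  set f := (Icc a b)ᶜ.indicator h
  have h1 : eVariationOn f (Icc a b) = 0 :=
    eVariationOn.constant_on (by
      rintro _ ⟨x, hx, rfl⟩ _ ⟨y, hy, rfl⟩
      simp only [f]
      rw [indicator_of_notMem (notMem_compl_iff.2 hx), indicator_of_notMem (notMem_compl_iff.2 hy)])
  have h3 : eVariationOn f univ = eVariationOn f (Iic a) + eVariationOn f (Ici b) := by
    have e1 := eVariationOn.union f (s := Iic a) (t := Ici a) isGreatest_Iic isLeast_Ici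
    have e2 := eVariationOn.union f (s := Icc a b) (t := Ici b) (isGreatest_Icc hab) isLeast_Ici
    rw [Iic_union_Ici] at e1
    rw [Icc_union_Ici_eq_Ici hab] at e2
    rw [e1, e2, h1, zero_add]
  have h4 : EqOn f ((Iio a).indicator h) (Iic a) := by
    intro x hx
    by_cases hxa : x < a
    · simp [f, hxa]
    · have : x = a := le_antisymm hx (not_lt.1 hxa)
      simp [f, this, hab]
  have h5 : EqOn f ((Ioi b).indicator h) (Ici b) := by
    intro x hx
    by_cases hxb : b < x
    · simp [f, hxb]
    · have : x = b := le_antisymm (not_lt.1 hxb) hx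
      simp [f, this, hab]
  rw [h3, eVariationOn.congr h4, eVariationOn.congr h5]
  exact add_le_add (eVariationOn_indicator_Iio_le ha le_rfl)
    (eVariationOn_indicator_Ioi_le hb le_rfl)

theorem lowerSemicontinuous_indicator {h : ℝ → ℝ} (hl : LowerSemicontinuous h)
    (h0 : ∀ x, 0 ≤ h x) {s : Set ℝ} (hs : IsOpen s) : LowerSemicontinuous (s.indicator h) := by
  intro x y hy
  by_cases hx : x ∈ s
  · rw [indicator_of_mem hx] at hy
    filter_upwards [hl x y hy, hs.mem_nhds hx] with z hz hzs
    rwa [indicator_of_mem hzs]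
  · rw [indicator_of_notMem hx] at hy
    exact Eventually.of_forall fun z => hy.trans_le (indicator_nonneg (fun w _ => h0 w) z)

/-! ### Operations on profiles -/

/-- Film profiles. -/
structure Profile (h : ℝ → ℝ) : Prop where
  integrable : Integrable h
  bv : BoundedVariationOn h univ
  lsc : LowerSemicontinuous h
  nonneg : ∀ x, 0 ≤ h x

theorem Profile.cut {h : ℝ → ℝ} (hh : Profile h) {a b : ℝ} (hab : a < b) :
    Profile ((Ioo a b).indicator h) ∧
      totalVar ((Ioo a b).indicator h) ≤ cumVar h b - cumVar h a + h a + h b := by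
  have h1 := eVariationOn_indicator_Ioo_le hab (hh.nonneg a) (hh.nonneg b)
  have h2 : eVariationOn h (Icc a b) ≠ ⊤ := eVariationOn_ne_top hh.bv _
  have h3 : eVariationOn h (Icc a b) + ENNReal.ofReal (h a) + ENNReal.ofReal (h b) ≠ ⊤ := by
    finiteness
  refine ⟨⟨hh.integrable.indicator measurableSet_Ioo, ne_top_of_le_ne_top h3 h1,
    lowerSemicontinuous_indicator hh.lsc hh.nonneg isOpen_Ioo,
    indicator_nonneg fun x _ => hh.nonneg x⟩, ?_⟩
  have h4 := ENNReal.toReal_mono h3 h1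
  rw [ENNReal.toReal_add (by finiteness) (by finiteness), ENNReal.toReal_add h2 (by finiteness),
    ENNReal.toReal_ofReal (hh.nonneg _), ENNReal.toReal_ofReal (hh.nonneg _)] at h4
  have h5 := cumVar_add_Icc hh.bv hab.le
  rw [totalVar]
  linarith

theorem Profile.cut_compl {h : ℝ → ℝ} (hh : Profile h) {a b : ℝ} (hab : a ≤ b) :
    Profile ((Icc a b)ᶜ.indicator h) ∧
      totalVar ((Icc a b)ᶜ.indicator h) ≤
        totalVar h - (cumVar h b - cumVar h a) + h a + h b := by
  have h1 := eVariationOn_indicator_compl_Icc_le hab (hh.nonneg a) (hh.nonneg b)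
  have h2 : eVariationOn h (Iic a) ≠ ⊤ := eVariationOn_ne_top hh.bv _
  have h2' : eVariationOn h (Ici b) ≠ ⊤ := eVariationOn_ne_top hh.bv _
  have h3 : (eVariationOn h (Iic a) + ENNReal.ofReal (h a)) +
        (eVariationOn h (Ici b) + ENNReal.ofReal (h b)) ≠ ⊤ := by
    finiteness
  refine ⟨⟨hh.integrable.indicator measurableSet_Icc.compl, ne_top_of_le_ne_top h3 h1,
    lowerSemicontinuous_indicator hh.lsc hh.nonneg isClosed_Icc.isOpen_compl,
    indicator_nonneg fun x _ => hh.nonneg x⟩, ?_⟩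
  have h4 := ENNReal.toReal_mono h3 h1
  rw [ENNReal.toReal_add (by finiteness) (by finiteness), ENNReal.toReal_add h2 (by finiteness),
    ENNReal.toReal_add h2' (by finiteness),
    ENNReal.toReal_ofReal (hh.nonneg _), ENNReal.toReal_ofReal (hh.nonneg _)] at h4
  have h5 := cumVar_add_Ici hh.bv b
  have h6 : cumVar h a = (eVariationOn h (Iic a)).toReal := rfl
  rw [totalVar]
  linarith

theorem eVariationOn_const_mul_le (h : ℝ → ℝ) {t : ℝ} (ht : 0 ≤ t) :
    eVariationOn (fun x => t * h x) univ ≤ ENNReal.ofReal t * eVariationOn h univ := by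
  have h1 : LipschitzOnWith t.toNNReal (fun x : ℝ => t * x) univ := by
    refine LipschitzOnWith.of_dist_le_mul fun x _ y _ => ?_
    rw [Real.dist_eq, Real.dist_eq, ← mul_sub, abs_mul, abs_of_nonneg ht, Real.coe_toNNReal _ ht]
  exact h1.comp_eVariationOn_le (g := h) (mapsTo_univ _ _)

theorem Profile.const_mul {h : ℝ → ℝ} (hh : Profile h) {t : ℝ} (ht : 0 ≤ t) :
    Profile (fun x => t * h x) ∧ totalVar (fun x => t * h x) ≤ t * totalVar h := by
  have h1 := eVariationOn_const_mul_le h ht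
  have h2 : eVariationOn h univ ≠ ⊤ := hh.bv
  have h3 : ENNReal.ofReal t * eVariationOn h univ ≠ ⊤ := by finiteness
  refine ⟨⟨hh.integrable.const_mul t, ne_top_of_le_ne_top h3 h1, ?_,
    fun x => mul_nonneg ht (hh.nonneg x)⟩, ?_⟩
  · exact (continuous_const.mul continuous_id).comp_lowerSemicontinuous hh.lsc
      (fun x y hxy => mul_le_mul_of_nonneg_left hxy ht)
  · have h4 := ENNReal.toReal_mono h3 h1
    rwa [ENNReal.toReal_mul, ENNReal.toReal_ofReal ht] at h4

theorem Profile.comp_mono {h : ℝ → ℝ} (hh : Profile h) {τ : ℝ → ℝ} (hτ : Monotone τ) :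
    BoundedVariationOn (h ∘ τ) univ ∧ totalVar (h ∘ τ) ≤ totalVar h := by
  have h1 := eVariationOn.comp_le_of_monotoneOn h (t := univ) (s := univ) τ (hτ.monotoneOn _)
    (mapsTo_univ _ _)
  exact ⟨ne_top_of_le_ne_top hh.bv h1, ENNReal.toReal_mono hh.bv h1⟩

theorem Profile.translate {h : ℝ → ℝ} (hh : Profile h) (a : ℝ) :
    Profile (fun x => h (x + a)) ∧ totalVar (fun x => h (x + a)) ≤ totalVar h := by
  have h1 := hh.comp_mono (τ := fun x => x + a) fun x y hxy => by simpa using hxy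
  exact ⟨⟨hh.integrable.comp_add_right a, h1.1, hh.lsc.comp (by fun_prop),
    fun x => hh.nonneg _⟩, h1.2⟩

/-! ### Test fields that follow a smooth minorant of the profile -/

/-- A smooth, nondecreasing step from `0` (for `t ≤ ε`) to `1` (for `2 ε ≤ t`). -/
noncomputable def smoothStep (ε t : ℝ) : ℝ := Real.smoothTransition ((t - ε) / ε)

/-- A smooth approximation of the positive part, with derivative `smoothStep ε`. -/
noncomputable def smoothRamp (ε t : ℝ) : ℝ := ∫ s in (0 : ℝ)..t, smoothStep ε s

theorem contDiff_smoothStep (ε : ℝ) : ContDiff ℝ ∞ (smoothStep ε) :=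
  Real.smoothTransition.contDiff.comp ((contDiff_id.sub contDiff_const).div_const ε)

theorem smoothStep_mem (ε t : ℝ) : smoothStep ε t ∈ Icc 0 1 :=
  ⟨Real.smoothTransition.nonneg _, Real.smoothTransition.le_one _⟩

theorem smoothStep_eq_zero {ε t : ℝ} (hε : 0 < ε) (ht : t ≤ ε) : smoothStep ε t = 0 :=
  Real.smoothTransition.zero_of_nonpos (div_nonpos_of_nonpos_of_nonneg (by linarith) hε.le)

theorem smoothStep_eq_one {ε t : ℝ} (hε : 0 < ε) (ht : 2 * ε ≤ t) : smoothStep ε t = 1 :=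
  Real.smoothTransition.one_of_one_le (by rw [le_div_iff₀ hε]; linarith)

theorem hasDerivAt_smoothRamp (ε t : ℝ) : HasDerivAt (smoothRamp ε) (smoothStep ε t) t :=
  intervalIntegral.integral_hasDerivAt_right
    ((contDiff_smoothStep ε).continuous.intervalIntegrable _ _)
    (contDiff_smoothStep ε).continuous.aestronglyMeasurable.stronglyMeasurableAtFilter
    (contDiff_smoothStep ε).continuous.continuousAt

theorem contDiff_smoothRamp (ε : ℝ) : ContDiff ℝ ∞ (smoothRamp ε) := by
  refine contDiff_infty_iff_deriv.2 ⟨fun t => (hasDerivAt_smoothRamp ε t).differentiableAt, ?_⟩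
  rw [show deriv (smoothRamp ε) = smoothStep ε from
    funext fun t => (hasDerivAt_smoothRamp ε t).deriv]
  exact contDiff_smoothStep ε

theorem smoothRamp_eq_zero {ε t : ℝ} (hε : 0 < ε) (ht : t ≤ ε) : smoothRamp ε t = 0 := by
  rw [smoothRamp]
  refine intervalIntegral.integral_zero_ae (ae_of_all _ fun s hs => smoothStep_eq_zero hε ?_)
  rcases le_total 0 t with h | h
  · rw [uIoc_of_le h] at hs; exact hs.2.trans ht
  · rw [uIoc_of_ge h] at hs; linarith [hs.2]

/-- The stream function of a field that follows a smooth profile `g`. -/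
noncomputable def profileStream (ε : ℝ) (g : ℝ → ℝ) (p : ℝ × ℝ) : ℝ :=
  -(smoothRamp ε (g p.1 - p.2) * Real.smoothTransition (2 * p.2 / ε + 1))

section
variable {ε : ℝ} {g : ℝ → ℝ}

theorem contDiff_profileStream (ε : ℝ) (hg : ContDiff ℝ ∞ g) :
    ContDiff ℝ ∞ (profileStream ε g) := by
  have h1 : ContDiff ℝ ∞ fun p : ℝ × ℝ => smoothRamp ε (g p.1 - p.2) :=
    (contDiff_smoothRamp ε).comp ((hg.comp contDiff_fst).sub contDiff_snd)
  have h2 : ContDiff ℝ ∞ fun p : ℝ × ℝ => Real.smoothTransition (2 * p.2 / ε + 1) :=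
    Real.smoothTransition.contDiff.comp
      (((contDiff_const.mul contDiff_snd).div_const ε).add contDiff_const)
  exact (h1.mul h2).neg

theorem profileStream_support (hε : 0 < ε) {p : ℝ × ℝ} (hp : profileStream ε g p ≠ 0) :
    -(ε / 2) ≤ p.2 ∧ p.2 ≤ g p.1 - ε := by
  constructor
  · by_contra hc
    refine hp ?_
    rw [profileStream, Real.smoothTransition.zero_of_nonpos, mul_zero, neg_zero]
    push Not at hc
    have : 2 * p.2 / ε ≤ -1 := by rw [div_le_iff₀ hε]; linarith
    linarith
  · by_contra hc
    refine hp ?_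
    rw [profileStream, smoothRamp_eq_zero hε (by linarith), zero_mul, neg_zero]

/-- The ramp requires `y ≤ g - ε`, while the lower cutoff requires `y ≥ -ε/2`. Hence `g ≥ ε/2` on
the support, which keeps it away from columns of zero height. -/
theorem isStream_profileStream {h : ℝ → ℝ} (hε : 0 < ε) (hg : ContDiff ℝ ∞ g)
    (hc : HasCompactSupport g) (hgh : ∀ x, g x ≤ h x) : IsStream h (profileStream ε g) := by
  obtain ⟨G, hG⟩ := hc.exists_bound_of_continuous hg.continuous
  have hsub : tsupport (profileStream ε g) ⊆ {p | -(ε / 2) ≤ p.2 ∧ p.2 ≤ g p.1 - ε} :=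
    closure_minimal (fun p hp => profileStream_support hε hp)
      (by
        have hgc := hg.continuous
        exact (isClosed_le (f := fun _ : ℝ × ℝ => -(ε / 2)) (g := fun p => p.2)
          (by fun_prop) (by fun_prop)).inter (isClosed_le (f := fun p : ℝ × ℝ => p.2)
          (g := fun p => g p.1 - ε) (by fun_prop) (by fun_prop)))
  refine ⟨contDiff_profileStream ε hg, HasCompactSupport.intro
    (hc.isCompact.prod (isCompact_Icc (a := -(ε / 2)) (b := G))) fun p hp => ?_,
    hsub.trans fun p hp => ?_⟩
  · by_contra hne
    obtain ⟨h1, h2⟩ := profileStream_support hε hne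
    refine hp ⟨subset_tsupport _ ?_, h1, ?_⟩
    · have : 0 < g p.1 := by linarith
      exact this.ne'
    · have := (le_abs_self _).trans (hG p.1)
      linarith
  · obtain ⟨h1, h2⟩ := hp
    exact ⟨by linarith [hgh p.1], by linarith [hgh p.1]⟩

theorem profileStream_eq (hε : 0 < ε) (x : ℝ) {y : ℝ} (hy : 0 < y) :
    profileStream ε g (x, y) = - smoothRamp ε (g x - y) := by
  rw [profileStream, Real.smoothTransition.one_of_one_le, mul_one]
  have : 0 ≤ 2 * y / ε := by positivity
  linarith

theorem dx_profileStream (hε : 0 < ε) (hg : ContDiff ℝ ∞ g) (x : ℝ) {y : ℝ} (hy : 0 < y) :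
    dx (profileStream ε g) (x, y) = -(smoothStep ε (g x - y) * deriv g x) := by
  refine (hasDerivAt_dx (contDiff_profileStream ε hg) x y).unique ?_
  have e : (fun t => profileStream ε g (t, y)) = fun t => - smoothRamp ε (g t - y) :=
    funext fun t => profileStream_eq hε t hy
  rw [e]
  have h1 : HasDerivAt g (deriv g x) x := (hg.differentiable (by simp)).differentiableAt.hasDerivAt
  exact ((hasDerivAt_smoothRamp ε (g x - y)).comp x (h1.sub_const y)).neg

theorem dy_profileStream (hε : 0 < ε) (hg : ContDiff ℝ ∞ g) (x : ℝ) {y : ℝ} (hy : 0 < y) :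
    dy (profileStream ε g) (x, y) = smoothStep ε (g x - y) := by
  refine (hasDerivAt_dy (contDiff_profileStream ε hg) x y).unique ?_
  have e : (fun t => profileStream ε g (x, t)) =ᶠ[𝓝 y] fun t => - smoothRamp ε (g x - t) := by
    filter_upwards [lt_mem_nhds hy] with t ht
    exact profileStream_eq hε x ht
  have h1 := ((hasDerivAt_smoothRamp ε (g x - y)).comp y ((hasDerivAt_id y).const_sub (g x))).neg
  refine HasDerivAt.congr_of_eventuallyEq ?_ e
  exact (show HasDerivAt (fun t => -smoothRamp ε (g x - t)) _ y from h1).congr_deriv (by ring)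

/-- With `s` the value of the step, the density is `2 s - s² - s² g'²`. It equals `1 - g'²` where `s
= 1`, is at least `-g'²` in the transition layer because `s ∈ [0,1]`, and vanishes above `g`. -/
theorem le_dualDensity_profileStream (hε : 0 < ε) (hg : ContDiff ℝ ∞ g) (x : ℝ) {y : ℝ}
    (hy : 0 < y) :
    (Iio (g x - 2 * ε)).indicator (fun _ => (1 : ℝ)) y
      - (Iio (g x)).indicator (fun _ => deriv g x ^ 2) y ≤ dualDensity (profileStream ε g) (x, y) := by
  rw [dualDensity, dx_profileStream hε hg x hy, dy_profileStream hε hg x hy]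
  obtain ⟨h1, h2⟩ := smoothStep_mem ε (g x - y)
  by_cases hA : y < g x - 2 * ε
  · rw [smoothStep_eq_one hε (by linarith), indicator_of_mem (show y ∈ Iio _ from hA),
      indicator_of_mem (show y ∈ Iio (g x) by simp only [mem_Iio]; linarith)]
    ring_nf
    rfl
  · rw [indicator_of_notMem (show y ∉ Iio _ from hA)]
    by_cases hB : y < g x
    · rw [indicator_of_mem (show y ∈ Iio _ from hB)]
      have h3 : smoothStep ε (g x - y) ^ 2 ≤ 1 := pow_le_one₀ h1 h2
      nlinarith [sq_nonneg (deriv g x), mul_nonneg (sub_nonneg.2 h3) (sq_nonneg (deriv g x)),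
        mul_nonneg h1 (sub_nonneg.2 h2)]
    · rw [indicator_of_notMem (show y ∉ Iio _ from hB), smoothStep_eq_zero hε (by linarith)]
      simp

end

theorem setIntegral_Ioi_indicator_Iio (b c : ℝ) :
    ∫ y in Ioi (0 : ℝ), (Iio b).indicator (fun _ => c) y = max b 0 * c := by
  rw [setIntegral_indicator measurableSet_Iio, Ioi_inter_Iio]
  simp [Measure.real, ENNReal.toReal_ofReal']

theorem integrableOn_indicator_Iio (b c : ℝ) :
    IntegrableOn ((Iio b).indicator (fun _ => c)) (Ioi (0 : ℝ)) := by
  rw [integrableOn_indicator_iff measurableSet_Iio]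
  exact integrableOn_const (by rw [Iio_inter_Ioi]; simp)

/-- A smooth minorant of the profile bounds the elastic energy from below. -/
theorem integral_sub_le_elastic {h g : ℝ → ℝ} (hi : Integrable h) (h0 : ∀ x, 0 ≤ h x)
    (hg : ContDiff ℝ ∞ g) (hc : HasCompactSupport g) (g0 : ∀ x, 0 ≤ g x) (hgh : ∀ x, g x ≤ h x) :
    (∫ x, g x) - ∫ x, g x * deriv g x ^ 2 ≤ elastic h := by
  have hgi : Integrable g := hg.continuous.integrable_of_hasCompactSupport hc
  have hdi : Integrable fun x => g x * deriv g x ^ 2 :=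
    (hg.continuous.mul ((hg.continuous_deriv (by simp)).pow 2)).integrable_of_hasCompactSupport
      hc.mul_right
  set K := tsupport g
  have hK : IsCompact K := hc.isCompact
  have hKi : Integrable (K.indicator fun _ => (1 : ℝ)) :=
    (integrable_indicator_iff hK.measurableSet).2 (integrableOn_const hK.measure_lt_top.ne)
  -- The transition layer has thickness at most `2 ε` over the support of `g`; this loss disappears
  -- as `ε → 0`.
  have key : ∀ ε > 0, (∫ x, g x) - (∫ x, g x * deriv g x ^ 2)
      - 2 * ε * ∫ x, K.indicator (fun _ => (1 : ℝ)) x ≤ elastic h := by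
    intro ε hε
    have hst := isStream_profileStream (h := h) hε hg hc hgh
    have hDi := integrable_dualDensity hst.smooth hst.compact
    refine le_trans ?_ (dualEnergy_le_elastic hi h0 hst)
    rw [dualEnergy, setIntegral_upperHalf hDi.integrableOn, ← integral_const_mul,
      ← integral_sub hgi hdi, ← integral_sub (f := fun x => g x - g x * deriv g x ^ 2)
        (hgi.sub hdi) (hKi.const_mul _)]
    have hDx : Integrable fun x => ∫ y in Ioi (0 : ℝ), dualDensity (profileStream ε g) (x, y) := by
      have h1 : Integrable (dualDensity (profileStream ε g))
          ((volume : Measure ℝ).prod (volume.restrict (Ioi 0))) := by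
        rw [Measure.volume_eq_prod] at hDi
        have := hDi.restrict (s := univ ×ˢ Ioi 0)
        rwa [← Measure.prod_restrict, Measure.restrict_univ] at this
      exact h1.integral_prod_left
    refine integral_mono ((hgi.sub hdi).sub (hKi.const_mul _)) hDx fun x => ?_
    have h1 : ∫ y in Ioi (0 : ℝ), ((Iio (g x - 2 * ε)).indicator (fun _ => (1 : ℝ)) y
        - (Iio (g x)).indicator (fun _ => deriv g x ^ 2) y)
        ≤ ∫ y in Ioi (0 : ℝ), dualDensity (profileStream ε g) (x, y) := by
      refine setIntegral_mono_on
        ((integrableOn_indicator_Iio _ _).sub (integrableOn_indicator_Iio _ _)) ?_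
        measurableSet_Ioi fun y hy => le_dualDensity_profileStream hε hg x hy
      exact (((contDiff_dualDensity hst.smooth).continuous.comp
        (by fun_prop)).integrable_of_hasCompactSupport
        (compact_slice_right (compact_dualDensity hst.compact) x)).integrableOn
    rw [integral_sub (integrableOn_indicator_Iio _ _) (integrableOn_indicator_Iio _ _),
      setIntegral_Ioi_indicator_Iio, setIntegral_Ioi_indicator_Iio, max_eq_left (g0 x), mul_one]
      at h1
    refine le_trans ?_ h1
    by_cases hx : x ∈ K
    · rw [indicator_of_mem hx]
      linarith [le_max_left (g x - 2 * ε) 0]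
    · rw [indicator_of_notMem hx, image_eq_zero_of_notMem_tsupport hx]
      simp
  have hlim : Tendsto (fun ε : ℝ => (∫ x, g x) - (∫ x, g x * deriv g x ^ 2)
      - 2 * ε * ∫ x, K.indicator (fun _ => (1 : ℝ)) x) (𝓝[>] 0)
      (𝓝 ((∫ x, g x) - (∫ x, g x * deriv g x ^ 2)
      - 2 * 0 * ∫ x, K.indicator (fun _ => (1 : ℝ)) x)) :=
    (Continuous.tendsto (by fun_prop) 0).mono_left nhdsWithin_le_nhds
  have := le_of_tendsto hlim (by filter_upwards [self_mem_nhdsWithin] with ε hε using key ε hε)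
  simpa using this

/-! ### Mollified minorants and the thin film inequality -/

/-- The integrals of two translates of one monotone function cancel except for two end strips of
length `2 r`, where the function lies between `0` and the total variation. -/
theorem intervalIntegral_cumVar_window_le {h : ℝ → ℝ} (hb : BoundedVariationOn h univ) {r : ℝ}
    (hr : 0 ≤ r) (a b : ℝ) :
    ∫ x in a..b, (cumVar h (x + r) - cumVar h (x - r)) ≤ 2 * r * totalVar h := by
  have hi : ∀ u v, IntervalIntegrable (cumVar h) volume u v := fun u v =>
    ((monotone_cumVar hb).monotoneOn _).intervalIntegrable
  have hi1 : IntervalIntegrable (fun x => cumVar h (x + r)) volume a b :=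
    Monotone.intervalIntegrable fun x y hxy => monotone_cumVar hb (by linarith)
  have hi2 : IntervalIntegrable (fun x => cumVar h (x - r)) volume a b :=
    Monotone.intervalIntegrable fun x y hxy => monotone_cumVar hb (by linarith)
  rw [intervalIntegral.integral_sub hi1 hi2, intervalIntegral.integral_comp_add_right,
    intervalIntegral.integral_comp_sub_right]
  have e1 := intervalIntegral.integral_add_adjacent_intervals (hi (a - r) (a + r)) (hi (a + r) (b + r))
  have e2 := intervalIntegral.integral_add_adjacent_intervals (hi (a - r) (b - r)) (hi (b - r) (b + r))
  have e3 : 0 ≤ ∫ x in (a - r)..(a + r), cumVar h x :=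
    intervalIntegral.integral_nonneg (by linarith) fun x _ => cumVar_nonneg h x
  have e4 : ∫ x in (b - r)..(b + r), cumVar h x ≤ ∫ x in (b - r)..(b + r), totalVar h :=
    intervalIntegral.integral_mono_on (by linarith) (hi _ _) (by simp)
      fun x _ => cumVar_le_totalVar hb x
  rw [intervalIntegral.integral_const, smul_eq_mul] at e4
  linarith

theorem integrable_cumVar_window {h : ℝ → ℝ} (hb : BoundedVariationOn h univ) {r : ℝ}
    (hr : 0 ≤ r) : Integrable (fun x => cumVar h (x + r) - cumVar h (x - r)) ∧
      ∫ x, (cumVar h (x + r) - cumVar h (x - r)) ≤ 2 * r * totalVar h := by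
  have hm := monotone_cumVar hb
  have ii : ∀ a b : ℝ, IntervalIntegrable (fun x => cumVar h (x + r) - cumVar h (x - r))
      volume a b := fun a b =>
    IntervalIntegrable.sub (Monotone.intervalIntegrable fun x y hxy => hm (by linarith))
      (Monotone.intervalIntegrable fun x y hxy => hm (by linarith))
  have h0 : ∀ x, 0 ≤ cumVar h (x + r) - cumVar h (x - r) := fun x =>
    sub_nonneg.2 (hm (by linarith))
  have hint : Integrable (fun x => cumVar h (x + r) - cumVar h (x - r)) := by
    refine integrable_of_intervalIntegral_norm_bounded (l := atTop) (a := fun n : ℕ => -(n : ℝ))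
      (b := fun n : ℕ => (n : ℝ)) (2 * r * totalVar h) (fun n => ?_)
      (tendsto_neg_atTop_atBot.comp tendsto_natCast_atTop_atTop) tendsto_natCast_atTop_atTop
      (Eventually.of_forall fun n => ?_)
    · exact (ii _ _).1
    · simp only [Real.norm_of_nonneg (h0 _)]
      exact intervalIntegral_cumVar_window_le hb hr _ _
  refine ⟨hint, ?_⟩
  refine le_of_tendsto (intervalIntegral_tendsto_integral (l := atTop) (a := fun n : ℕ => -(n : ℝ))
    (b := fun n : ℕ => (n : ℝ)) hint (tendsto_neg_atTop_atBot.comp tendsto_natCast_atTop_atTop)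
      tendsto_natCast_atTop_atTop)
    (Eventually.of_forall fun n => intervalIntegral_cumVar_window_le hb hr _ _)

/-- A minorant of all the values of `h` at distance at most `r`. -/
noncomputable def windowMin (h : ℝ → ℝ) (r x : ℝ) : ℝ :=
  max 0 (h x - (cumVar h (x + r) - cumVar h (x - r)))

section
variable {h : ℝ → ℝ}

theorem windowMin_le (hh : Profile h) {r x z : ℝ} (hz : |x - z| ≤ r) : windowMin h r z ≤ h x := by
  refine max_le (hh.nonneg x) ?_
  rw [abs_le] at hz
  have := abs_sub_le_cumVar hh.bv (a := z - r) (b := z + r) (x := z) (y := x)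
    ⟨by linarith, by linarith⟩ ⟨by linarith, by linarith⟩
  linarith [le_abs_self (h z - h x)]

theorem sub_windowMin_le (hh : Profile h) {r x z : ℝ} (hz : |x - z| ≤ r) :
    h x - windowMin h r z ≤ 2 * (cumVar h (x + 2 * r) - cumVar h (x - 2 * r)) := by
  rw [abs_le] at hz
  have h1 := abs_sub_le_cumVar hh.bv (a := x - 2 * r) (b := x + 2 * r) (x := x) (y := z)
    ⟨by linarith, by linarith⟩ ⟨by linarith, by linarith⟩
  have h2 := monotone_cumVar hh.bv (show z + r ≤ x + 2 * r by linarith)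
  have h3 := monotone_cumVar hh.bv (show x - 2 * r ≤ z - r by linarith)
  have h4 := le_max_right 0 (h z - (cumVar h (z + r) - cumVar h (z - r)))
  rw [windowMin]
  linarith [le_abs_self (h x - h z)]

theorem measurable_windowMin (hh : Profile h) (r : ℝ) : Measurable (windowMin h r) := by
  have hm := (monotone_cumVar hh.bv).measurable
  exact measurable_const.max (hh.lsc.measurable.sub
    ((hm.comp (measurable_id.add_const r)).sub (hm.comp (measurable_id.sub_const r))))

theorem windowMin_nonneg (h : ℝ → ℝ) (r x : ℝ) : 0 ≤ windowMin h r x := le_max_left _ _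

theorem integrable_windowMin (hh : Profile h) {r : ℝ} (hr : 0 ≤ r) :
    Integrable (windowMin h r) :=
  hh.integrable.mono' (measurable_windowMin hh r).aestronglyMeasurable (ae_of_all _ fun x => by
    rw [Real.norm_of_nonneg (windowMin_nonneg _ _ _)]
    exact windowMin_le hh (by simpa using hr))

end

/-- A fixed smooth kernel on the line. -/
noncomputable def kernel : ℝ → ℝ :=
  (⟨1 / 2, 1, by norm_num, by norm_num⟩ : ContDiffBump (0 : ℝ)).normed volume

theorem contDiff_kernel : ContDiff ℝ ∞ kernel := ContDiffBump.contDiff_normed _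

theorem kernel_nonneg (x : ℝ) : 0 ≤ kernel x := ContDiffBump.nonneg_normed _ _

theorem integral_kernel : ∫ x, kernel x = 1 := ContDiffBump.integral_normed _

theorem tsupport_kernel : tsupport kernel = Icc (-1) 1 := by
  rw [kernel, ContDiffBump.tsupport_normed_eq, Real.closedBall_eq_Icc]
  simp

/-- The kernel at scale `r`. -/
noncomputable def kernelScaled (r x : ℝ) : ℝ := r⁻¹ * kernel (r⁻¹ * x)

theorem contDiff_kernelScaled (r : ℝ) : ContDiff ℝ ∞ (kernelScaled r) :=
  contDiff_const.mul (contDiff_kernel.comp (contDiff_const.mul contDiff_id))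

theorem kernelScaled_nonneg {r : ℝ} (hr : 0 < r) (x : ℝ) : 0 ≤ kernelScaled r x :=
  mul_nonneg (inv_nonneg.2 hr.le) (kernel_nonneg _)

theorem kernelScaled_eq_zero {r : ℝ} (hr : 0 < r) {x : ℝ} (hx : r < |x|) :
    kernelScaled r x = 0 := by
  have h0 : r⁻¹ * x ∉ tsupport kernel := by
    rw [tsupport_kernel, mem_Icc, ← abs_le, abs_mul, abs_of_pos (inv_pos.2 hr), not_le,
      lt_inv_mul_iff₀ hr]
    linarith
  rw [kernelScaled, image_eq_zero_of_notMem_tsupport h0, mul_zero]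

theorem compact_kernelScaled {r : ℝ} (hr : 0 < r) : HasCompactSupport (kernelScaled r) := by
  refine HasCompactSupport.intro (isCompact_Icc (a := -r) (b := r)) fun x hx => ?_
  refine kernelScaled_eq_zero hr ?_
  rwa [mem_Icc, ← abs_le, not_le] at hx

theorem integral_kernelScaled {r : ℝ} (hr : 0 < r) : ∫ x, kernelScaled r x = 1 := by
  simp only [kernelScaled]
  rw [integral_const_mul, Measure.integral_comp_mul_left, integral_kernel]
  simp [abs_of_pos hr, hr.ne']

theorem exists_deriv_kernel_bound : ∃ D, 0 < D ∧ ∀ x, |deriv kernel x| ≤ D := by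
  have hc : HasCompactSupport kernel := ContDiffBump.hasCompactSupport_normed _
  obtain ⟨D, hD⟩ := hc.deriv.exists_bound_of_continuous (contDiff_kernel.continuous_deriv (by simp))
  exact ⟨max D 1, by positivity, fun x => (hD x).trans (le_max_left _ _)⟩

theorem deriv_kernelScaled (r x : ℝ) :
    deriv (kernelScaled r) x = r⁻¹ ^ 2 * deriv kernel (r⁻¹ * x) := by
  have h1 : HasDerivAt kernel (deriv kernel (r⁻¹ * x)) (r⁻¹ * x) :=
    (contDiff_kernel.differentiable (by simp)).differentiableAt.hasDerivAt
  have h2 := ((h1.comp x ((hasDerivAt_id x).const_mul r⁻¹)).const_mul r⁻¹).deriv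
  exact (show deriv (kernelScaled r) x = _ from h2).trans (by ring)

/-- The thin film inequality: the elastic energy of a thin film is almost its volume. -/
theorem exists_thin_film_bound : ∃ C, 0 < C ∧ ∀ (h : ℝ → ℝ) (H : ℝ), Profile h →
    HasCompactSupport h → 0 < H → (∀ x, h x ≤ H) →
    (∫ x, h x) - C * H * totalVar h ≤ elastic h := by
  obtain ⟨D, hD0, hD⟩ := exists_deriv_kernel_bound
  -- This is `4 (2 + 8 D²)`: the volume loss contributes `2` and the gradient term `8 D²`, each
  -- times `∫ wd ≤ 4 H totalVar h`.
  refine ⟨8 + 32 * D ^ 2, by positivity, fun h H hh hc hH hhH => ?_⟩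
  set m := windowMin h H
  set k := kernelScaled H
  -- Window and kernel share the scale `H`, so `g x` averages numbers that are all at most `h x` and
  -- remains a minorant.
  set g : ℝ → ℝ := convolution k m (ContinuousLinearMap.mul ℝ ℝ) volume
  set wd : ℝ → ℝ := fun x => cumVar h (x + 2 * H) - cumVar h (x - 2 * H)
  have hmi : Integrable m := integrable_windowMin hh hH.le
  have hkc : HasCompactSupport k := compact_kernelScaled hH
  have hks : ContDiff ℝ ∞ k := contDiff_kernelScaled H
  have hmc : HasCompactSupport m := by
    refine hc.mono fun x hx => ?_
    by_contra h0
    simp only [Function.mem_support, not_not] at h0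
    exact hx (le_antisymm ((windowMin_le hh (by simpa using hH.le)).trans h0.le)
      (windowMin_nonneg _ _ _))
  have hgs : ContDiff ℝ ∞ g :=
    hkc.contDiff_convolution_left (n := ⊤) (ContinuousLinearMap.mul ℝ ℝ) hks
      hmi.locallyIntegrable
  have hgc : HasCompactSupport g := hkc.convolution _ hmc
  have gval : ∀ x, g x = ∫ t, k t * m (x - t) := fun x => by
    simp only [g, convolution_def, ContinuousLinearMap.mul_apply']
  have gder : ∀ x, deriv g x = ∫ t, deriv k t * m (x - t) := fun x => by
    have := (hkc.hasDerivAt_convolution_left (ContinuousLinearMap.mul ℝ ℝ) (hks.of_le (by simp))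
      hmi.locallyIntegrable x).deriv
    rw [this]
    simp only [convolution_def, ContinuousLinearMap.mul_apply']
  have hmx : ∀ x, Integrable fun t => m (x - t) := fun x => hmi.comp_sub_left x
  have int1 : ∀ (f : ℝ → ℝ), Continuous f → HasCompactSupport f → ∀ x,
      Integrable fun t => f t * m (x - t) := by
    intro f hf hfc x
    obtain ⟨c, hc'⟩ := hfc.exists_bound_of_continuous hf
    exact (hmx x).bdd_mul (c := c) hf.aestronglyMeasurable (ae_of_all _ hc')
  have hki : Integrable k := hks.continuous.integrable_of_hasCompactSupport hkc
  have kint : ∫ t, k t = 1 := integral_kernelScaled hH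
  have hdc : Continuous (deriv k) := hks.continuous_deriv (by simp)
  have hdi : Integrable (deriv k) := hdc.integrable_of_hasCompactSupport hkc.deriv
  have dint : ∫ t, deriv k t = 0 :=
    integral_eq_zero_of_hasDerivAt_of_integrable
      (fun t => ((hks.differentiable (by simp)).differentiableAt).hasDerivAt) hdi hki
  have g0 : ∀ x, 0 ≤ g x := fun x => by
    rw [gval]
    exact integral_nonneg fun t => mul_nonneg (kernelScaled_nonneg hH t) (windowMin_nonneg _ _ _)
  have hsub : ∀ x, h x - g x = ∫ t, k t * (h x - m (x - t)) := by
    intro x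
    have e : ∀ t, k t * (h x - m (x - t)) = k t * h x - k t * m (x - t) := fun t => by ring
    simp only [e]
    rw [integral_sub (hki.mul_const _) (int1 k hks.continuous hkc x), integral_mul_const, kint,
      one_mul, gval]
  have hdiff : ∀ x t, |t| ≤ H → 0 ≤ h x - m (x - t) ∧ h x - m (x - t) ≤ 2 * wd x ∧
      h x - m (x - t) ≤ H := by
    intro x t ht
    have hz : |x - (x - t)| ≤ H := by simpa using ht
    refine ⟨sub_nonneg.2 (windowMin_le hh hz), sub_windowMin_le hh hz, ?_⟩
    linarith [hhH x, windowMin_nonneg h H (x - t)]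
  have wd0 : ∀ x, 0 ≤ wd x := fun x => sub_nonneg.2 (monotone_cumVar hh.bv (by linarith))
  have gle : ∀ x, g x ≤ h x := fun x => by
    rw [← sub_nonneg, hsub]
    refine integral_nonneg fun t => ?_
    by_cases ht : |t| ≤ H
    · exact mul_nonneg (kernelScaled_nonneg hH t) (hdiff x t ht).1
    · simp [k, kernelScaled_eq_zero hH (not_le.1 ht)]
  have gge : ∀ x, h x - g x ≤ 2 * wd x := fun x => by
    rw [hsub]
    have : ∫ t, k t * (2 * wd x) = 2 * wd x := by rw [integral_mul_const, kint, one_mul]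
    rw [← this]
    refine integral_mono ?_ (hki.mul_const _) fun t => ?_
    · have e : (fun t => k t * (h x - m (x - t))) = fun t => k t * h x - k t * m (x - t) :=
        funext fun t => by ring
      rw [e]
      exact (hki.mul_const _).sub (int1 k hks.continuous hkc x)
    · by_cases ht : |t| ≤ H
      · exact mul_le_mul_of_nonneg_left (hdiff x t ht).2.1 (kernelScaled_nonneg hH t)
      · simp [k, kernelScaled_eq_zero hH (not_le.1 ht)]
  -- Since `∫ k' = 0`, the constant `h x` may be inserted; the derivative is then controlled by the
  -- small differences `h - m`.
  have dval : ∀ x, deriv g x = - ∫ t, deriv k t * (h x - m (x - t)) := by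
    intro x
    have e : ∀ t, deriv k t * (h x - m (x - t)) = deriv k t * h x - deriv k t * m (x - t) :=
      fun t => by ring
    simp only [e]
    rw [integral_sub (hdi.mul_const _) (int1 _ hdc hkc.deriv x), integral_mul_const, dint, zero_mul,
      zero_sub, neg_neg, gder]
  have dbound : ∀ x c, (∀ t, |t| ≤ H → h x - m (x - t) ≤ c) → |deriv g x| ≤ 2 * D * c / H := by
    intro x c hcx
    rw [dval, abs_neg, ← Real.norm_eq_abs]
    have hI : Integrable ((Icc (-H) H).indicator fun _ : ℝ => H⁻¹ ^ 2 * D * c) :=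
      (integrable_indicator_iff measurableSet_Icc).2 (integrableOn_const (by simp))
    refine (norm_integral_le_of_norm_le hI (ae_of_all _ fun t => ?_)).trans (le_of_eq ?_)
    · by_cases ht : |t| ≤ H
      · rw [indicator_of_mem (show t ∈ Icc (-H) H from abs_le.1 ht), norm_mul,
          Real.norm_eq_abs, Real.norm_eq_abs,
          abs_of_nonneg (hdiff x t ht).1, deriv_kernelScaled, abs_mul,
          abs_of_nonneg (by positivity : 0 ≤ H⁻¹ ^ 2)]
        have := hD (H⁻¹ * t)
        have h1 := (hdiff x t ht).1
        have h2 := hcx t ht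
        gcongr
      · have ht' : t ∉ tsupport k := by
          intro h'
          have : tsupport k ⊆ Icc (-H) H := closure_minimal (fun s hs => by
            by_contra hs'
            rw [mem_Icc, ← abs_le, not_le] at hs'
            exact hs (kernelScaled_eq_zero hH hs')) isClosed_Icc
          exact ht (abs_le.2 (this h'))
        have h0 : deriv k t = 0 := by
          by_contra hne
          exact ht' (support_deriv_subset hne)
        rw [h0, indicator_of_notMem (show t ∉ Icc (-H) H from fun h' => ht (abs_le.2 h'))]
        simp
    · rw [integral_indicator measurableSet_Icc]
      simp only [integral_const, measureReal_restrict_apply_univ, Real.volume_real_Icc, smul_eq_mul]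
      rw [max_eq_left (by linarith)]
      field_simp
      ring
  have d2 : ∀ x, g x * deriv g x ^ 2 ≤ 8 * D ^ 2 * wd x := by
    intro x
    -- One factor of `g'²` is estimated by the local variation and the other by the height bound, so
    -- that the result is linear in `wd`.
    have b1 := dbound x (2 * wd x) fun t ht => (hdiff x t ht).2.1
    have b2 := dbound x H fun t ht => (hdiff x t ht).2.2
    have hgH : g x ≤ H := (gle x).trans (hhH x)
    have b3 : deriv g x ^ 2 ≤ (2 * D * (2 * wd x) / H) * (2 * D * H / H) := by
      rw [← sq_abs, sq]
      exact mul_le_mul b1 b2 (abs_nonneg _) ((abs_nonneg _).trans b1)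
    calc g x * deriv g x ^ 2 ≤ H * ((2 * D * (2 * wd x) / H) * (2 * D * H / H)) := by
          gcongr
      _ = 8 * D ^ 2 * wd x := by field_simp; ring
  obtain ⟨wdi, wdle⟩ := integrable_cumVar_window hh.bv (r := 2 * H) (by linarith)
  have hgi : Integrable g := hgs.continuous.integrable_of_hasCompactSupport hgc
  have key := integral_sub_le_elastic hh.integrable hh.nonneg hgs hgc g0 gle
  have i1 : (∫ x, h x) - ∫ x, g x ≤ 2 * ∫ x, wd x := by
    rw [← integral_sub hh.integrable hgi, ← integral_const_mul]
    exact integral_mono (hh.integrable.sub hgi) (wdi.const_mul 2) gge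
  have i2 : ∫ x, g x * deriv g x ^ 2 ≤ 8 * D ^ 2 * ∫ x, wd x := by
    rw [← integral_const_mul]
    refine integral_mono ?_ (wdi.const_mul _) d2
    exact (hgs.continuous.mul ((hgs.continuous_deriv (by simp)).pow 2)).integrable_of_hasCompactSupport
      hgc.mul_right
  have i3 : (2 + 8 * D ^ 2) * ∫ x, wd x ≤ (2 + 8 * D ^ 2) * (2 * (2 * H) * totalVar h) := by
    gcongr
  linarith

/-! ### Epi-limits of profiles and lower semicontinuity -/

/-- The lower epi-limit of a sequence of functions along an ultrafilter. -/
noncomputable def epiLimit (U : Ultrafilter ℕ) (H : ℕ → ℝ → ℝ) (x : ℝ) : ℝ :=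
  sSup {c | ∃ ε > 0, ∀ᶠ n in (U : Filter ℕ), ∀ z, |z - x| < ε → c ≤ H n z}

section

variable {U : Ultrafilter ℕ} {H : ℕ → ℝ → ℝ} {M : ℝ}

theorem bddAbove_epiLimit (hM : ∀ n x, H n x ≤ M) (x : ℝ) :
    BddAbove {c | ∃ ε > 0, ∀ᶠ n in (U : Filter ℕ), ∀ z, |z - x| < ε → c ≤ H n z} := by
  refine ⟨M, ?_⟩
  rintro c ⟨ε, hε, hc⟩
  obtain ⟨n, hn⟩ := hc.exists
  exact (hn x (by simpa using hε)).trans (hM n x)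

theorem le_epiLimit (hM : ∀ n x, H n x ≤ M) {x c ε : ℝ} (hε : 0 < ε)
    (hc : ∀ᶠ n in (U : Filter ℕ), ∀ z, |z - x| < ε → c ≤ H n z) : c ≤ epiLimit U H x :=
  le_csSup (bddAbove_epiLimit hM x) ⟨ε, hε, hc⟩

theorem epiLimit_nonneg (hM : ∀ n x, H n x ≤ M) (h0 : ∀ n x, 0 ≤ H n x) (x : ℝ) :
    0 ≤ epiLimit U H x :=
  le_epiLimit hM one_pos (Eventually.of_forall fun n z _ => h0 n z)

theorem exists_of_lt_epiLimit (h0 : ∀ n x, 0 ≤ H n x) {x c : ℝ} (hc : c < epiLimit U H x) :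
    ∃ ε > 0, ∀ᶠ n in (U : Filter ℕ), ∀ z, |z - x| < ε → c ≤ H n z := by
  have hne : {c | ∃ ε > 0, ∀ᶠ n in (U : Filter ℕ), ∀ z, |z - x| < ε → c ≤ H n z}.Nonempty :=
    ⟨0, 1, one_pos, Eventually.of_forall fun n z _ => h0 n z⟩
  obtain ⟨c', ⟨ε, hε, hc'⟩, hcc⟩ := exists_lt_of_lt_csSup hne hc
  exact ⟨ε, hε, hc'.mono fun n hn z hz => hcc.le.trans (hn z hz)⟩

theorem epiLimit_le (h0 : ∀ n x, 0 ≤ H n x) {x c : ℝ} (hx : ∀ n, H n x ≤ c) :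
    epiLimit U H x ≤ c := by
  refine csSup_le ⟨0, 1, one_pos, Eventually.of_forall fun n z _ => h0 n z⟩ ?_
  rintro b ⟨ε, hε, hb⟩
  obtain ⟨n, hn⟩ := hb.exists
  exact (hn x (by simpa using hε)).trans (hx n)

theorem lowerSemicontinuous_epiLimit (hM : ∀ n x, H n x ≤ M) (h0 : ∀ n x, 0 ≤ H n x) :
    LowerSemicontinuous (epiLimit U H) := by
  intro x c hc
  obtain ⟨c', hcc', hc'⟩ := exists_between hc
  obtain ⟨ε, hε, hev⟩ := exists_of_lt_epiLimit h0 hc'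
  filter_upwards [Metric.ball_mem_nhds x (half_pos hε)] with z hz
  rw [Metric.mem_ball, Real.dist_eq] at hz
  refine hcc'.trans_le (le_epiLimit hM (half_pos hε) (hev.mono fun n hn y hy => hn y ?_))
  have := abs_sub_le y z x
  linarith

/-- Recovery points: the definition bounds `H n` from below near `x`, and prevents it from being
eventually larger by `δ` there. Along an ultrafilter "not eventually" becomes "eventually not", so
no subsequence is needed. -/
theorem eventually_exists_near_epiLimit (hM : ∀ n x, H n x ≤ M) (h0 : ∀ n x, 0 ≤ H n x) (x : ℝ)
    {ε δ : ℝ} (hε : 0 < ε) (hδ : 0 < δ) :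
    ∀ᶠ n in (U : Filter ℕ), ∃ z, |z - x| < ε ∧ |H n z - epiLimit U H x| ≤ δ := by
  obtain ⟨ε', hε', hev⟩ := exists_of_lt_epiLimit (U := U) (H := H) h0
    (sub_lt_self (epiLimit U H x) hδ)
  have h2 : ¬ ∀ᶠ n in (U : Filter ℕ), ∀ z, |z - x| < min ε ε' → epiLimit U H x + δ ≤ H n z :=
    fun h => absurd (le_epiLimit hM (lt_min hε hε') h) (by linarith)
  rw [← Ultrafilter.eventually_not] at h2
  filter_upwards [hev, h2] with n h3 h4
  push Not at h4
  obtain ⟨z, hz, hzc⟩ := h4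
  refine ⟨z, hz.trans_le (min_le_left _ _), abs_le.2 ⟨?_, by linarith⟩⟩
  linarith [h3 z (hz.trans_le (min_le_right _ _))]

theorem eventually_exists_near_epiLimit_finset (hM : ∀ n x, H n x ≤ M) (h0 : ∀ n x, 0 ≤ H n x)
    (S : Finset ℝ) {ε δ : ℝ} (hε : 0 < ε) (hδ : 0 < δ) :
    ∀ᶠ n in (U : Filter ℕ), ∃ z : ℝ → ℝ, ∀ x ∈ S, |z x - x| < ε ∧
      |H n (z x) - epiLimit U H x| ≤ δ := by
  have := (Finset.eventually_all S).2 fun x (_ : x ∈ S) =>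
    eventually_exists_near_epiLimit (U := U) hM h0 x hε hδ
  filter_upwards [this] with n hn
  choose! z hz using hn
  exact ⟨z, hz⟩

/-- Replace the points of a nearly optimal partition by recovery points, which form a partition for
`H n` with almost the same sum of jumps. -/
theorem eventually_lt_eVariationOn (hM : ∀ n x, H n x ≤ M) (h0 : ∀ n x, 0 ≤ H n x) {a : ℝ≥0∞}
    (ha : a < eVariationOn (epiLimit U H) univ) :
    ∀ᶠ n in (U : Filter ℕ), a ≤ eVariationOn (H n) univ := by
  set h := epiLimit U H
  obtain ⟨⟨N, u, hu, _⟩, hau⟩ := lt_iSup_iff.1 ha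
  set S : Finset ℝ := (Finset.range (N + 1)).image u
  have hS : ∀ i ≤ N, u i ∈ S := fun i hi =>
    Finset.mem_image_of_mem _ (Finset.mem_range.2 (by omega))
  -- Moving each partition point by less than half the smallest gap preserves the order; repeated
  -- points move together because `z` is a function of the point.
  have gap : ∃ ε > 0, ∀ x ∈ S, ∀ y ∈ S, x < y → ε + ε < y - x := by
    have h1 : ∀ᶠ ε in 𝓝[>] (0 : ℝ), ∀ x ∈ S, ∀ y ∈ S, x < y → ε + ε < y - x := by
      refine (Finset.eventually_all S).2 fun x _ => (Finset.eventually_all S).2 fun y _ => ?_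
      by_cases hxy : x < y
      · have h2 : ∀ᶠ ε in 𝓝 (0 : ℝ), ε + ε < y - x :=
          ((continuous_id.add continuous_id).tendsto (0 : ℝ)).eventually
            (gt_mem_nhds (by simpa using hxy))
        exact (h2.filter_mono nhdsWithin_le_nhds).mono fun ε hε _ => hε
      · exact Eventually.of_forall fun ε h => absurd h hxy
    obtain ⟨ε, h2, h3⟩ := (h1.and self_mem_nhdsWithin).exists
    exact ⟨ε, h3, h2⟩
  obtain ⟨ε, hε, hgap⟩ := gap
  obtain ⟨δ, hδ, hδN⟩ : ∃ δ : ℝ, 0 < δ ∧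
      a + N * ENNReal.ofReal (2 * δ) ≤ ∑ i ∈ Finset.range N, edist (h (u (i + 1))) (h (u i)) := by
    have h1 : Tendsto (fun δ : ℝ => a + N * ENNReal.ofReal (2 * δ)) (𝓝[>] 0) (𝓝 a) := by
      have h2 : Tendsto (fun δ : ℝ => ENNReal.ofReal (2 * δ)) (𝓝 0) (𝓝 0) := by
        have : Continuous fun δ : ℝ => ENNReal.ofReal (2 * δ) :=
          ENNReal.continuous_ofReal.comp (by fun_prop)
        simpa using this.tendsto 0
      have h3 := (ENNReal.Tendsto.const_mul (a := (N : ℝ≥0∞)) h2 (Or.inr (by simp))).const_add a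
      simp only [mul_zero, add_zero] at h3
      exact h3.mono_left nhdsWithin_le_nhds
    obtain ⟨δ, h2, h3⟩ := ((h1.eventually (gt_mem_nhds hau)).and self_mem_nhdsWithin).exists
    exact ⟨δ, h3, h2.le⟩
  filter_upwards [eventually_exists_near_epiLimit_finset (U := U) hM h0 S hε hδ] with n hn
  obtain ⟨z, hz⟩ := hn
  have hzm : MonotoneOn z S := by
    intro x hx y hy hxy
    rcases hxy.eq_or_lt with rfl | hlt
    · exact le_rfl
    · have h1 := abs_lt.1 (hz x hx).1
      have h2 := abs_lt.1 (hz y hy).1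
      linarith [hgap x hx y hy hlt]
  have hle : ∑ i ∈ Finset.range N, edist (H n (z (u (i + 1)))) (H n (z (u i))) ≤
      eVariationOn (H n) univ :=
    eVariationOn.sum_le_of_monotoneOn_Iic (u := fun i => z (u i))
      (fun i hi j hj hij => hzm (hS i hi) (hS j hj) (hu hij)) fun _ _ => mem_univ _
  have hsum : ∑ i ∈ Finset.range N, edist (h (u (i + 1))) (h (u i)) ≤
      (∑ i ∈ Finset.range N, edist (H n (z (u (i + 1)))) (H n (z (u i)))) +
        N * ENNReal.ofReal (2 * δ) := by
    have : (N : ℝ≥0∞) * ENNReal.ofReal (2 * δ) =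
        ∑ _i ∈ Finset.range N, ENNReal.ofReal (2 * δ) := by simp
    rw [this, ← Finset.sum_add_distrib]
    refine Finset.sum_le_sum fun i hi => ?_
    have hi' := Finset.mem_range.1 hi
    rw [edist_dist, edist_dist, ← ENNReal.ofReal_add dist_nonneg (by positivity)]
    refine ENNReal.ofReal_le_ofReal ?_
    rw [Real.dist_eq, Real.dist_eq]
    have h1 := abs_le.1 (hz _ (hS i hi'.le)).2
    have h2 := abs_le.1 (hz _ (hS (i + 1) hi')).2
    have h3 := abs_le.1 (le_refl |H n (z (u (i + 1))) - H n (z (u i))|)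
    exact abs_le.2 ⟨by linarith, by linarith⟩
  have h5 := (hδN.trans hsum).trans (add_le_add_left hle _)
  exact (ENNReal.add_le_add_iff_right (by finiteness)).1 h5

/-- A height strictly below the epi-limit at a point is eventually below `H n` on a whole
neighbourhood; compactness of the support makes this uniform. -/
theorem eventually_isStream (h0 : ∀ n x, 0 ≤ H n x)
    {ψ : ℝ × ℝ → ℝ} (hψ : IsStream (epiLimit U H) ψ) :
    ∀ᶠ n in (U : Filter ℕ), IsStream (H n) ψ := by
  have key : ∀ᶠ n in (U : Filter ℕ), tsupport ψ ⊆ filmRegion (H n) := by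
    refine IsCompact.induction_on (p := fun s => ∀ᶠ n in (U : Filter ℕ), s ⊆ filmRegion (H n))
      hψ.compact (Eventually.of_forall fun _ => empty_subset _)
      (fun s t hst ht => ht.mono fun n hn => hst.trans hn)
      (fun s t hs ht => (hs.and ht).mono fun n hn => union_subset hn.1 hn.2) fun p hp => ?_
    obtain ⟨hp1, hp2⟩ := hψ.subset hp
    obtain ⟨c, hc1, hc2⟩ := exists_between (max_lt hp1 hp2)
    obtain ⟨ε, hε, hev⟩ := exists_of_lt_epiLimit h0 hc2
    refine ⟨{q | |q.1 - p.1| < ε} ∩ {q | q.2 < c}, mem_nhdsWithin_of_mem_nhds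
      (IsOpen.mem_nhds (IsOpen.inter ?_ ?_) ⟨by simpa using hε, (max_lt_iff.1 hc1).2⟩),
      hev.mono fun n hn q hq => ?_⟩
    · exact isOpen_lt (by fun_prop) continuous_const
    · exact isOpen_lt (by fun_prop) continuous_const
    · have := hn q.1 hq.1
      exact ⟨(max_lt_iff.1 hc1).1.trans_le this, (show q.2 < c from hq.2).trans_le this⟩
  exact key.mono fun n hn => ⟨hψ.smooth, hψ.compact, hn⟩

theorem eventually_lt_elastic (h0 : ∀ n x, 0 ≤ H n x)
    (hi : ∀ n, Integrable (H n)) {c : ℝ} (hc : c < elastic (epiLimit U H)) :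
    ∀ᶠ n in (U : Filter ℕ), c < elastic (H n) := by
  obtain ⟨ψ, hψ, hcψ⟩ := exists_lt_dualEnergy hc
  exact (eventually_isStream h0 hψ).mono fun n hn =>
    hcψ.trans_le (dualEnergy_le_elastic (hi n) (h0 n) hn)

end

/-! ### Existence of minimizers on a fixed interval -/

theorem abs_sub_le_totalVar {h : ℝ → ℝ} (hb : BoundedVariationOn h univ) (x y : ℝ) :
    |h x - h y| ≤ totalVar h :=
  BoundedVariationOn.dist_le hb (mem_univ x) (mem_univ y)

theorem le_totalVar_of_zero {h : ℝ → ℝ} (hb : BoundedVariationOn h univ) {a : ℝ} (ha : h a = 0)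
    (x : ℝ) : h x ≤ totalVar h := by
  have := (le_abs_self _).trans (abs_sub_le_totalVar hb x a)
  rwa [ha, sub_zero] at this

theorem abs_integral_sub_sample_le {k : ℝ → ℝ} (hk : Profile k) {a b z : ℝ} (hab : a ≤ b)
    (hz : z ∈ Icc a b) :
    |(∫ x in a..b, k x) - (b - a) * k z| ≤ (b - a) * (cumVar k b - cumVar k a) := by
  have h1 : (∫ x in a..b, k x) - (b - a) * k z = ∫ x in a..b, (k x - k z) := by
    rw [intervalIntegral.integral_sub hk.integrable.intervalIntegrable (by simp)]
    simp
  have h2 := intervalIntegral.norm_integral_le_of_norm_le_const (f := fun x => k x - k z)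
    (a := a) (b := b) (C := cumVar k b - cumVar k a) fun x hx => by
      rw [uIoc_of_le hab] at hx
      exact abs_sub_le_cumVar hk.bv ⟨hx.1.le, hx.2⟩ hz
  rw [h1, mul_comm, ← abs_of_nonneg (sub_nonneg.2 hab)]
  exact h2

theorem intervalIntegral_eq_of_zero_off {k : ℝ → ℝ} {R : ℝ} (hR : 0 ≤ R)
    (hz : ∀ x, x ∉ Icc 0 R → k x = 0) : ∫ x in (0 : ℝ)..R, k x = ∫ x, k x := by
  rw [intervalIntegral.integral_of_le hR, ← integral_Icc_eq_integral_Ioc,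
    setIntegral_eq_integral_of_forall_compl_eq_zero hz]

/-- Compare Riemann sums: on each cell the integral differs from cell length times any sample by at
most the length times the variation on the cell, and these variations telescope. The two sample
points in a cell need not coincide. -/
theorem abs_integral_sub_le {h k : ℝ → ℝ} (hh : Profile h) (hk : Profile k) {R : ℝ} (hR : 0 < R)
    (hh0 : ∀ x, x ∉ Icc 0 R → h x = 0) (hk0 : ∀ x, x ∉ Icc 0 R → k x = 0) {N : ℕ} (hN : 0 < N)
    {δ : ℝ}
    (hz : ∀ i < N, ∃ y ∈ Icc (i * (R / N)) ((i + 1 : ℕ) * (R / N)),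
      ∃ z ∈ Icc (i * (R / N)) ((i + 1 : ℕ) * (R / N)), |k z - h y| ≤ δ) :
    |(∫ x, k x) - ∫ x, h x| ≤ R / N * (totalVar h + totalVar k) + R * δ := by
  have hN' : (0 : ℝ) < N := by exact_mod_cast hN
  set l := R / N with hl
  have hlN : N * l = R := by rw [hl]; field_simp
  have hl0 : 0 < l := by positivity
  set a : ℕ → ℝ := fun i => i * l with ha
  have step : ∀ i, a (i + 1) - a i = l := fun i => by simp [ha]; ring
  have mono : ∀ i, a i ≤ a (i + 1) := fun i => by linarith [step i]
  have split : ∀ g : ℝ → ℝ, Integrable g → (∀ x, x ∉ Icc 0 R → g x = 0) →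
      ∫ x, g x = ∑ i ∈ Finset.range N, ∫ x in a i..a (i + 1), g x := by
    intro g hg hg0
    rw [intervalIntegral.sum_integral_adjacent_intervals fun i _ => hg.intervalIntegrable,
      ← intervalIntegral_eq_of_zero_off hR.le hg0]
    simp [ha, hlN]
  rw [split k hk.integrable hk0, split h hh.integrable hh0, ← Finset.sum_sub_distrib]
  have cell : ∀ i ∈ Finset.range N, |(∫ x in a i..a (i + 1), k x) - ∫ x in a i..a (i + 1), h x| ≤
      l * (cumVar k (a (i + 1)) - cumVar k (a i)) + l * (cumVar h (a (i + 1)) - cumVar h (a i)) +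
        l * δ := by
    intro i hi
    obtain ⟨y, hy, z, hzz, hd⟩ := hz i (Finset.mem_range.1 hi)
    have h1 := abs_integral_sub_sample_le hk (mono i) hzz
    have h2 := abs_integral_sub_sample_le hh (mono i) hy
    rw [step] at h1 h2
    have h3 : |l * k z - l * h y| ≤ l * δ := by
      rw [← mul_sub, abs_mul, abs_of_pos hl0]
      exact mul_le_mul_of_nonneg_left hd hl0.le
    rw [abs_le] at *
    constructor <;> linarith [h1.1, h1.2, h2.1, h2.2, h3.1, h3.2]
  refine (Finset.abs_sum_le_sum_abs _ _).trans ((Finset.sum_le_sum cell).trans ?_)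
  rw [Finset.sum_add_distrib, Finset.sum_add_distrib, ← Finset.mul_sum, ← Finset.mul_sum,
    Finset.sum_range_sub (fun i => cumVar k (a i)), Finset.sum_range_sub (fun i => cumVar h (a i))]
  simp only [Finset.sum_const, Finset.card_range, nsmul_eq_mul]
  have e1 : l * (cumVar k (a N) - cumVar k (a 0)) ≤ l * totalVar k :=
    mul_le_mul_of_nonneg_left (by linarith [cumVar_le_totalVar hk.bv (a N), cumVar_nonneg k (a 0)])
      hl0.le
  have e2 : l * (cumVar h (a N) - cumVar h (a 0)) ≤ l * totalVar h :=
    mul_le_mul_of_nonneg_left (by linarith [cumVar_le_totalVar hh.bv (a N), cumVar_nonneg h (a 0)])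
      hl0.le
  have e3 : (N : ℝ) * (l * δ) = R * δ := by rw [← mul_assoc, hlN]
  linarith

/-- The energy of a profile after minimization over the displacement. -/
noncomputable def profileEnergy (h : ℝ → ℝ) : ℝ := elastic h + totalVar h

/-- A profile of volume `V` supported in `[0, R]`. -/
structure Confined (V R : ℝ) (h : ℝ → ℝ) : Prop extends Profile h where
  zero : ∀ x, x ∉ Icc 0 R → h x = 0
  volume : ∫ x, h x = V

theorem profileEnergy_nonneg {h : ℝ → ℝ} (hh : Profile h) : 0 ≤ profileEnergy h :=
  add_nonneg (elastic_nonneg hh.integrable hh.nonneg) (totalVar_nonneg h)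

/-- Minimizers exist among the profiles supported in a given interval. -/
theorem exists_confined_minimizer {V R : ℝ} (hR : 0 < R) (hne : ∃ k, Confined V R k) :
    ∃ h, Confined V R h ∧ ∀ k, Confined V R k → profileEnergy h ≤ profileEnergy k := by
  set s := profileEnergy '' {k | Confined V R k}
  have sne : s.Nonempty := by
    obtain ⟨k, hk⟩ := hne
    exact ⟨_, k, hk, rfl⟩
  have sbdd : BddBelow s := ⟨0, by rintro _ ⟨k, hk, rfl⟩; exact profileEnergy_nonneg hk.toProfile⟩
  obtain ⟨u, ua, ut, us⟩ := exists_seq_tendsto_sInf sne sbdd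
  choose H hH hHu using us
  replace hH : ∀ n, Confined V R (H n) := hH
  set W := u 0
  have hW : ∀ n, totalVar (H n) ≤ W := fun n => by
    have h1 := elastic_nonneg (hH n).integrable (hH n).nonneg
    have h2 := hHu n
    have h3 := ua (Nat.zero_le n)
    rw [profileEnergy] at h2
    linarith
  have h0 : ∀ n x, 0 ≤ H n x := fun n => (hH n).nonneg
  -- `R + 1` lies outside the interval, so each profile has a zero and its variation bounds its
  -- height.
  have hM : ∀ n x, H n x ≤ W := fun n x =>
    (le_totalVar_of_zero (hH n).bv ((hH n).zero (R + 1) (by simp)) x).trans (hW n)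
  set U := hyperfilter ℕ
  set h := epiLimit U H
  have hl : LowerSemicontinuous h := lowerSemicontinuous_epiLimit hM h0
  have hn : ∀ x, 0 ≤ h x := epiLimit_nonneg hM h0
  have hz : ∀ x, x ∉ Icc 0 R → h x = 0 := fun x hx =>
    le_antisymm (epiLimit_le h0 fun n => ((hH n).zero x hx).le) (hn x)
  have hi : Integrable h := by
    have hb : Integrable ((Icc 0 R).indicator fun _ : ℝ => W) :=
      (integrable_indicator_iff measurableSet_Icc).2 (integrableOn_const (by simp))
    refine hb.mono' hl.measurable.aestronglyMeasurable (ae_of_all _ fun x => ?_)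
    rw [Real.norm_of_nonneg (hn x)]
    by_cases hx : x ∈ Icc 0 R
    · rw [indicator_of_mem hx]
      exact epiLimit_le h0 fun n => hM n x
    · rw [indicator_of_notMem hx, hz x hx]
  have hv : ∀ n, eVariationOn (H n) univ = ENNReal.ofReal (totalVar (H n)) := fun n =>
    (ENNReal.ofReal_toReal (hH n).bv).symm
  have hb : BoundedVariationOn h univ := by
    intro htop
    have h1 : ENNReal.ofReal W + 1 < eVariationOn h univ := by
      rw [htop]
      finiteness
    obtain ⟨n, h2⟩ := (eventually_lt_eVariationOn hM h0 h1).exists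
    rw [hv] at h2
    have h3 := h2.trans (ENNReal.ofReal_le_ofReal (hW n))
    exact absurd h3 (not_le.2 (ENNReal.lt_add_right ENNReal.ofReal_ne_top one_ne_zero))
  have hp : Profile h := ⟨hi, hb, hl, hn⟩
  have hvol : ∫ x, h x = V := by
    have key : |V - ∫ x, h x| ≤ 0 := by
      refine le_of_forall_pos_le_add fun η hη => ?_
      -- With `N` cells the variation error is at most `η/2`; the sampling tolerance `η/2/R`
      -- accounts for the other half.
      obtain ⟨N, hN⟩ := exists_nat_gt (R * (totalVar h + W) / (η / 2))
      have hT : 0 ≤ R * (totalVar h + W) :=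
        mul_nonneg hR.le (add_nonneg (totalVar_nonneg h) ((totalVar_nonneg _).trans (hW 0)))
      have hN0 : (0 : ℝ) < N := lt_of_le_of_lt (by positivity) hN
      have hN' : 0 < N := by exact_mod_cast hN0
      set l := R / N
      have hl0 : 0 < l := by positivity
      -- Recovery points are taken within half a cell of the midpoints, so each stays in its own
      -- cell.
      obtain ⟨n, z, hzn⟩ := (eventually_exists_near_epiLimit_finset (U := U) hM h0
        ((Finset.range N).image fun i : ℕ => (i + 1 / 2) * l) (half_pos hl0)
        (by positivity : 0 < η / 2 / R)).exists
      have h1 := abs_integral_sub_le hp (hH n).toProfile hR hz (hH n).zero hN' (δ := η / 2 / R)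
        fun i hi => by
          have h2 := hzn _ (Finset.mem_image_of_mem _ (Finset.mem_range.2 hi))
          have h3 := abs_lt.1 h2.1
          refine ⟨(i + 1 / 2) * l, ⟨?_, ?_⟩, z ((i + 1 / 2) * l), ⟨?_, ?_⟩, h2.2⟩
          all_goals
            push_cast
            linarith [h3.1, h3.2]
      rw [(hH n).volume] at h1
      have h2 : R / N * (totalVar h + totalVar (H n)) ≤ η / 2 := by
        have h3 : R / N * (totalVar h + totalVar (H n)) ≤ R / N * (totalVar h + W) :=
          mul_le_mul_of_nonneg_left (by linarith [hW n]) hl0.le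
        refine h3.trans ?_
        rw [div_lt_iff₀ (by positivity)] at hN
        rw [div_mul_eq_mul_div, div_le_iff₀ hN0]
        linarith
      have h4 : R * (η / 2 / R) = η / 2 := by field_simp
      linarith
    linarith [abs_nonpos_iff.1 key]
  refine ⟨h, ⟨hp, hz, hvol⟩, fun k hk => ?_⟩
  refine le_trans ?_ (csInf_le sbdd ⟨k, hk, rfl⟩)
  have utU : Tendsto u U (𝓝 (sInf s)) := ut.mono_left Nat.hyperfilter_le_atTop
  refine le_of_forall_pos_le_add fun η hη => ?_
  have e1 := eventually_lt_elastic (U := U) h0 (fun n => (hH n).integrable)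
    (sub_lt_self (elastic h) (by positivity : 0 < η / 3))
  have e2 : ∀ᶠ n in (U : Filter ℕ), totalVar h - η / 3 ≤ totalVar (H n) := by
    rcases lt_or_ge (totalVar h - η / 3) 0 with hneg | hpos
    · exact Eventually.of_forall fun n => hneg.le.trans (totalVar_nonneg _)
    · have h1 : ENNReal.ofReal (totalVar h - η / 3) < eVariationOn h univ := by
        rw [← ENNReal.ofReal_toReal hb]
        exact (ENNReal.ofReal_lt_ofReal_iff_of_nonneg hpos).2
          (sub_lt_self _ (by positivity))
      refine (eventually_lt_eVariationOn hM h0 h1).mono fun n hn => ?_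
      rw [hv] at hn
      exact (ENNReal.ofReal_le_ofReal_iff (totalVar_nonneg _)).1 hn
  have e3 := utU.eventually (gt_mem_nhds (by linarith : sInf s < sInf s + η / 3))
  obtain ⟨n, h1, h2, h3⟩ := (e1.and (e2.and e3)).exists
  have h4 := hHu n
  rw [profileEnergy] at h4 ⊢
  linarith

/-! ### Thin parts of minimizers and the existence of gaps -/

/-- A constant for the thin film inequality. -/
noncomputable def filmConst : ℝ := exists_thin_film_bound.choose

theorem filmConst_pos : 0 < filmConst := exists_thin_film_bound.choose_spec.1

theorem thin_film_bound {h : ℝ → ℝ} {s : ℝ} (hh : Profile h) (hc : HasCompactSupport h) (hs : 0 < s)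
    (hhs : ∀ x, h x ≤ s) : (∫ x, h x) - filmConst * s * totalVar h ≤ elastic h :=
  exists_thin_film_bound.choose_spec.2 h s hh hc hs hhs

theorem profileEnergy_const_mul_le {h : ℝ → ℝ} (hh : Profile h) {t : ℝ} (ht : 1 ≤ t) :
    profileEnergy (fun x => t * h x) ≤ t * profileEnergy h := by
  have h1 := elastic_stretch_le hh.integrable hh.nonneg ht
  have h2 := (hh.const_mul (zero_le_one.trans ht)).2
  rw [profileEnergy, profileEnergy, mul_add]
  exact add_le_add h1 h2

/-- Minimality among the profiles of given volume, tested with a stretched profile. -/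
theorem mul_profileEnergy_le {V R F : ℝ} (hV : 0 < V)
    (hmin : ∀ k, Confined V R k → F ≤ profileEnergy k) {k : ℝ → ℝ} (hk : Profile k)
    (hk0 : ∀ x, x ∉ Icc 0 R → k x = 0) (hkV : ∫ x, k x ≤ V) :
    (∫ x, k x) * F ≤ V * profileEnergy k := by
  have h0 : 0 ≤ ∫ x, k x := integral_nonneg hk.nonneg
  rcases h0.eq_or_lt with h1 | h1
  · rw [← h1, zero_mul]
    exact mul_nonneg hV.le (profileEnergy_nonneg hk)
  · set t := V / ∫ x, k x
    have ht : 1 ≤ t := (one_le_div h1).2 hkV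
    have hc : Confined V R fun x => t * k x :=
      ⟨(hk.const_mul (zero_le_one.trans ht)).1, fun x hx => by rw [hk0 x hx, mul_zero], by
        rw [integral_const_mul, div_mul_cancel₀ _ h1.ne']⟩
    have h2 := (hmin _ hc).trans (profileEnergy_const_mul_le hk ht)
    calc (∫ x, k x) * F ≤ (∫ x, k x) * (t * profileEnergy k) := by gcongr
      _ = V * profileEnergy k := by
        simp only [t]
        field_simp

/-- Removing the film over `[a, b]` releases its elastic energy, almost its volume `v` by the thin
film inequality, and its variation, at the price of the two end heights. Stretching the rest back to
volume `V` and using minimality gives `(V - v) F ≤ V E` for the energy `E` of the rest; the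
hypothesis `F ≤ (1 - θ) V` leaves the gain `θ v`. -/
theorem cut_inequality {V R θ s a b : ℝ} {h : ℝ → ℝ} (hV : 0 < V) (hh : Confined V R h)
    (hmin : ∀ k, Confined V R k → profileEnergy h ≤ profileEnergy k)
    (hF : profileEnergy h ≤ (1 - θ) * V) (hab : a < b) (hs : 0 < s)
    (hbd : ∀ x ∈ Icc a b, h x ≤ s) :
    θ * (∫ x in a..b, h x) ≤ (1 + filmConst * s) * (h a + h b) -
      (1 - filmConst * s) * (cumVar h b - cumVar h a) := by
  obtain ⟨hp1, hv1⟩ := hh.toProfile.cut hab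
  obtain ⟨hp2, hv2⟩ := hh.toProfile.cut_compl hab.le
  set k₁ := (Ioo a b).indicator h
  set k₂ := (Icc a b)ᶜ.indicator h
  set v := ∫ x in a..b, h x with hv
  set F := profileEnergy h with hFdef
  have int1 : ∫ x, k₁ x = v := by
    rw [integral_indicator measurableSet_Ioo, ← integral_Ioc_eq_integral_Ioo,
      ← intervalIntegral.integral_of_le hab.le]
  have int2 : ∫ x, k₂ x = V - v := by
    rw [integral_indicator measurableSet_Icc.compl, setIntegral_compl measurableSet_Icc
      hh.integrable, hh.volume, integral_Icc_eq_integral_Ioc,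
      ← intervalIntegral.integral_of_le hab.le]
  have v0 : 0 ≤ v := intervalIntegral.integral_nonneg hab.le fun x _ => hh.nonneg x
  have hsum : elastic k₁ + elastic k₂ ≤ elastic h := by
    refine elastic_add_le hh.integrable hh.nonneg
      (fun x => indicator_le_self' (fun x _ => hh.nonneg x) x)
      (fun x => indicator_le_self' (fun x _ => hh.nonneg x) x) fun x => ?_
    by_cases hx : x ∈ Icc a b
    · exact Or.inr (indicator_of_notMem (notMem_compl_iff.2 hx) _)
    · exact Or.inl (indicator_of_notMem (fun h' => hx ⟨h'.1.le, h'.2.le⟩) _)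
  have hfilm : v - filmConst * s * totalVar k₁ ≤ elastic k₁ := by
    rw [← int1]
    refine thin_film_bound hp1 (HasCompactSupport.intro (isCompact_Icc (a := a) (b := b))
      fun x hx => indicator_of_notMem (fun h' => hx ⟨h'.1.le, h'.2.le⟩) _) hs fun x => ?_
    by_cases hx : x ∈ Ioo a b
    · simpa [k₁, hx] using hbd x ⟨hx.1.le, hx.2.le⟩
    · simpa [k₁, hx] using hs.le
  have hfilm' : v - filmConst * s * (cumVar h b - cumVar h a + h a + h b) ≤ elastic k₁ := by
    refine le_trans ?_ hfilm
    have : filmConst * s * totalVar k₁ ≤ filmConst * s * (cumVar h b - cumVar h a + h a + h b) :=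
      mul_le_mul_of_nonneg_left hv1 (mul_nonneg filmConst_pos.le hs.le)
    linarith
  have hk2 : profileEnergy k₂ ≤ F - v + (1 + filmConst * s) * (h a + h b) -
      (1 - filmConst * s) * (cumVar h b - cumVar h a) := by
    rw [hFdef, profileEnergy, profileEnergy]
    linarith
  have hm := mul_profileEnergy_le hV hmin hp2 (fun x hx => by
    simp only [k₂, indicator_apply, hh.zero x hx, ite_self]) (by rw [int2]; linarith)
  rw [int2] at hm
  have h1 := hm.trans (mul_le_mul_of_nonneg_left hk2 hV.le)
  have h2 : F * v ≤ (1 - θ) * V * v := mul_le_mul_of_nonneg_right hF v0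
  refine le_of_mul_le_mul_left (a := V) ?_ hV
  linarith

theorem two_mul_sub_le_cumVar {h : ℝ → ℝ} (hb : BoundedVariationOn h univ) {a b z : ℝ}
    (hz : z ∈ Icc a b) : |2 * h z - (h a + h b)| ≤ cumVar h b - cumVar h a := by
  have h1 := abs_le.1 (abs_sub_le_cumVar hb (left_mem_Icc.2 hz.1) (right_mem_Icc.2 hz.1))
  have h2 := abs_le.1 (abs_sub_le_cumVar hb (left_mem_Icc.2 hz.2) (right_mem_Icc.2 hz.2))
  exact abs_le.2 ⟨by linarith, by linarith⟩

/-- A long thin part of a minimizer carries little volume compared with its end heights. -/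
theorem volume_le_sq_of_thin {V R θ a b : ℝ} {h : ℝ → ℝ} (hV : 0 < V) (hθ : 0 < θ)
    (hh : Confined V R h) (hmin : ∀ k, Confined V R k → profileEnergy h ≤ profileEnergy k)
    (hF : profileEnergy h ≤ (1 - θ) * V) (hab : 4 / θ ≤ b - a)
    (hbd : ∀ x ∈ Icc a b, h x ≤ 1 / (2 * filmConst)) :
    θ * (∫ x in a..b, h x) ≤ 8 * filmConst * (h a + h b) ^ 2 := by
  have hC := filmConst_pos
  have hlt : a < b := by
    have : 0 < 4 / θ := by positivity
    linarith
  set f := h a + h b with hf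
  set v := ∫ x in a..b, h x with hv
  have f0 : 0 ≤ f := add_nonneg (hh.nonneg a) (hh.nonneg b)
  have v0 : 0 ≤ v := intervalIntegral.integral_nonneg hlt.le fun x _ => hh.nonneg x
  -- First use, with `C s = 1/2`: it bounds the variation on `[a, b]` by `3 f`, hence `h` by `2 f`
  -- there.
  have h1 := cut_inequality hV hh hmin hF hlt (by positivity) hbd
  have e1 : filmConst * (1 / (2 * filmConst)) = 1 / 2 := by field_simp
  rw [e1, ← hf, ← hv] at h1
  have hz2 : ∀ z ∈ Icc a b, h z ≤ 2 * f := by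
    intro z hz
    have h2 := (abs_le.1 (two_mul_sub_le_cumVar hh.bv hz)).2
    have h3 : 0 ≤ θ * v := by positivity
    linarith
  have hpt : ∀ z ∈ Icc a b, θ * v - 4 * filmConst * f ^ 2 ≤ 2 * h z := by
    intro z hz
    -- The height parameter of the second cut must be positive, so vanishing end heights are treated
    -- separately.
    rcases f0.eq_or_lt with h0 | h0
    · have : v = 0 := by
        rw [hv, intervalIntegral.integral_of_le hlt.le, ← integral_Icc_eq_integral_Ioc]
        refine setIntegral_eq_zero_of_forall_eq_zero fun x hx => ?_
        exact le_antisymm (by linarith [hz2 x hx]) (hh.nonneg x)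
      rw [this, ← h0]
      simpa using hh.nonneg z
    · have hs : 0 < min (2 * f) (1 / (2 * filmConst)) := lt_min (by linarith) (by positivity)
      set s := min (2 * f) (1 / (2 * filmConst))
      -- Second use, with the improved height bound `2 f`. Since the variation is at least `f - 2 h
      -- z`, the terms linear in `f` cancel up to an error of order `f²`.
      have h2 := cut_inequality hV hh hmin hF hlt hs fun x hx => le_min (hz2 x hx) (hbd x hx)
      have h3 := (abs_le.1 (two_mul_sub_le_cumVar hh.bv hz)).1
      have h4 : filmConst * s ≤ 1 / 2 := by
        rw [← e1]
        exact mul_le_mul_of_nonneg_left (min_le_right _ _) hC.le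
      have h5 : (1 - filmConst * s) * (f - 2 * h z) ≤
          (1 - filmConst * s) * (cumVar h b - cumVar h a) :=
        mul_le_mul_of_nonneg_left (by linarith) (by linarith)
      have h6 : filmConst * s * f ≤ filmConst * (2 * f) * f := by
        gcongr
        exact min_le_left _ _
      have h7 : 0 ≤ filmConst * s * h z := mul_nonneg (by positivity) (hh.nonneg z)
      rw [← hf, ← hv] at h2
      linarith
  -- Average the pointwise bound over `z`. As `b - a ≥ 4/θ`, the right side is at most `(b - a) θ v
  -- / 2` and half of `θ v` is absorbed.
  have hint : (b - a) * (θ * v - 4 * filmConst * f ^ 2) ≤ 2 * v := by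
    have h2 := intervalIntegral.integral_mono_on (f := fun _ => θ * v - 4 * filmConst * f ^ 2)
      (g := fun z => 2 * h z) (μ := volume) hlt.le (by simp)
      (hh.integrable.const_mul 2).intervalIntegrable hpt
    rwa [intervalIntegral.integral_const, smul_eq_mul, intervalIntegral.integral_const_mul] at h2
  rw [div_le_iff₀ hθ] at hab
  have h8 : 2 * v ≤ (b - a) * (θ * v / 2) := by nlinarith
  have h9 : (b - a) * (θ * v - 4 * filmConst * f ^ 2) ≤ (b - a) * (θ * v / 2) := hint.trans h8
  have := le_of_mul_le_mul_left h9 (sub_pos.2 hlt)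
  linarith

/-- A nonnegative function whose integral over growing intervals is controlled by the square of its
end values has an interval around the centre where the integral vanishes. -/
theorem integral_eq_zero_of_sqrt_le {h : ℝ → ℝ} (hi : Integrable h) (h0 : ∀ x, 0 ≤ h x)
    {m κ r₀ r₁ : ℝ} (hκ : 0 < κ) (hr₀ : 0 ≤ r₀) (hr : r₀ ≤ r₁)
    (hsq : ∀ r ∈ Icc r₀ r₁, κ * √(∫ x in (m - r)..(m + r), h x) ≤ h (m - r) + h (m + r))
    (hlong : √(∫ x, h x) < κ / 4 * (r₁ - r₀)) : ∫ x in (m - r₀)..(m + r₀), h x = 0 := by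
  set A : ℝ → ℝ := fun r => ∫ x in (m - r)..(m + r), h x with hA
  have hint : ∀ a b : ℝ, IntervalIntegrable h volume a b := fun a b => hi.intervalIntegrable
  have A0 : ∀ r, 0 ≤ r → 0 ≤ A r := fun r hr =>
    intervalIntegral.integral_nonneg (by linarith) fun x _ => h0 x
  have Adiff : ∀ x y, A y - A x = ∫ r in x..y, (h (m - r) + h (m + r)) := by
    intro x y
    rw [intervalIntegral.integral_add (hi.comp_sub_left m).intervalIntegrable
      (hi.comp_add_left m).intervalIntegrable, intervalIntegral.integral_comp_sub_left,
      intervalIntegral.integral_comp_add_left]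
    simp only [hA]
    have e1 := intervalIntegral.integral_add_adjacent_intervals (hint (m - y) (m - x))
      (hint (m - x) (m + x))
    have e2 := intervalIntegral.integral_add_adjacent_intervals (hint (m - y) (m + x))
      (hint (m + x) (m + y))
    linarith
  have Amono : ∀ x y, x ≤ y → A x ≤ A y := fun x y hxy => by
    rw [← sub_nonneg, Adiff]
    exact intervalIntegral.integral_nonneg hxy fun r _ => add_nonneg (h0 _) (h0 _)
  have Acont : Continuous A := by
    have e : A = fun y => A 0 + ∫ r in (0 : ℝ)..y, (h (m - r) + h (m + r)) := by
      funext y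
      rw [← Adiff]
      ring
    rw [e]
    exact continuous_const.add (intervalIntegral.continuous_primitive (fun a b =>
      ((hi.comp_sub_left m).add (hi.comp_add_left m)).intervalIntegrable) 0)
  by_contra hne
  have hpos : 0 < A r₀ := lt_of_le_of_ne (A0 r₀ hr₀) (Ne.symm hne)
  set β := √(A r₀) with hβ
  have hβ0 : 0 < β := Real.sqrt_pos.2 hpos
  -- The inequality `A' ≥ κ √A` makes `√A` grow with slope at least `κ/2`. Half of this slope makes
  -- the comparison with the parabola `(α (r - r₀) + β)²` strict, as the barrier lemma requires.
  set α := κ / 4 with hα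
  have hα0 : 0 < α := by positivity
  have key := image_le_of_liminf_slope_right_lt_deriv_boundary (f := fun r => - A r)
    (f' := fun r => - (κ * √(A r))) (a := r₀) (b := r₁)
    (B := fun r => - (α * (r - r₀) + β) ^ 2) (B' := fun r => - (2 * α * (α * (r - r₀) + β)))
    Acont.neg.continuousOn ?_ ?_ ?_ ?_
  · have h1 := key ⟨hr, le_rfl⟩
    have h2 : A r₁ ≤ ∫ x, h x := by
      simp only [hA]
      rw [intervalIntegral.integral_of_le (by linarith)]
      exact setIntegral_le_integral hi (ae_of_all _ h0)
    have h3 : α * (r₁ - r₀) + β ≤ √(∫ x, h x) := by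
      refine Real.le_sqrt_of_sq_le ?_
      linarith
    linarith
  · intro x hx r hr'
    refine Eventually.frequently ?_
    have hmem : Ioo x r₁ ∈ 𝓝[>] x := Ioo_mem_nhdsGT hx.2
    filter_upwards [hmem] with z hz
    refine lt_of_le_of_lt ?_ hr'
    rw [slope_def_field, div_le_iff₀ (sub_pos.2 hz.1)]
    -- Only difference quotients are estimated, since `A` need not be differentiable everywhere;
    -- monotonicity of `A` lets its value at `x` serve on all of `[x, z]`.
    have h1 : (z - x) * (κ * √(A x)) ≤ A z - A x := by
      rw [Adiff, ← smul_eq_mul, ← intervalIntegral.integral_const]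
      refine intervalIntegral.integral_mono_on hz.1.le (by simp)
        ((hi.comp_sub_left m).add (hi.comp_add_left m)).intervalIntegrable fun r hrr => ?_
      refine le_trans ?_ (hsq r ⟨hx.1.trans hrr.1, hrr.2.trans hz.2.le⟩)
      exact mul_le_mul_of_nonneg_left (Real.sqrt_le_sqrt (Amono x r hrr.1)) hκ.le
    linarith
  · simp only [sub_self, mul_zero, zero_add, hβ]
    rw [Real.sq_sqrt hpos.le]
  · intro x
    have h1 : HasDerivAt (fun r => α * (r - r₀) + β) α x := by
      simpa using (((hasDerivAt_id x).sub_const r₀).const_mul α).add_const β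
    have h2 := (h1.pow 2).neg
    refine h2.congr_deriv ?_
    simp
    ring
  · intro x hx hAB
    have h1 : 0 < α * (x - r₀) + β := by
      have : 0 ≤ α * (x - r₀) := mul_nonneg hα0.le (sub_nonneg.2 hx.1)
      linarith
    have h2 : √(A x) = α * (x - r₀) + β := by
      rw [neg_inj.1 hAB, Real.sqrt_sq h1.le]
    show - (κ * √(A x)) < - (2 * α * (α * (x - r₀) + β))
    rw [h2]
    have : 2 * α * (α * (x - r₀) + β) < κ * (α * (x - r₀) + β) :=
      mul_lt_mul_of_pos_right (by rw [hα]; linarith) h1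
    linarith

/-- By lower semicontinuity the set where `h` is positive is open, so it cannot be a nonempty null
set inside the interval. -/
theorem eq_zero_of_integral_eq_zero {h : ℝ → ℝ} (hh : Profile h) {a b : ℝ} (hab : a ≤ b)
    (hz : ∫ x in a..b, h x = 0) : ∀ x ∈ Ioo a b, h x = 0 := by
  rw [intervalIntegral.integral_of_le hab, integral_Ioc_eq_integral_Ioo,
    setIntegral_eq_zero_iff_of_nonneg_ae (ae_of_all _ hh.nonneg) hh.integrable.integrableOn] at hz
  intro x hx
  by_contra hne
  have hpos : 0 < h x := lt_of_le_of_ne (hh.nonneg x) (Ne.symm hne)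
  have hop : IsOpen (Ioo a b ∩ h ⁻¹' Ioi 0) := isOpen_Ioo.inter (hh.lsc.isOpen_preimage 0)
  have h1 := hop.measure_pos volume ⟨x, hx, hpos⟩
  have h2 : volume (Ioo a b ∩ h ⁻¹' Ioi 0) = 0 := by
    have h3 := (ae_iff.1 hz)
    rw [Measure.restrict_apply' measurableSet_Ioo] at h3
    refine measure_mono_null (fun y hy => ?_) h3
    exact mem_inter (fun h4 : h y = 0 => (ne_of_gt (show 0 < h y from hy.2)) h4) hy.1
  exact absurd h2 h1.ne'

/-- Pigeonhole: a cell on which `h` exceeds `c` somewhere consumes at least `L c` of its volume plus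
`L` times its variation, and the total of these is at most `L T`. -/
theorem exists_low_cell {h : ℝ → ℝ} (hh : Profile h) {c L T : ℝ} (hL : 0 < L) (n : ℕ)
    (hT : (∫ x, h x) / L + totalVar h ≤ T) (hn : T < n * c) :
    ∃ i < n, ∀ x ∈ Icc (i * L) ((i + 1 : ℕ) * L), h x ≤ c := by
  by_contra! hcon
  choose! z hz hcz using hcon
  set a : ℕ → ℝ := fun i => i * L with ha
  have step : ∀ i, a (i + 1) - a i = L := fun i => by simp [ha]; ring
  have cell : ∀ i ∈ Finset.range n, L * c ≤
      (∫ x in a i..a (i + 1), h x) + L * (cumVar h (a (i + 1)) - cumVar h (a i)) := by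
    intro i hi
    have hi' := Finset.mem_range.1 hi
    have h1 := (abs_le.1 (abs_integral_sub_sample_le hh (by linarith [step i]) (hz i hi'))).1
    change -((a (i + 1) - a i) * (cumVar h (a (i + 1)) - cumVar h (a i))) ≤
      (∫ x in a i..a (i + 1), h x) - (a (i + 1) - a i) * h (z i) at h1
    rw [step] at h1
    have h2 : L * c ≤ L * h (z i) := mul_le_mul_of_nonneg_left (hcz i hi').le hL.le
    linarith
  have h1 := Finset.sum_le_sum cell
  rw [Finset.sum_add_distrib, ← Finset.mul_sum (Finset.range n)
      (fun i => cumVar h (a (i + 1)) - cumVar h (a i)) L,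
    Finset.sum_range_sub (fun i => cumVar h (a i)), intervalIntegral.sum_integral_adjacent_intervals
      fun i _ => hh.integrable.intervalIntegrable] at h1
  simp only [Finset.sum_const, Finset.card_range, nsmul_eq_mul] at h1
  have h2 : ∫ x in a 0..a n, h x ≤ ∫ x, h x := by
    rw [intervalIntegral.integral_of_le (by simp only [ha]; gcongr; simp)]
    exact setIntegral_le_integral hh.integrable (ae_of_all _ hh.nonneg)
  have h3 : L * (cumVar h (a n) - cumVar h (a 0)) ≤ L * totalVar h :=
    mul_le_mul_of_nonneg_left (by linarith [cumVar_le_totalVar hh.bv (a n), cumVar_nonneg h (a 0)])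
      hL.le
  have h4 : (∫ x, h x) + L * totalVar h ≤ L * T := by
    have := mul_le_mul_of_nonneg_left hT hL.le
    rwa [mul_add, mul_div_cancel₀ _ hL.ne'] at this
  have h5 : L * T < L * (n * c) := mul_lt_mul_of_pos_left hn hL
  linarith

/-- Minimizers among the profiles on a long interval vanish on an interval of unit length. -/
theorem exists_gap {V θ : ℝ} (hV : 0 < V) (hθ : 0 < θ) (hθ1 : θ < 1) :
    ∃ R₀ : ℝ, 0 < R₀ ∧ ∀ R, R₀ ≤ R → ∀ h, Confined V R h →
      (∀ k, Confined V R k → profileEnergy h ≤ profileEnergy k) →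
      profileEnergy h ≤ (1 - θ) * V →
      ∃ p, 0 ≤ p ∧ p + 1 ≤ R ∧ ∀ x ∈ Icc p (p + 1), h x = 0 := by
  have hC := filmConst_pos
  set κ := √(θ / (8 * filmConst)) with hκ
  have hκ0 : 0 < κ := Real.sqrt_pos.2 (by positivity)
  -- Intervals of half-length at least `r₀` satisfy the length requirement of
  -- `volume_le_sq_of_thin`; since `θ < 1`, also `r₀ > 2`, which leaves room for a unit gap.
  set r₀ := 2 / θ with hr₀
  have hr2 : 2 < r₀ := by rw [hr₀, lt_div_iff₀ hθ]; linarith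
  -- Chosen so that `κ/4 (r₁ - r₀) = √V + 1` exceeds the square root of the volume.
  set r₁ := r₀ + 4 * (√V + 1) / κ with hr₁
  have hr : r₀ < r₁ := by
    have : 0 < 4 * (√V + 1) / κ := by positivity
    linarith
  set L := 2 * r₁ with hL
  have hL0 : 0 < L := by linarith
  set c := 1 / (2 * filmConst) with hc
  have hc0 : 0 < c := by positivity
  obtain ⟨n, hn⟩ := exists_nat_gt ((V / L + V) / c)
  have hn0 : (0 : ℝ) < n := lt_of_le_of_lt (by positivity) hn
  rw [div_lt_iff₀ hc0] at hn
  refine ⟨n * L, by positivity, fun R hR h hh hmin hF => ?_⟩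
  have hT : (∫ x, h x) / L + totalVar h ≤ V / L + V := by
    have h1 := elastic_nonneg hh.integrable hh.nonneg
    have h2 : 0 ≤ θ * V := by positivity
    rw [profileEnergy] at hF
    rw [hh.volume]
    linarith
  obtain ⟨i, hi, hlow⟩ := exists_low_cell hh.toProfile hL0 n hT hn
  set m := (i + 1 / 2) * L with hm
  have hend : (i + 1 : ℕ) * L = m + r₁ := by push_cast; rw [hm, hL]; ring
  have hstart : (i : ℝ) * L = m - r₁ := by rw [hm, hL]; ring
  rw [hend, hstart] at hlow
  have hzero := integral_eq_zero_of_sqrt_le hh.integrable hh.nonneg (m := m) hκ0 (by linarith) hr.le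
    (fun r hrr => by
      have h1 := volume_le_sq_of_thin hV hθ hh hmin hF (a := m - r) (b := m + r)
        (by rw [show m + r - (m - r) = 2 * r by ring]
            have : 4 / θ = 2 * r₀ := by rw [hr₀]; ring
            linarith [hrr.1])
        (fun x hx => hlow x ⟨by linarith [hx.1, hrr.2], by linarith [hx.2, hrr.2]⟩)
      rw [hκ, ← Real.sqrt_mul (by positivity)]
      refine Real.sqrt_le_iff.2 ⟨add_nonneg (hh.nonneg _) (hh.nonneg _), ?_⟩
      rw [div_mul_eq_mul_div, div_le_iff₀ (by positivity)]
      linarith)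
    (by
      rw [hh.volume, hr₁]
      have : κ / 4 * (r₀ + 4 * (√V + 1) / κ - r₀) = √V + 1 := by field_simp; ring
      linarith)
  have hz := eq_zero_of_integral_eq_zero hh.toProfile (by linarith) hzero
  have h3 : m + r₁ ≤ n * L := by
    rw [← hend]
    gcongr
    exact_mod_cast hi
  have h4 : 0 ≤ m - r₁ := by rw [← hstart]; positivity
  exact ⟨m, by linarith, by linarith, fun x hx => hz x ⟨by linarith [hx.1], by linarith [hx.2]⟩⟩

/-! ### From a fixed interval to all profiles -/

/-- A gap of unit length in a profile can be closed without increasing the energy. -/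
theorem exists_closed_gap {V R p : ℝ} {h : ℝ → ℝ} (hh : Confined V R h) (hp0 : 0 ≤ p)
    (hpR : p + 1 ≤ R) (hp : ∀ x ∈ Icc p (p + 1), h x = 0) :
    ∃ k, Confined V (R - 1) k ∧ profileEnergy k ≤ profileEnergy h := by
  -- A monotone reparametrization that skips the gap, so the variation cannot increase. At `p` the
  -- new profile is still zero, and the elastic energy splits there.
  set τ : ℝ → ℝ := fun x => if x ≤ p then x else x + 1 with hτ
  have hτm : Monotone τ := by
    intro x y hxy
    simp only [hτ]
    split_ifs <;> linarith
  set A := (Iio p).indicator h with hA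
  set B := (Ioi (p + 1)).indicator h with hB
  have hAi : Integrable A := hh.integrable.indicator measurableSet_Iio
  have hBi : Integrable B := hh.integrable.indicator measurableSet_Ioi
  have hB0 : ∀ x, 0 ≤ B x := indicator_nonneg fun x _ => hh.nonneg x
  have hsum : ∀ x, h x = A x + B x := by
    intro x
    rcases lt_or_ge x p with h1 | h1
    · have h2 : ¬ p + 1 < x := by linarith
      simp [hA, hB, h1, h2]
    · rcases lt_or_ge (p + 1) x with h2 | h2
      · simp [hA, hB, h2, not_lt.2 h1]
      · simp [hA, hB, not_lt.2 h2, not_lt.2 h1, hp x ⟨h1, h2⟩]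
  have hk : ∀ x, (h ∘ τ) x = A x + B (x + 1) := by
    intro x
    rcases lt_trichotomy x p with h1 | h1 | h1
    · simp [hA, hB, hτ, h1, h1.le, not_lt.2 h1.le]
    · simp [hA, hB, hτ, h1, hp p ⟨le_rfl, by linarith⟩]
    · simp [hA, hB, hτ, h1, not_le.2 h1, not_lt.2 h1.le]
  have hki : Integrable (h ∘ τ) := by
    rw [funext hk]
    exact hAi.add (hBi.comp_add_right 1)
  have hk0 : ∀ x, 0 ≤ (h ∘ τ) x := fun x => hh.nonneg _
  obtain ⟨hbv, hvar⟩ := hh.toProfile.comp_mono hτm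
  have hlsc : LowerSemicontinuous (h ∘ τ) := by
    rw [funext hk]
    exact (lowerSemicontinuous_indicator hh.lsc hh.nonneg isOpen_Iio).add
      ((lowerSemicontinuous_indicator hh.lsc hh.nonneg isOpen_Ioi).comp (by fun_prop))
  refine ⟨h ∘ τ, ⟨⟨hki, hbv, hlsc, hk0⟩, fun x hx => ?_, ?_⟩, ?_⟩
  · refine hh.zero _ fun h1 => hx ?_
    simp only [hτ] at h1
    split_ifs at h1 with h2
    · exact ⟨h1.1, by linarith⟩
    · exact ⟨by linarith, by linarith [h1.2]⟩
  · rw [funext hk, integral_add hAi (hBi.comp_add_right 1), integral_add_right_eq_self B 1,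
      ← integral_add hAi hBi, ← hh.volume]
    exact integral_congr_ae (ae_of_all _ fun x => (hsum x).symm)
  · refine add_le_add ?_ hvar
    have hpk : (h ∘ τ) p = 0 := by simp [hτ, hp p ⟨le_rfl, by linarith⟩]
    have e1 : (Iio p).indicator (h ∘ τ) = A := by
      funext x
      rcases lt_or_ge x p with h1 | h1
      · simp [hA, hτ, h1, h1.le]
      · simp [hA, not_lt.2 h1]
    have e2 : (Ioi p).indicator (h ∘ τ) = fun x => B (x + 1) := by
      funext x
      rcases lt_or_ge p x with h1 | h1
      · simp [hB, hτ, h1, not_le.2 h1]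
      · simp [hB, not_lt.2 h1]
    have h1 := elastic_le_add_of_zero hki hk0 hpk
    rw [e1, e2] at h1
    have h2 := elastic_translate_le hBi hB0 1
    have h3 : elastic A + elastic B ≤ elastic h := by
      refine elastic_add_le hh.integrable hh.nonneg
        (fun x => indicator_le_self' (fun x _ => hh.nonneg x) x)
        (fun x => indicator_le_self' (fun x _ => hh.nonneg x) x) fun x => ?_
      rcases lt_or_ge x p with h4 | h4
      · exact Or.inr (indicator_of_notMem (by simp; linarith) _)
      · exact Or.inl (indicator_of_notMem (by simpa using h4) _)
    linarith

theorem Confined.mono {V R R' : ℝ} {h : ℝ → ℝ} (hh : Confined V R h) (hR : R ≤ R') :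
    Confined V R' h :=
  ⟨hh.toProfile, fun x hx => hh.zero x fun h1 => hx ⟨h1.1, h1.2.trans hR⟩, hh.volume⟩

/-- If some compactly supported profile has energy less than its volume, then there is a minimizer
among all compactly supported profiles. -/
theorem exists_minimizer_compact {V R : ℝ} {k₀ : ℝ → ℝ} (hV : 0 < V) (hk₀ : Confined V R k₀)
    (hlt : profileEnergy k₀ < V) :
    ∃ R₁ h, Confined V R₁ h ∧ ∀ R k, Confined V R k → profileEnergy h ≤ profileEnergy k := by
  -- Half of the available margin: positive, and below one even if the energy of `k₀` were zero.
  set θ := (1 - profileEnergy k₀ / V) / 2 with hθ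
  have hq1 : profileEnergy k₀ / V < 1 := (div_lt_one hV).2 hlt
  have hq0 : 0 ≤ profileEnergy k₀ / V := div_nonneg (profileEnergy_nonneg hk₀.toProfile) hV.le
  have hkθ : profileEnergy k₀ ≤ (1 - θ) * V := by
    have h1 : profileEnergy k₀ = profileEnergy k₀ / V * V := (div_mul_cancel₀ _ hV.ne').symm
    rw [h1]
    exact mul_le_mul_of_nonneg_right (by linarith) hV.le
  obtain ⟨R₀, hR₀, hgap⟩ := exists_gap hV (by linarith : 0 < θ) (by linarith)
  set R₁ := max R₀ R
  have hR₁ : 0 < R₁ := hR₀.trans_le (le_max_left _ _)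
  obtain ⟨h, hh, hmin⟩ := exists_confined_minimizer hR₁ ⟨k₀, hk₀.mono (le_max_right _ _)⟩
  -- A minimizer on the longer interval does at least as well as `k₀`, so it has a gap; closing the
  -- gap yields a competitor on the interval shorter by one, covered by the induction hypothesis.
  have key : ∀ n : ℕ, ∀ k, Confined V (R₁ + n) k → profileEnergy h ≤ profileEnergy k := by
    intro n
    induction n with
    | zero => simpa using hmin
    | succ n ih =>
      intro k hk
      have hn : (0 : ℝ) ≤ ((n + 1 : ℕ) : ℝ) := Nat.cast_nonneg _
      have hk₁ : Confined V (R₁ + (n + 1 : ℕ)) k₀ :=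
        hk₀.mono (by linarith [le_max_right R₀ R])
      obtain ⟨g, hg, hgmin⟩ := exists_confined_minimizer (by linarith) ⟨k, hk⟩
      obtain ⟨p, hp0, hpR, hp⟩ := hgap _ (by linarith [le_max_left R₀ R]) g hg hgmin
        ((hgmin k₀ hk₁).trans hkθ)
      obtain ⟨g', hg', hle⟩ := exists_closed_gap hg hp0 hpR hp
      have e : R₁ + (n + 1 : ℕ) - 1 = R₁ + n := by push_cast; ring
      rw [e] at hg'
      exact (ih g' hg').trans (hle.trans (hgmin k hk))
  refine ⟨R₁, h, hh, fun R' k hk => ?_⟩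
  obtain ⟨n, hn⟩ := exists_nat_ge (R' - R₁)
  exact key n k (hk.mono (by linarith))

theorem exists_lt_of_integrable {h : ℝ → ℝ} (hi : Integrable h) {s : Set ℝ} (hs : volume s = ⊤)
    {ε : ℝ} (hε : 0 < ε) : ∃ x ∈ s, h x < ε := by
  by_contra! hcon
  have h1 := hi.measure_norm_ge_lt_top hε
  have h2 : s ⊆ {x | ε ≤ ‖h x‖} := fun x hx => (hcon x hx).trans (le_abs_self _)
  exact absurd (measure_mono h2) (by rw [hs]; exact not_le.2 h1)

/-- Compactly supported profiles approximate the energy of a general profile. -/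
theorem exists_confined_approx {V ε : ℝ} {h : ℝ → ℝ} (hV : 0 < V) (hh : Profile h)
    (hvol : ∫ x, h x = V) (hε : 0 < ε) :
    ∃ R k, Confined V R k ∧ profileEnergy k ≤ profileEnergy h + ε := by
  -- Integrability provides cut points far out at which `h` is small, so truncation adds little
  -- variation.
  have ha : ∀ n : ℕ, ∃ x ∈ Iio (-(n : ℝ)), h x < 1 / ((n : ℝ) + 1) := fun n =>
    exists_lt_of_integrable hh.integrable Real.volume_Iio (by positivity)
  have hb : ∀ n : ℕ, ∃ x ∈ Ioi (n : ℝ), h x < 1 / ((n : ℝ) + 1) := fun n =>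
    exists_lt_of_integrable hh.integrable Real.volume_Ioi (by positivity)
  choose a ha1 ha2 using ha
  choose b hb1 hb2 using hb
  have ta : Tendsto a atTop atBot :=
    tendsto_atBot_mono (fun n => (ha1 n).le)
      (tendsto_neg_atTop_atBot.comp tendsto_natCast_atTop_atTop)
  have tb : Tendsto b atTop atTop :=
    tendsto_atTop_mono (fun n => (hb1 n).le) tendsto_natCast_atTop_atTop
  have tv : Tendsto (fun n => ∫ x in a n..b n, h x) atTop (𝓝 V) := by
    rw [← hvol]
    exact intervalIntegral_tendsto_integral hh.integrable ta tb
  -- The factor restores the volume lost by truncation and tends to one; the bracket bounds the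
  -- energy of the truncated profile.
  have te : Tendsto (fun n : ℕ => V / (∫ x in a n..b n, h x) *
      (profileEnergy h + (1 / ((n : ℝ) + 1) + 1 / ((n : ℝ) + 1)))) atTop (𝓝 (profileEnergy h)) := by
    have h1 := (tendsto_const_nhds (x := V)).div tv hV.ne'
    have h2 := (tendsto_one_div_add_atTop_nhds_zero_nat (𝕜 := ℝ))
    have h3 := h1.mul ((h2.add h2).const_add (profileEnergy h))
    rwa [div_self hV.ne', add_zero, add_zero, one_mul] at h3
  obtain ⟨n, hn1, hn2⟩ := ((te.eventually (gt_mem_nhds (lt_add_of_pos_right _ hε))).and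
    (tv.eventually (lt_mem_nhds hV))).exists
  have hab : a n < b n := by
    have h1 : a n < -(n : ℝ) := ha1 n
    have h2 : (n : ℝ) < b n := hb1 n
    have h3 : (0 : ℝ) ≤ n := Nat.cast_nonneg n
    linarith
  obtain ⟨hp, hv⟩ := hh.cut hab
  set k := (Ioo (a n) (b n)).indicator h
  have kint : ∫ x, k x = ∫ x in a n..b n, h x := by
    rw [integral_indicator measurableSet_Ioo, ← integral_Ioc_eq_integral_Ioo,
      ← intervalIntegral.integral_of_le hab.le]
  have kle : ∫ x, k x ≤ V := by
    rw [← hvol]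
    exact integral_mono hp.integrable hh.integrable
      fun x => indicator_le_self' (fun x _ => hh.nonneg x) x
  rw [← kint] at hn1 hn2
  set t := V / ∫ x, k x
  have ht : 1 ≤ t := (one_le_div hn2).2 kle
  have hk' := (hp.translate (a n)).1
  refine ⟨b n - a n, fun x => t * k (x + a n), ⟨(hk'.const_mul (zero_le_one.trans ht)).1,
    fun x hx => ?_, ?_⟩, ?_⟩
  · have : x + a n ∉ Ioo (a n) (b n) := fun h1 => hx ⟨by linarith [h1.1], by linarith [h1.2]⟩
    simp [k, indicator_of_notMem this]
  · rw [integral_const_mul, integral_add_right_eq_self k (a n), div_mul_cancel₀ _ hn2.ne']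
  · refine (profileEnergy_const_mul_le hk' ht).trans (le_trans ?_ hn1.le)
    refine mul_le_mul_of_nonneg_left ?_ (zero_le_one.trans ht)
    have h1 := (hp.translate (a n)).2
    have h2 := elastic_translate_le hp.integrable hp.nonneg (a n)
    have h3 : elastic k ≤ elastic h := elastic_mono hh.integrable hh.nonneg
      fun x => indicator_le_self' (fun x _ => hh.nonneg x) x
    rw [profileEnergy, profileEnergy]
    linarith [cumVar_le_totalVar hh.bv (b n), cumVar_nonneg h (a n), ha2 n, hb2 n]

/-- If some profile has energy less than its volume, then there is a minimizer among all profiles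
of this volume. -/
theorem exists_minimizer {V : ℝ} {k₀ : ℝ → ℝ} (hV : 0 < V) (hk₀ : Profile k₀)
    (hvol : ∫ x, k₀ x = V) (hlt : profileEnergy k₀ < V) :
    ∃ R h, Confined V R h ∧ ∀ k, Profile k → ∫ x, k x = V → profileEnergy h ≤ profileEnergy k := by
  obtain ⟨R, k₁, hk₁, hle⟩ := exists_confined_approx hV hk₀ hvol
    (half_pos (sub_pos.2 hlt))
  obtain ⟨R₁, h, hh, hmin⟩ := exists_minimizer_compact hV hk₁ (by linarith)
  refine ⟨R₁, h, hh, fun k hk hkV => le_of_forall_pos_le_add fun ε hε => ?_⟩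
  obtain ⟨R', k', hk', hle'⟩ := exists_confined_approx hV hk hkV hε
  exact (hmin R' k' hk').trans hle'

/-! ### Return to admissible pairs -/

theorem ofReal_totalVar {h : ℝ → ℝ} (hb : BoundedVariationOn h univ) :
    ENNReal.ofReal (totalVar h) = eVariationOn h univ :=
  ENNReal.ofReal_toReal hb

theorem profile_of_admissible {V : ℝ} {u : ℝ × ℝ → ℝ} {h : ℝ → ℝ} (ha : (u, h) ∈ admissible V) :
    Profile h :=
  ⟨ha.1, ha.2.1, ha.2.2.1, ha.2.2.2.1⟩

theorem ofReal_profileEnergy_le_energy {V : ℝ} {u : ℝ × ℝ → ℝ} {h : ℝ → ℝ}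
    (ha : (u, h) ∈ admissible V) : ENNReal.ofReal (profileEnergy h) ≤ energy (u, h) := by
  have hp := profile_of_admissible ha
  rw [profileEnergy, ENNReal.ofReal_add (elastic_nonneg hp.integrable hp.nonneg)
    (totalVar_nonneg h), ofReal_totalVar hp.bv]
  refine add_le_add ?_ le_rfl
  by_cases htop : elasticEnergy u h = ⊤
  · simp [htop]
  · rw [ENNReal.ofReal_le_iff_le_toReal htop]
    exact elastic_le fun ψ hψ => (ENNReal.ofReal_le_iff_le_toReal htop).1
      (ofReal_dualEnergy_le_elasticEnergy ha hψ)

end IslandFilm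

theorem mainTheorem10 (V : ℝ) (hV : 0 < V)
    (hF : IslandFilm.minEnergy V < ENNReal.ofReal V) :
    ∃ u : ℝ × ℝ → ℝ, ∃ h : ℝ → ℝ,
      (u, h) ∈ IslandFilm.admissible V ∧
        IslandFilm.energy (u, h) = IslandFilm.minEnergy V := by
  obtain ⟨⟨u₀, h₀⟩, ha₀, hlt₀⟩ : ∃ q ∈ IslandFilm.admissible V,
      IslandFilm.energy q < ENNReal.ofReal V := by
    simpa only [IslandFilm.minEnergy, iInf_lt_iff, exists_prop] using hF
  have hp₀ := IslandFilm.profile_of_admissible ha₀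
  have hlt : IslandFilm.profileEnergy h₀ < V :=
    (ENNReal.ofReal_lt_ofReal_iff hV).1
      ((IslandFilm.ofReal_profileEnergy_le_energy ha₀).trans_lt hlt₀)
  obtain ⟨R, h, hh, hmin⟩ := IslandFilm.exists_minimizer hV hp₀ ha₀.2.2.2.2.2.1 hlt
  -- A zero of the profile bounds its height by its variation, as required for the reconstruction of
  -- the displacement.
  have hz : h (R + 1) = 0 := hh.zero _ fun h1 => by linarith [h1.2]
  obtain ⟨u, hu, htr, hel⟩ := IslandFilm.exists_displacement hh.lsc hh.nonneg hh.integrable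
    (IslandFilm.le_totalVar_of_zero hh.bv hz) hh.zero
  have ha : (u, h) ∈ IslandFilm.admissible V :=
    ⟨hh.integrable, hh.bv, hh.lsc, hh.nonneg, hu, hh.volume, htr⟩
  refine ⟨u, h, ha, le_antisymm (le_iInf₂ ?_) (iInf₂_le _ ha)⟩
  rintro ⟨w, k⟩ hk
  have hkp := IslandFilm.profile_of_admissible hk
  calc IslandFilm.energy (u, h) ≤ ENNReal.ofReal (IslandFilm.profileEnergy h) := by
        rw [IslandFilm.profileEnergy, ENNReal.ofReal_add
          (IslandFilm.elastic_nonneg hh.integrable hh.nonneg) (IslandFilm.totalVar_nonneg h),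
          IslandFilm.ofReal_totalVar hh.bv]
        exact add_le_add hel le_rfl
    _ ≤ ENNReal.ofReal (IslandFilm.profileEnergy k) :=
        ENNReal.ofReal_le_ofReal (hmin k hkp hk.2.2.2.2.2.1)
    _ ≤ IslandFilm.energy (w, k) := IslandFilm.ofReal_profileEnergy_le_energy hk
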